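/- Let $M$ be a compact smooth surface, let $r\ge 5$ be an integer, and let $\mathcal I^r$ be the set of $C^r$ immersions $M\to\mathbb R^3$, an open subset of the space $C^r(M,\mathbb R^3)$ with its $C^r$ norm. Let $\alpha\in\mathcal I^r$ have an umbilic point $p$ of type $D^1_{2,3}$. Then there are an open neighbourhood $\mathcal V\subset\mathcal I^r$ of $\alpha$, an open neighbourhood $V$ of $p$ in $M$, and a function $\mathcal B:\mathcal V\to\mathbb R$ of class $C^{r-3}$ such that 1. $d\mathcal B(\alpha)\neq 0$; and, for every $\beta\in\mathcal V$, 2. $\mathcal B(\beta)>0$ if and only if $\beta$ has no umbilic point in $V$; 3. $\mathcal B(\beta)<0$ if and only if $\beta$ has exactly two umbilic points in $V$, one Darbouxian of type $D_2$ and the other Darbouxian of type $D_3$; 4. $\mathcal B(\beta)=0$ if and only if $\beta$ has exactly one umbilic point in $V$, and it is of type $D^1_{2,3}$. Here the notions are the following. Let $\mathcal H$ and $\mathcal K$ be the mean and Gaussian curvatures; an umbilic point is a point where $\mathcal H^2-\mathcal K=0$. In a chart $(u,v)$, with first and second fundamental forms $E\,du^2+2F\,du\,dv+G\,dv^2$ and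 $e\,du^2+2f\,du\,dv+g\,dv^2$, put $$\mathcal T(u,v,p)=(Fg-Gf)p^2+(Eg-Ge)p+(Ef-Fe),\qquad p=dv/du .$$ The variety $\mathbb L_\beta=\{\mathcal T=0\}$ of principal directions lies in the projective tangent bundle and contains the projective line over every umbilic point. The lifted line field on $\mathbb L_\beta$ is generated by the vector field $(\mathcal T_p,\;p\mathcal T_p,\;-(\mathcal T_u+p\mathcal T_v))$. Around $p=\infty$ one uses the analogous expressions in the coordinate $q=du/dv$. $\mathbb L_\beta$ is regular at a point of it if $d\mathcal T\ne0$ there; at a regular point where the vector field vanishes, its linear part acts on the tangent plane $\ker d\mathcal T$, and the singularity is a hyperbolic saddle (node) if the two eigenvalues of this action are real, non-zero and of opposite (equal) signs. An umbilic point $q$ is - Darbouxian of type $D_2$ if $\mathbb L_\beta$ is regular along the whole projective line over $q$ and the lifted line field has exactly three singularities there, one hyperbolic node and two hyperbolic saddles; - Darbouxian of type $D_3$ if $\mathbb L_\beta$ is regular along the whole projective line over $q$ and the lifted line field has exactly three singularities there, all of them hyperbolic saddles; - of type $D^1_{2,3}$ if, on the projective line over $q$, $\mathbb L_\beta$ fails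 to be regular at exactly two points, at both of these points the Hessian of $\mathcal T$ is non-degenerate (Morse type), and the lifted line field has a further singularity at a point where $\mathbb L_\beta$ is regular. -/

import Mathlib

open scoped Manifold ContDiff

noncomputable section

namespace UmbilicBifurcation

/-- The coordinate plane. -/
abbrev Plane : Type := EuclideanSpace ℝ (Fin 2)

/-- Euclidean three-space, the target of the immersions. -/
abbrev Space : Type := EuclideanSpace ℝ (Fin 3)

/-! ### Fundamental forms of a parametrized surface `f : (u, v) ↦ f (u, v)` -/

/-- The partial derivative of `f` in the `i`-th coordinate direction. -/
def partialD (i : Fin 2) (f : Plane → Space) (x : Plane) : Space :=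
  fderiv ℝ f x (EuclideanSpace.single i 1)

/-- The vector product of Euclidean three-space. -/
def vecProd (a b : Space) : Space :=
  WithLp.toLp 2 (crossProduct (WithLp.ofLp a) (WithLp.ofLp b))

/-- The unit normal `N = (f_u ∧ f_v) / |f_u ∧ f_v|`. -/
def unitNormal (f : Plane → Space) (x : Plane) : Space :=
  ‖vecProd (partialD 0 f x) (partialD 1 f x)‖⁻¹ • vecProd (partialD 0 f x) (partialD 1 f x)

/-- Coefficients of the first fundamental form: `E`, `F`, `G` are the entries
`(0, 0)`, `(0, 1)`, `(1, 1)`. -/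
def firstForm (f : Plane → Space) (x : Plane) : Matrix (Fin 2) (Fin 2) ℝ :=
  Matrix.of fun i j => inner ℝ (partialD i f x) (partialD j f x)

/-- Coefficients of the second fundamental form: `e`, `f`, `g` are the entries
`(0, 0)`, `(0, 1)`, `(1, 1)`. -/
def secondForm (f : Plane → Space) (x : Plane) : Matrix (Fin 2) (Fin 2) ℝ :=
  Matrix.of fun i j => inner ℝ (unitNormal f x) (partialD i (partialD j f) x)

/-- The matrix of `-ω`, where `ω` is the Weingarten endomorphism, in the basis `∂_u, ∂_v`. -/
def shapeMatrix (f : Plane → Space) (x : Plane) : Matrix (Fin 2) (Fin 2) ℝ :=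
  (firstForm f x)⁻¹ * secondForm f x

/-- Gaussian curvature. -/
def gaussCurv (f : Plane → Space) (x : Plane) : ℝ := (shapeMatrix f x).det

/-- Mean curvature. -/
def meanCurv (f : Plane → Space) (x : Plane) : ℝ := (shapeMatrix f x).trace / 2

/-- Umbilic points: `H ^ 2 - K = 0`. -/
def LocUmbilic (f : Plane → Space) (x : Plane) : Prop :=
  meanCurv f x ^ 2 - gaussCurv f x = 0

/-! ### The variety of principal directions and its Lie-Cartan vector field -/

/-- The numerator of the geodesic torsion in the direction `w = (du, dv)`:
`(F g - G f) dv² + (E g - G e) du dv + (E f - F e) du²`. -/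
def torsionForm (f : Plane → Space) (x w : Plane) : ℝ :=
  (firstForm f x 0 1 * secondForm f x 1 1 - firstForm f x 1 1 * secondForm f x 0 1) * w 1 ^ 2
  + (firstForm f x 0 0 * secondForm f x 1 1 - firstForm f x 1 1 * secondForm f x 0 0)
      * (w 0 * w 1)
  + (firstForm f x 0 0 * secondForm f x 0 1 - firstForm f x 0 1 * secondForm f x 0 0) * w 0 ^ 2

/-- The projective line over a point is `OnePoint ℝ`, the finite points being the slopes
`p = dv/du`. A finite point is studied in the affine chart `(u, v; p)`, whose value `s` of the
fibre coordinate stands for the direction `(1, s)`; the point at infinity is studied in the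
affine chart `(u, v; q = du/dv)`, where `s` stands for the direction `(s, 1)`. -/
def affineDir : OnePoint ℝ → ℝ → Plane
  | OnePoint.some _ => fun s => !₂[1, s]
  | OnePoint.infty => fun s => !₂[s, 1]

/-- The fibre coordinate of a point of the projective line in the affine chart used for it. -/
def affineCoord : OnePoint ℝ → ℝ
  | OnePoint.some p => p
  | OnePoint.infty => 0

/-- The function `𝒯` whose zero set is the variety of principal directions, in the affine chart
used around the fibre point `l`: `L p² + M p + N`, respectively `L + M q + N q²`. -/
def liftFun (f : Plane → Space) (l : OnePoint ℝ) (z : Plane × ℝ) : ℝ :=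
  torsionForm f z.1 (affineDir l z.2)

/-- The Lie-Cartan vector field, in the affine chart used around `l`:
`(𝒯_p, p 𝒯_p, -(𝒯_u + p 𝒯_v))`, respectively `(q 𝒯_q, 𝒯_q, -(q 𝒯_u + 𝒯_v))`. It generates the
lifted line field. -/
def lieCartan (f : Plane → Space) (l : OnePoint ℝ) (z : Plane × ℝ) : Plane × ℝ :=
  (fderiv ℝ (liftFun f l) z (0, 1) • affineDir l z.2,
    -fderiv ℝ (liftFun f l) z (affineDir l z.2, 0))

/-- The variety of principal directions is regular at the fibre point `l` over `x`. -/
def RegularAt (f : Plane → Space) (x : Plane) (l : OnePoint ℝ) : Prop :=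
  fderiv ℝ (liftFun f l) (x, affineCoord l) ≠ 0

/-- The Hessian of `𝒯` is non-degenerate at the fibre point `l` over `x`. -/
def HessianNondegenerateAt (f : Plane → Space) (x : Plane) (l : OnePoint ℝ) : Prop :=
  ∀ v : Plane × ℝ,
    (∀ w : Plane × ℝ,
      fderiv ℝ (fderiv ℝ (liftFun f l)) (x, affineCoord l) v w = 0) → v = 0

/-- The fibre point `l` over `x` is a singularity of the lifted line field. -/
def SingularAt (f : Plane → Space) (x : Plane) (l : OnePoint ℝ) : Prop :=
  lieCartan f l (x, affineCoord l) = 0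

/-- The linear part of the Lie-Cartan vector field at the fibre point `l` over `x`, restricted to
the tangent plane `ker d𝒯` of the variety, is triangular with diagonal `μ, ν` in a suitable basis
`v, w` of that plane; that is, its eigenvalues are the real numbers `μ, ν`, counted with
multiplicity. (Used at points where the variety is regular.) -/
def TangentEigenvalues (f : Plane → Space) (x : Plane) (l : OnePoint ℝ) (μ ν : ℝ) : Prop :=
  ∃ v w : Plane × ℝ, LinearIndependent ℝ ![v, w] ∧
    fderiv ℝ (liftFun f l) (x, affineCoord l) v = 0 ∧
    fderiv ℝ (liftFun f l) (x, affineCoord l) w = 0 ∧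
    fderiv ℝ (lieCartan f l) (x, affineCoord l) v = μ • v ∧
    ∃ c : ℝ, fderiv ℝ (lieCartan f l) (x, affineCoord l) w = c • v + ν • w

/-- Hyperbolic saddle of the lifted line field. -/
def SaddleAt (f : Plane → Space) (x : Plane) (l : OnePoint ℝ) : Prop :=
  RegularAt f x l ∧ SingularAt f x l ∧ ∃ μ ν : ℝ, μ * ν < 0 ∧ TangentEigenvalues f x l μ ν

/-- Hyperbolic node of the lifted line field. -/
def NodeAt (f : Plane → Space) (x : Plane) (l : OnePoint ℝ) : Prop :=
  RegularAt f x l ∧ SingularAt f x l ∧ ∃ μ ν : ℝ, 0 < μ * ν ∧ TangentEigenvalues f x l μ ν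

/-- Condition `T`: the variety is regular along the whole projective line over `x`. -/
def ConditionT (f : Plane → Space) (x : Plane) : Prop :=
  ∀ l : OnePoint ℝ, RegularAt f x l

/-- Darbouxian umbilic of type `D₂`: one node and two saddles. -/
def LocD2 (f : Plane → Space) (x : Plane) : Prop :=
  LocUmbilic f x ∧ ConditionT f x ∧
    ∃ l₀ l₁ l₂ : OnePoint ℝ, l₀ ≠ l₁ ∧ l₀ ≠ l₂ ∧ l₁ ≠ l₂ ∧
      {l | SingularAt f x l} = {l₀, l₁, l₂} ∧
      NodeAt f x l₀ ∧ SaddleAt f x l₁ ∧ SaddleAt f x l₂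

/-- Darbouxian umbilic of type `D₃`: three saddles. -/
def LocD3 (f : Plane → Space) (x : Plane) : Prop :=
  LocUmbilic f x ∧ ConditionT f x ∧
    ∃ l₀ l₁ l₂ : OnePoint ℝ, l₀ ≠ l₁ ∧ l₀ ≠ l₂ ∧ l₁ ≠ l₂ ∧
      {l | SingularAt f x l} = {l₀, l₁, l₂} ∧
      SaddleAt f x l₀ ∧ SaddleAt f x l₁ ∧ SaddleAt f x l₂

/-- Umbilic of type `D¹₂,₃`: condition `T` fails exactly at two points of the projective line over
`x`, the variety is of Morse type at both, and the lifted line field has a further singularity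
over `x`, on the regular portion of the variety. -/
def LocD123 (f : Plane → Space) (x : Plane) : Prop :=
  LocUmbilic f x ∧
    (∃ l₁ l₂ : OnePoint ℝ, l₁ ≠ l₂ ∧ {l | ¬ RegularAt f x l} = {l₁, l₂} ∧
      HessianNondegenerateAt f x l₁ ∧ HessianNondegenerateAt f x l₂) ∧
    ∃ l₀ : OnePoint ℝ, SingularAt f x l₀ ∧ RegularAt f x l₀

/-! ### Immersions of a compact surface -/

section Surface

variable (M : Type*) [TopologicalSpace M] [ChartedSpace Plane M]

/-- Finitely many coordinate compacta whose interiors cover `M`. -/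
structure CompactChartCover where
  /-- the centres of the charts in use -/
  centers : Finset M
  /-- the coordinate compactum at each centre -/
  cpt : M → Set M
  isCompact_cpt : ∀ c, IsCompact (cpt c)
  cpt_subset : ∀ c, cpt c ⊆ (chartAt Plane c).source
  covers : ∀ x, ∃ c ∈ centers, x ∈ interior (cpt c)

theorem nonempty_compactChartCover [CompactSpace M] : Nonempty (CompactChartCover M) := by
  have : LocallyCompactSpace M := ChartedSpace.locallyCompactSpace Plane M
  have h : ∀ c : M, ∃ K : Set M, IsCompact K ∧ c ∈ interior K ∧ K ⊆ (chartAt Plane c).source :=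
    fun c => exists_compact_subset (chartAt Plane c).open_source (mem_chart_source Plane c)
  choose K hK hc hs using h
  obtain ⟨t, ht⟩ := isCompact_univ.elim_finite_subcover (fun c : M => interior (K c))
    (fun c => isOpen_interior) (fun x _ => Set.mem_iUnion.2 ⟨x, hc x⟩)
  refine ⟨⟨t, K, hK, hs, fun x => ?_⟩⟩
  have hx := ht (Set.mem_univ x)
  simp only [Set.mem_iUnion] at hx
  obtain ⟨c, hct, hxc⟩ := hx
  exact ⟨c, hct, hxc⟩

/-- The cover used to define the `C^r` norm; another one gives an equivalent norm. -/
def chosenCover [CompactSpace M] : CompactChartCover M :=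
  Classical.choice (nonempty_compactChartCover M)

/-- The coordinate image of one of the compacta of the chosen cover. -/
def coordCpt [CompactSpace M] (c : M) : Set Plane :=
  chartAt Plane c '' (chosenCover M).cpt c

instance instCompactSpaceCoordCpt [CompactSpace M] (c : M) : CompactSpace (coordCpt M c) :=
  isCompact_iff_compactSpace.1 (((chosenCover M).isCompact_cpt c).image_of_continuousOn
    ((chartAt Plane c).continuousOn.mono ((chosenCover M).cpt_subset c)))

/-- The vector space of `C^r` maps from the surface `M` to Euclidean three-space. -/
def CrMap (r : ℕ) : Type _ :=
  ContMDiffMap (𝓡 2) 𝓘(ℝ, Space) M Space (r : WithTop ℕ∞)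

variable {M} {r : ℕ}

instance instCoeFunCrMap : CoeFun (CrMap M r) fun _ => M → Space where
  coe f := f.1

instance instAddCommGroupCrMap : AddCommGroup (CrMap M r) :=
  inferInstanceAs (AddCommGroup (ContMDiffMap (𝓡 2) 𝓘(ℝ, Space) M Space (r : WithTop ℕ∞)))

instance instModuleCrMap : Module ℝ (CrMap M r) :=
  inferInstanceAs (Module ℝ (ContMDiffMap (𝓡 2) 𝓘(ℝ, Space) M Space (r : WithTop ℕ∞)))

theorem contDiffOn_coord [IsManifold (𝓡 2) ∞ M] (f : CrMap M r) (c : M) :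
    ContDiffOn ℝ r (f ∘ (chartAt Plane c).symm) (chartAt Plane c).target := by
  have : IsManifold (𝓡 2) (r : WithTop ℕ∞) M :=
    IsManifold.of_le (n := ∞) (by exact_mod_cast le_top)
  rw [← contMDiffOn_iff_contDiffOn]
  exact (ContMDiffMap.contMDiff f).comp_contMDiffOn contMDiffOn_chart_symm

theorem coordCpt_subset [CompactSpace M] (c : M) :
    coordCpt M c ⊆ (chartAt Plane c).target := by
  rintro _ ⟨x, hx, rfl⟩
  exact (chartAt Plane c).map_source ((chosenCover M).cpt_subset c hx)

theorem contDiffAt_coord [CompactSpace M] [IsManifold (𝓡 2) ∞ M] (f : CrMap M r) (c : M)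
    (y : coordCpt M c) : ContDiffAt ℝ r (f ∘ (chartAt Plane c).symm) y :=
  (contDiffOn_coord f c).contDiffAt
    ((chartAt Plane c).open_target.mem_nhds (coordCpt_subset c y.2))

/-- Continuous functions on a coordinate compactum with values in the `j`-linear maps, with the
supremum norm. -/
abbrev JetFun (M : Type*) [TopologicalSpace M] [ChartedSpace Plane M] [CompactSpace M]
    (c : M) (j : ℕ) : Type :=
  C(coordCpt M c, ContinuousMultilinearMap ℝ (fun _ : Fin j => Plane) Space)

/-- Families of such functions, indexed by the compacta of the chosen cover and by the orders
`j ≤ r`, with the largest of the supremum norms. -/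
def JetSpace (M : Type*) [TopologicalSpace M] [ChartedSpace Plane M] [CompactSpace M]
    (r : ℕ) : Type _ :=
  (c : (chosenCover M).centers) → (j : Fin (r + 1)) → JetFun M (c : M) (j : ℕ)

instance instNormedAddCommGroupJetSpace [CompactSpace M] : NormedAddCommGroup (JetSpace M r) :=
  @Pi.normedAddCommGroup _ _ _ fun c => @Pi.normedAddCommGroup _ _ _ fun j =>
    (inferInstance : NormedAddCommGroup (JetFun M (c : M) (j : ℕ)))

instance instNormedSpaceJetSpace [CompactSpace M] : NormedSpace ℝ (JetSpace M r) :=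
  @Pi.normedSpace _ _ _ _ _ _ fun c => @Pi.normedSpace _ _ _ _ _ _ fun j =>
    (inferInstance : NormedSpace ℝ (JetFun M (c : M) (j : ℕ)))

/-- All coordinate derivatives of order at most `r` on the compacta of the chosen cover. -/
def jetMap (M : Type*) [TopologicalSpace M] [ChartedSpace Plane M] [CompactSpace M]
    [IsManifold (𝓡 2) ∞ M] (r : ℕ) : CrMap M r →ₗ[ℝ] JetSpace M r where
  toFun f c j :=
    { toFun := fun y => iteratedFDeriv ℝ j (f ∘ (chartAt Plane (c : M)).symm) y
      continuous_toFun := by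
        rw [continuous_iff_continuousAt]
        intro y
        have h1 := (contDiffAt_coord f c y).continuousAt_iteratedFDeriv (k := j)
          (by exact_mod_cast Nat.lt_succ_iff.1 j.2)
        exact ContinuousAt.comp (f := fun y : coordCpt M (c : M) => (y : Plane)) h1
          continuous_subtype_val.continuousAt }
  map_add' f g := by
    funext c j
    refine ContinuousMap.ext fun y => ?_
    exact iteratedFDeriv_add_apply
      ((contDiffAt_coord f c y).of_le (by exact_mod_cast Nat.lt_succ_iff.1 j.2))
      ((contDiffAt_coord g c y).of_le (by exact_mod_cast Nat.lt_succ_iff.1 j.2))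
  map_smul' a f := by
    funext c j
    refine ContinuousMap.ext fun y => ?_
    exact iteratedFDeriv_const_smul_apply
      ((contDiffAt_coord f c y).of_le (by exact_mod_cast Nat.lt_succ_iff.1 j.2))

theorem jetMap_injective [CompactSpace M] [IsManifold (𝓡 2) ∞ M] :
    Function.Injective (jetMap M r) := by
  intro f g h
  refine ContMDiffMap.coe_injective (I := 𝓡 2) (I' := 𝓘(ℝ, Space)) ?_
  funext x
  obtain ⟨c, hc, hx⟩ := (chosenCover M).covers x
  have hxK := interior_subset hx
  have hxs := (chosenCover M).cpt_subset c hxK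
  have h1 := congrFun (congrFun h ⟨c, hc⟩) 0
  have h2 := DFunLike.congr_fun h1 ⟨chartAt Plane c x, ⟨x, hxK, rfl⟩⟩
  have h3 := DFunLike.congr_fun h2 (fun _ => 0)
  have h4 : f ((chartAt Plane c).symm (chartAt Plane c x))
      = g ((chartAt Plane c).symm (chartAt Plane c x)) := h3
  rwa [(chartAt Plane c).left_inv hxs] at h4

/-- The `C^r` norm: the largest supremum of a coordinate derivative of order at most `r` on one of
the compacta of the chosen cover. It induces the `C^r` topology. -/
instance instNormedAddCommGroupCrMap [CompactSpace M] [IsManifold (𝓡 2) ∞ M] :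
    NormedAddCommGroup (CrMap M r) :=
  NormedAddCommGroup.induced (CrMap M r) _ (jetMap M r) jetMap_injective

instance instNormedSpaceCrMap [CompactSpace M] [IsManifold (𝓡 2) ∞ M] :
    NormedSpace ℝ (CrMap M r) :=
  NormedSpace.induced ℝ (CrMap M r) _ (jetMap M r)

variable (M r) in
/-- The set `ℐ^r` of `C^r` immersions of `M` into Euclidean three-space. -/
def immersions : Set (CrMap M r) :=
  {f | ∀ x : M, Function.Injective (mfderiv (𝓡 2) 𝓘(ℝ, Space) f x)}

/-- The local property `P` holds for `f` at `q` in a smooth chart around `q`. The properties it is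
applied to below do not depend on the chart. -/
def InChart (P : (Plane → Space) → Plane → Prop) (f : CrMap M r) (q : M) : Prop :=
  ∃ φ ∈ IsManifold.maximalAtlas (𝓡 2) ∞ M, q ∈ φ.source ∧ P (f ∘ φ.symm) (φ q)

/-- The set of umbilic points of `f`. -/
def umbilicSet (f : CrMap M r) : Set M := {q | InChart LocUmbilic f q}

/-- `q` is a Darbouxian umbilic of `f` of type `D₂`. -/
def IsD2 (f : CrMap M r) (q : M) : Prop := InChart LocD2 f q

/-- `q` is a Darbouxian umbilic of `f` of type `D₃`. -/
def IsD3 (f : CrMap M r) (q : M) : Prop := InChart LocD3 f q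

/-- `q` is an umbilic of `f` of type `D¹₂,₃`. -/
def IsD123 (f : CrMap M r) (q : M) : Prop := InChart LocD123 f q

end Surface

end UmbilicBifurcation

end

noncomputable section

namespace UmbilicBifurcation

open Set Filter Topology

/-! In a chart, write L, M, N for the coefficients of dv², du dv, du² in `torsionForm`. The relation
E L - F M + G N = 0 makes the umbilic points of an immersion the common zeros of M and N
(`locUmbilic_iff`). At such a point the first derivatives of L, M, N form a quadratic form Q on
directions with values in covectors. The nonregular points of the fibre are the zeros of Q, and the
singularities of the lifted field are the zeros of the cubic w ↦ Q(w)(w). At a singularity the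
eigenvalues are, up to a common factor, -(A + P) and P, where A = Q(w)(rot w) and P is the
derivative of w ↦ Q(w) in the direction rot w, evaluated on w.

At a D¹₂,₃ point Q is a product q ⊗ ξ of a scalar quadratic form and one covector. The two
nonregular points are simple roots of q, and the further singularity is the kernel of ξ. Hence the
cubic has three simple roots and d(M, N) has rank one. The Morse condition says that the planar map
(M, N) has a fold: its second derivative along ker ξ leaves the image of its differential
(`SmoothUmbilicAt.exists_of_locD123`; `SmoothUmbilicAt.locD123` is the way back).

For a family of folds, one combination of M and N is solved for one variable. The other combination,
restricted to the resulting curve, is a function with a single nondegenerate minimum, and the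
bifurcation function is the minimum value. Its sign decides whether there are zero, one or two
zeros, and the Jacobian of the map has opposite signs at the two zeros (`exists_fold`,
`exists_planar_fold`).

The types follow from signs. Simple roots of the cubic persist (`GoodDirs.eventually`), and
`cquad_mul_cpolar` gives the product A P the sign opposite to the Jacobian J. Near the roots of q
the number P dominates A, so both singularities are saddles. Near ker ξ the number A dominates P, so
the singularity is a node for J > 0 and a saddle for J < 0. One of the two zeros is thus D₂ and the
other D₃. When the minimum value is zero, J = 0 and the fold condition, being open, gives D¹₂,₃
again.

The evaluation (β, x) ↦ β(x) is of class C^r, so M and N are of class C^(r-2) in both variables. The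
minimum point solves an equation between their first derivatives, whence the class C^(r-3). The
differential is nonzero because a bump in the normal direction moves the 2-jet of α transversally to
the fold (`coef_add_smul_bend`). -/

theorem contDiffOn_nat_succ_of_hasFDerivAt {E F : Type*} [NormedAddCommGroup E] [NormedSpace ℝ E]
    [NormedAddCommGroup F] [NormedSpace ℝ F] {O : Set E} {k : ℕ} {f : E → F} {f' : E → E →L[ℝ] F}
    (hO : IsOpen O) (h : ∀ x ∈ O, HasFDerivAt f (f' x) x)
    (h' : ContDiffOn ℝ (k : WithTop ℕ∞) f' O) :
    ContDiffOn ℝ ((k + 1 : ℕ) : WithTop ℕ∞) f O := by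
  rw [Nat.cast_add, Nat.cast_one, contDiffOn_succ_iff_hasFDerivWithinAt_of_uniqueDiffOn
    hO.uniqueDiffOn]
  exact ⟨by simp, f', h', fun x hx => (h x hx).hasFDerivWithinAt⟩

/-! ### A scalar implicit function theorem with parameters in an arbitrary normed space -/

section Implicit

variable {Z : Type*} [NormedAddCommGroup Z] [NormedSpace ℝ Z]

/-- Only continuity of the implicit function is assumed. The expansion of the constant F along the
graph reads A(dz) + dY = o(|dz| + |dY|), and the dY on the right can be absorbed. -/
theorem hasFDerivAt_of_implicit {F : Z × ℝ → ℝ} {Y : Z → ℝ} {z : Z}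
    (hF : DifferentiableAt ℝ F (z, Y z)) (hY : ContinuousAt Y z)
    (ha : fderiv ℝ F (z, Y z) (0, 1) ≠ 0) (h0 : ∀ᶠ z' in 𝓝 z, F (z', Y z') = F (z, Y z)) :
    HasFDerivAt Y (-(fderiv ℝ F (z, Y z) (0, 1))⁻¹ •
      (fderiv ℝ F (z, Y z)).comp (ContinuousLinearMap.inl ℝ Z ℝ)) z := by
  set D := fderiv ℝ F (z, Y z) with hD
  set a := D (0, 1) with hadef
  set A : Z →L[ℝ] ℝ := a⁻¹ • D.comp (ContinuousLinearMap.inl ℝ Z ℝ) with hA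
  have hsplit : ∀ (ζ : Z) (y : ℝ), D (ζ, y) = a * (A ζ + y) := by
    intro ζ y
    have : ((ζ, y) : Z × ℝ) = (ζ, 0) + y • (0, 1) := by simp
    rw [this, map_add, map_smul, hA]
    simp only [smul_eq_mul, smul_apply, ContinuousLinearMap.comp_apply,
      ContinuousLinearMap.inl_apply]
    field_simp
    rw [hadef]
  have hcont : Tendsto (fun z' => (z', Y z')) (𝓝 z) (𝓝 (z, Y z)) :=
    tendsto_id.prodMk_nhds hY
  have h1 := (hasFDerivAt_iff_isLittleO.1 hF.hasFDerivAt).comp_tendsto hcont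
  have h2 : (fun z' => A (z' - z) + (Y z' - Y z)) =o[𝓝 z]
      fun z' => ((z' - z, Y z' - Y z) : Z × ℝ) := by
    have h3 : (fun z' => -a * (A (z' - z) + (Y z' - Y z))) =o[𝓝 z]
        fun z' => ((z' - z, Y z' - Y z) : Z × ℝ) := by
      refine h1.congr' ?_ ?_
      · filter_upwards [h0] with z' hz'
        simp only [Function.comp, hz', sub_self, Prod.mk_sub_mk]
        rw [← hD, hsplit]; ring
      · exact Eventually.of_forall fun z' => rfl
    have h4 := h3.const_mul_left (-a⁻¹)
    refine h4.congr_left fun z' => ?_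
    field_simp
  have h5 : (fun z' => ((z' - z, Y z' - Y z) : Z × ℝ)) =O[𝓝 z] fun z' => z' - z := by
    -- If |dY| is the larger entry, the bound with factor 1/2 gives |dY| ≤ 2‖A‖ |dz|; otherwise the
    -- constant 1 suffices.
    refine Asymptotics.IsBigO.of_bound (2 * ‖A‖ + 1) ?_
    filter_upwards [h2.def (c := 1 / 2) (by norm_num)] with z' hz'
    have hAz : |A (z' - z)| ≤ ‖A‖ * ‖z' - z‖ := A.le_opNorm _
    have hn := norm_nonneg (z' - z)
    have hAn : 0 ≤ ‖A‖ * ‖z' - z‖ := mul_nonneg (norm_nonneg _) hn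
    simp only [Prod.norm_def, Real.norm_eq_abs] at hz' ⊢
    have hle : |Y z' - Y z| ≤ |A (z' - z) + (Y z' - Y z)| + |A (z' - z)| := by
      have := abs_sub (A (z' - z) + (Y z' - Y z)) (A (z' - z))
      simpa using this
    rcases max_cases ‖z' - z‖ |Y z' - Y z| with ⟨hm, hm'⟩ | ⟨hm, hm'⟩ <;> rw [hm] at hz' ⊢ <;>
      nlinarith
  refine hasFDerivAt_iff_isLittleO.2 ((h2.trans_isBigO h5).congr_left fun z' => ?_)
  simp only [hA, neg_smul, neg_apply]
  ring

/-- The unknown is scalar, so strict monotonicity in y and the intermediate value theorem replace a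
contraction argument, and `Z` need not be complete. -/
theorem exists_implicit {F : Z × ℝ → ℝ} {Ω : Set (Z × ℝ)} {n : ℕ} (hΩ : IsOpen Ω)
    (hF : ContDiffOn ℝ ((n + 1 : ℕ) : WithTop ℕ∞) F Ω) {z₀ : Z} {y₀ : ℝ} (h0 : (z₀, y₀) ∈ Ω)
    (hF0 : F (z₀, y₀) = 0) (hd : 0 < fderiv ℝ F (z₀, y₀) (0, 1)) :
    ∃ (O : Set Z) (η : ℝ) (Y : Z → ℝ), IsOpen O ∧ z₀ ∈ O ∧ 0 < η ∧ Y z₀ = y₀ ∧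
      (∀ z ∈ O, ∀ y, |y - y₀| ≤ η → (z, y) ∈ Ω ∧ 0 < fderiv ℝ F (z, y) (0, 1)) ∧
      ContDiffOn ℝ ((n + 1 : ℕ) : WithTop ℕ∞) Y O ∧
      ∀ z ∈ O, |Y z - y₀| < η ∧ ∀ y, |y - y₀| ≤ η → (F (z, y) = 0 ↔ y = Y z) := by
  have hFd : ContDiffOn ℝ (n : WithTop ℕ∞) (fderiv ℝ F) Ω :=
    hF.fderiv_of_isOpen hΩ (by norm_cast)
  have hpos : {q | q ∈ Ω ∧ 0 < fderiv ℝ F q (0, 1)} ∈ 𝓝 (z₀, y₀) := by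
    have hc : ContinuousAt (fun q => fderiv ℝ F q (0, 1)) (z₀, y₀) :=
      ((hFd.continuousOn.continuousAt (hΩ.mem_nhds h0)).clm_apply continuousAt_const)
    filter_upwards [hΩ.mem_nhds h0, hc.eventually (lt_mem_nhds hd)] with q h1 h2 using ⟨h1, h2⟩
  obtain ⟨O₁, hO₁, S, hS, hOS⟩ := mem_nhds_prod_iff.1 hpos
  obtain ⟨η, hη, hball⟩ := Metric.nhds_basis_closedBall.mem_iff.1 hS
  obtain ⟨O₂, hO₂, hO₂o, hzO₂⟩ := mem_nhds_iff.1 hO₁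
  have hbox : ∀ z ∈ O₂, ∀ y, |y - y₀| ≤ η → (z, y) ∈ Ω ∧ 0 < fderiv ℝ F (z, y) (0, 1) :=
    fun z hz y hy => hOS ⟨hO₂ hz, hball (by rwa [Metric.mem_closedBall, Real.dist_eq])⟩
  have hderiv : ∀ z ∈ O₂, ∀ y, |y - y₀| ≤ η →
      HasDerivAt (fun y => F (z, y)) (fderiv ℝ F (z, y) (0, 1)) y := by
    intro z hz y hy
    have h1 : HasFDerivAt F (fderiv ℝ F (z, y)) (z, y) :=
      (hF.contDiffAt (hΩ.mem_nhds (hbox z hz y hy).1)).differentiableAt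
        (by simp) |>.hasFDerivAt
    exact h1.comp_hasDerivAt y ((hasDerivAt_const y z).prodMk (hasDerivAt_id y))
  have hmono : ∀ z ∈ O₂, StrictMonoOn (fun y => F (z, y)) (Icc (y₀ - η) (y₀ + η)) := by
    intro z hz
    refine strictMonoOn_of_deriv_pos (convex_Icc _ _) ?_ ?_
    · intro y hy
      exact (hderiv z hz y (abs_le.2 ⟨by linarith [hy.1], by linarith [hy.2]⟩)).continuousAt
        |>.continuousWithinAt
    · intro y hy
      rw [interior_Icc] at hy
      have hy' : |y - y₀| ≤ η := abs_le.2 ⟨by linarith [hy.1], by linarith [hy.2]⟩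
      rw [(hderiv z hz y hy').deriv]
      exact (hbox z hz y hy').2
  have hcz : ∀ y, |y - y₀| ≤ η → ContinuousOn (fun z => F (z, y)) O₂ := by
    intro y hy
    exact hF.continuousOn.comp (by fun_prop) fun z hz => (hbox z hz y hy).1
  have hη' : |y₀ + η - y₀| ≤ η := by simp [abs_of_pos hη]
  have hη'' : |y₀ - η - y₀| ≤ η := by simp [abs_of_pos hη]
  -- On this open set F has opposite signs at the two ends of the y-interval, which traps exactly
  -- one zero.
  set O := (O₂ ∩ (fun z => F (z, y₀ + η)) ⁻¹' Ioi 0) ∩ (O₂ ∩ (fun z => F (z, y₀ - η)) ⁻¹' Iio 0)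
    with hO
  have hOo : IsOpen O := ((hcz _ hη').isOpen_inter_preimage hO₂o isOpen_Ioi).inter
    ((hcz _ hη'').isOpen_inter_preimage hO₂o isOpen_Iio)
  have hOsub : ∀ z ∈ O, z ∈ O₂ := fun z hz => hz.1.1
  have hz₀ : z₀ ∈ O := by
    have h1 := hmono z₀ hzO₂ (a := y₀) (b := y₀ + η) ⟨by linarith, by linarith⟩
      ⟨by linarith, by linarith⟩ (by linarith)
    have h2 := hmono z₀ hzO₂ (b := y₀) (a := y₀ - η) ⟨by linarith, by linarith⟩
      ⟨by linarith, by linarith⟩ (by linarith)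
    simp only [hF0] at h1 h2
    exact ⟨⟨hzO₂, h1⟩, ⟨hzO₂, h2⟩⟩
  have hex : ∀ z ∈ O, ∃ y, |y - y₀| < η ∧ F (z, y) = 0 := by
    intro z hz
    have hc : ContinuousOn (fun y => F (z, y)) (Icc (y₀ - η) (y₀ + η)) := by
      intro y hy
      exact (hderiv z (hOsub z hz) y
        (abs_le.2 ⟨by linarith [hy.1], by linarith [hy.2]⟩)).continuousAt.continuousWithinAt
    obtain ⟨y, hy, hy0⟩ := intermediate_value_Ioo (by linarith) hc ⟨hz.2.2, hz.1.2⟩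
    exact ⟨y, abs_lt.2 ⟨by linarith [hy.1], by linarith [hy.2]⟩, hy0⟩
  choose! Y hY hYF using hex
  have huniq : ∀ z ∈ O, ∀ y, |y - y₀| ≤ η → (F (z, y) = 0 ↔ y = Y z) := by
    intro z hz y hy
    refine ⟨fun h => ?_, fun h => h ▸ hYF z hz⟩
    have h1 := abs_le.1 hy
    have h2 := abs_lt.1 (hY z hz)
    refine (hmono z (hOsub z hz)).injOn ⟨by linarith, by linarith⟩ ⟨by linarith, by linarith⟩ ?_
    simp only [h, hYF z hz]
  have hcont : ∀ z ∈ O, ContinuousAt Y z := by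
    intro z hz
    have h2 := abs_lt.1 (hY z hz)
    refine tendsto_order.2 ⟨fun y hy => ?_, fun y hy => ?_⟩
    · by_cases hyl : y < y₀ - η
      · filter_upwards [hOo.mem_nhds hz] with z' hz'
        linarith [(abs_lt.1 (hY z' hz')).1]
      · have hy' : |y - y₀| ≤ η := abs_le.2 ⟨by linarith, by linarith⟩
        have hlt : F (z, y) < 0 := by
          rw [← hYF z hz]
          exact hmono z (hOsub z hz) ⟨by linarith, by linarith⟩ ⟨by linarith, by linarith⟩ hy
        filter_upwards [hOo.mem_nhds hz, ((hcz y hy').continuousAt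
          (hO₂o.mem_nhds (hOsub z hz))).eventually (gt_mem_nhds hlt)] with z' hz' hlt'
        have h3 := abs_lt.1 (hY z' hz')
        by_contra hle
        have := (hmono z' (hOsub z' hz')).monotoneOn (a := Y z') (b := y)
          ⟨by linarith, by linarith⟩ ⟨by linarith, by linarith⟩ (not_lt.1 hle)
        simp only [hYF z' hz'] at this
        linarith
    · by_cases hyl : y₀ + η < y
      · filter_upwards [hOo.mem_nhds hz] with z' hz'
        linarith [(abs_lt.1 (hY z' hz')).2]
      · have hy' : |y - y₀| ≤ η := abs_le.2 ⟨by linarith, by linarith⟩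
        have hlt : 0 < F (z, y) := by
          rw [← hYF z hz]
          exact hmono z (hOsub z hz) ⟨by linarith, by linarith⟩ ⟨by linarith, by linarith⟩ hy
        filter_upwards [hOo.mem_nhds hz, ((hcz y hy').continuousAt
          (hO₂o.mem_nhds (hOsub z hz))).eventually (lt_mem_nhds hlt)] with z' hz' hlt'
        have h3 := abs_lt.1 (hY z' hz')
        by_contra hle
        have := (hmono z' (hOsub z' hz')).monotoneOn (a := y) (b := Y z')
          ⟨by linarith, by linarith⟩ ⟨by linarith, by linarith⟩ (not_lt.1 hle)
        simp only [hYF z' hz'] at this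
        linarith
  have hYder : ∀ z ∈ O, HasFDerivAt Y (-(fderiv ℝ F (z, Y z) (0, 1))⁻¹ •
      (fderiv ℝ F (z, Y z)).comp (ContinuousLinearMap.inl ℝ Z ℝ)) z := by
    intro z hz
    have hb := hbox z (hOsub z hz) (Y z) (hY z hz).le
    refine hasFDerivAt_of_implicit ?_ (hcont z hz) hb.2.ne' ?_
    · exact (hF.contDiffAt (hΩ.mem_nhds hb.1)).differentiableAt (by simp)
    · filter_upwards [hOo.mem_nhds hz] with z' hz'
      rw [hYF z' hz', hYF z hz]
  -- Bootstrap: the formula for Y' involves only Y and the derivative of F, so Y of class C^k has a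
  -- derivative of class C^k as long as k ≤ n.
  have hYsmooth : ∀ k : ℕ, k ≤ n + 1 → ContDiffOn ℝ (k : WithTop ℕ∞) Y O := by
    intro k
    induction k with
    | zero =>
      intro _
      rw [Nat.cast_zero, contDiffOn_zero]
      exact fun z hz => (hcont z hz).continuousWithinAt
    | succ k ih =>
      intro hk
      have hYk := ih (by omega)
      have hmap : ContDiffOn ℝ (k : WithTop ℕ∞) (fun z => (z, Y z)) O := contDiffOn_id.prodMk hYk
      have hF' : ContDiffOn ℝ (k : WithTop ℕ∞) (fun z => fderiv ℝ F (z, Y z)) O :=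
        (hFd.of_le (by exact_mod_cast (by omega : k ≤ n))).comp hmap
          fun z hz => (hbox z (hOsub z hz) (Y z) (hY z hz).le).1
      have h1 : ContDiffOn ℝ (k : WithTop ℕ∞)
          (fun z => -(fderiv ℝ F (z, Y z) (0, 1))⁻¹) O :=
        ((hF'.clm_apply contDiffOn_const).inv
          fun z hz => (hbox z (hOsub z hz) (Y z) (hY z hz).le).2.ne').neg
      exact contDiffOn_nat_succ_of_hasFDerivAt hOo hYder
        (h1.smul (hF'.clm_comp contDiffOn_const))
  have hYz₀ : Y z₀ = y₀ := ((huniq z₀ hz₀ y₀ (by simp [hη.le])).1 hF0).symm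
  exact ⟨O, η, Y, hOo, hz₀, hη, hYz₀, fun z hz => hbox z (hOsub z hz), hYsmooth _ le_rfl,
    fun z hz => ⟨hY z hz, huniq z hz⟩⟩

end Implicit

/-! ### The fold bifurcation of zeros of a family of planar maps -/

theorem zeros_of_valley {u : ℝ → ℝ} {η τ : ℝ} (hτ : |τ| < η)
    (hc : ContinuousOn u (Icc (-η) η)) (ha : StrictAntiOn u (Icc (-η) τ))
    (hm : StrictMonoOn u (Icc τ η)) (hl : 0 < u (-η)) (hr : 0 < u η) :
    (0 < u τ → {t | |t| < η ∧ u t = 0} = ∅) ∧ (u τ = 0 → {t | |t| < η ∧ u t = 0} = {τ}) ∧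
    (u τ < 0 → ∃ t₁ t₂, t₁ < τ ∧ τ < t₂ ∧ {t | |t| < η ∧ u t = 0} = {t₁, t₂}) := by
  obtain ⟨hτ1, hτ2⟩ := abs_lt.1 hτ
  have hlt : ∀ t, |t| < η → t ≠ τ → u τ < u t := by
    intro t ht hne
    obtain ⟨h1, h2⟩ := abs_lt.1 ht
    rcases lt_or_gt_of_ne hne with h | h
    · exact ha ⟨h1.le, h.le⟩ ⟨hτ1.le, le_rfl⟩ h
    · exact hm ⟨le_rfl, hτ2.le⟩ ⟨h.le, h2.le⟩ h
  refine ⟨fun h => ?_, fun h => ?_, fun h => ?_⟩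
  · ext t
    simp only [mem_ofPred_eq, mem_empty_iff_false, iff_false, not_and]
    intro ht h0
    by_cases hne : t = τ
    · subst hne; linarith
    · linarith [hlt t ht hne]
  · ext t
    simp only [mem_ofPred_eq, mem_singleton_iff]
    refine ⟨fun ⟨ht, h0⟩ => ?_, fun e => e ▸ ⟨hτ, h⟩⟩
    by_contra hne
    linarith [hlt t ht hne]
  · obtain ⟨t₁, h1, h1'⟩ := intermediate_value_Ioo' hτ1.le
      (hc.mono (Icc_subset_Icc_right hτ2.le)) ⟨h, hl⟩
    obtain ⟨t₂, h2, h2'⟩ := intermediate_value_Ioo hτ2.le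
      (hc.mono (Icc_subset_Icc_left hτ1.le)) ⟨h, hr⟩
    refine ⟨t₁, t₂, h1.2, h2.1, ?_⟩
    ext t
    simp only [mem_ofPred_eq, mem_insert_iff, mem_singleton_iff]
    constructor
    · rintro ⟨ht, h0⟩
      obtain ⟨h3, h4⟩ := abs_lt.1 ht
      rcases le_total t τ with hle | hle
      · exact Or.inl (ha.injOn ⟨h3.le, hle⟩ ⟨h1.1.le, h1.2.le⟩ (h0.trans h1'.symm))
      · exact Or.inr (hm.injOn ⟨hle, h4.le⟩ ⟨h2.1.le, h2.2.le⟩ (h0.trans h2'.symm))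
    · rintro (e | e) <;> subst e
      · exact ⟨abs_lt.2 ⟨h1.1, by linarith [h1.2]⟩, h1'⟩
      · exact ⟨abs_lt.2 ⟨by linarith [h2.1], h2.2⟩, h2'⟩

section Fold

variable {X : Type*} [NormedAddCommGroup X] [NormedSpace ℝ X]

/-- The Jacobian determinant of `(H, F)` in the variables `(t, y)`. -/
def jac (F H : (X × ℝ) × ℝ → ℝ) (q : (X × ℝ) × ℝ) : ℝ :=
  fderiv ℝ H q ((0, 1), 0) * fderiv ℝ F q (0, 1) - fderiv ℝ H q (0, 1) * fderiv ℝ F q ((0, 1), 0)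

/-- Lyapunov–Schmidt reduction. F = 0 is solved as y = Y(β, t), and u is H on this graph. Since F_y
u_t equals `jac F H`, which increases with t, u falls and then rises, with its minimum at the zero
τ(β) of the Jacobian. The bifurcation function is u(β, τ(β)). The order drops from m + 2 to m + 1
because τ is defined by first derivatives. -/
theorem exists_fold {F H : (X × ℝ) × ℝ → ℝ} {Ω : Set ((X × ℝ) × ℝ)} {m : ℕ} (hΩ : IsOpen Ω)
    (hF : ContDiffOn ℝ ((m + 2 : ℕ) : WithTop ℕ∞) F Ω)
    (hH : ContDiffOn ℝ ((m + 2 : ℕ) : WithTop ℕ∞) H Ω) {α : X} (h0 : ((α, 0), 0) ∈ Ω)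
    (hF0 : F ((α, 0), 0) = 0) (hH0 : H ((α, 0), 0) = 0)
    (hFy : 0 < fderiv ℝ F ((α, 0), 0) (0, 1)) (hFt : fderiv ℝ F ((α, 0), 0) ((0, 1), 0) = 0)
    (hHy : fderiv ℝ H ((α, 0), 0) (0, 1) = 0) (hHt : fderiv ℝ H ((α, 0), 0) ((0, 1), 0) = 0)
    (hJ : 0 < fderiv ℝ (jac F H) ((α, 0), 0) ((0, 1), 0)) :
    ∃ (𝒱 : Set X) (W : Set (ℝ × ℝ)) (B : X → ℝ), IsOpen 𝒱 ∧ α ∈ 𝒱 ∧ IsOpen W ∧ (0, 0) ∈ W ∧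
      (∀ β ∈ 𝒱, ∀ w ∈ W, ((β, w.1), w.2) ∈ Ω) ∧
      ContDiffOn ℝ ((m + 1 : ℕ) : WithTop ℕ∞) B 𝒱 ∧
      (∀ γ, fderiv ℝ B α γ = fderiv ℝ H ((α, 0), 0) ((γ, 0), 0)) ∧
      ∀ β ∈ 𝒱,
        (0 < B β → {w ∈ W | F ((β, w.1), w.2) = 0 ∧ H ((β, w.1), w.2) = 0} = ∅) ∧
        (B β = 0 → ∃ w, {w ∈ W | F ((β, w.1), w.2) = 0 ∧ H ((β, w.1), w.2) = 0} = {w} ∧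
          jac F H ((β, w.1), w.2) = 0) ∧
        (B β < 0 → ∃ w₁ w₂, w₁ ≠ w₂ ∧
          {w ∈ W | F ((β, w.1), w.2) = 0 ∧ H ((β, w.1), w.2) = 0} = {w₁, w₂} ∧
          jac F H ((β, w₁.1), w₁.2) < 0 ∧ 0 < jac F H ((β, w₂.1), w₂.2)) := by
  obtain ⟨O, η, Y, hO, hαO, hη, hY0, hbox, hYs, hYu⟩ :=
    exists_implicit (n := m + 1) hΩ hF h0 hF0 hFy
  have hYmem : ∀ z ∈ O, (z, Y z) ∈ Ω ∧ 0 < fderiv ℝ F (z, Y z) (0, 1) :=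
    fun z hz => hbox z hz _ (by simpa using (hYu z hz).1.le)
  have hYF : ∀ z ∈ O, F (z, Y z) = 0 :=
    fun z hz => ((hYu z hz).2 _ (by simpa using (hYu z hz).1.le)).2 rfl
  have hYd : ∀ z ∈ O, HasFDerivAt Y (fderiv ℝ Y z) z := fun z hz =>
    ((hYs.contDiffAt (hO.mem_nhds hz)).differentiableAt (by simp)).hasFDerivAt
  have hFd : ∀ q ∈ Ω, HasFDerivAt F (fderiv ℝ F q) q := fun q hq =>
    ((hF.contDiffAt (hΩ.mem_nhds hq)).differentiableAt (by simp)).hasFDerivAt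
  have hHd : ∀ q ∈ Ω, HasFDerivAt H (fderiv ℝ H q) q := fun q hq =>
    ((hH.contDiffAt (hΩ.mem_nhds hq)).differentiableAt (by simp)).hasFDerivAt
  have hgraph : ∀ z ∈ O, HasFDerivAt (fun z => (z, Y z))
      ((ContinuousLinearMap.id ℝ (X × ℝ)).prod (fderiv ℝ Y z)) z :=
    fun z hz => (hasFDerivAt_id z).prodMk (hYd z hz)
  have hYt : ∀ z ∈ O, ∀ ζ, fderiv ℝ F (z, Y z) (ζ, fderiv ℝ Y z ζ) = 0 := by
    intro z hz ζ
    have h1 := (hFd _ (hYmem z hz).1).comp z (hgraph z hz)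
    have h2 : HasFDerivAt (F ∘ fun z => (z, Y z)) (0 : X × ℝ →L[ℝ] ℝ) z := by
      refine (hasFDerivAt_const (0 : ℝ) z).congr_of_eventuallyEq ?_
      filter_upwards [hO.mem_nhds hz] with z' hz' using hYF z' hz'
    have h3 := DFunLike.congr_fun (h1.unique h2) ζ
    simpa using h3
  have hsplit : ∀ (D : (X × ℝ) × ℝ →L[ℝ] ℝ) (ζ : X × ℝ) (y : ℝ),
      D (ζ, y) = D (ζ, 0) + y * D (0, 1) := by
    intro D ζ y
    have : ((ζ, y) : (X × ℝ) × ℝ) = (ζ, 0) + y • (0, 1) := by simp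
    rw [this, map_add, map_smul, smul_eq_mul]
  -- the restriction of `H` to the graph
  set u : X × ℝ → ℝ := fun z => H (z, Y z) with hu
  have hmap : ContDiffOn ℝ ((m + 2 : ℕ) : WithTop ℕ∞) (fun z => (z, Y z)) O :=
    contDiffOn_id.prodMk hYs
  have hus : ContDiffOn ℝ ((m + 2 : ℕ) : WithTop ℕ∞) u O :=
    hH.comp hmap fun z hz => (hYmem z hz).1
  have hud : ∀ z ∈ O, ∀ ζ, fderiv ℝ u z ζ = fderiv ℝ H (z, Y z) (ζ, fderiv ℝ Y z ζ) := by
    intro z hz ζ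
    have h1 := (hHd _ (hYmem z hz).1).comp z (hgraph z hz)
    have h2 : fderiv ℝ u z = _ := h1.fderiv
    rw [h2]; simp
  have hudiff : ∀ z ∈ O, HasFDerivAt u (fderiv ℝ u z) z := fun z hz =>
    ((hus.contDiffAt (hO.mem_nhds hz)).differentiableAt (by simp)).hasFDerivAt
  -- Eliminating Y_t with F_t + F_y Y_t = 0 turns u_t into the Jacobian divided by F_y > 0, so the
  -- two have the same sign.
  have hut : ∀ z ∈ O, fderiv ℝ F (z, Y z) (0, 1) * fderiv ℝ u z (0, 1) = jac F H (z, Y z) := by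
    intro z hz
    have h1 := hYt z hz (0, 1)
    rw [hsplit] at h1
    rw [hud z hz, hsplit _ (0, 1) (fderiv ℝ Y z (0, 1)), jac]
    linear_combination fderiv ℝ H (z, Y z) (0, 1) * h1
  have hFd' : ContDiffOn ℝ ((m + 1 : ℕ) : WithTop ℕ∞) (fderiv ℝ F) Ω :=
    hF.fderiv_of_isOpen hΩ (by norm_cast)
  have hHd' : ContDiffOn ℝ ((m + 1 : ℕ) : WithTop ℕ∞) (fderiv ℝ H) Ω :=
    hH.fderiv_of_isOpen hΩ (by norm_cast)
  have hjac : ContDiffOn ℝ ((m + 1 : ℕ) : WithTop ℕ∞) (jac F H) Ω :=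
    ((hHd'.clm_apply contDiffOn_const).mul (hFd'.clm_apply contDiffOn_const)).sub
      ((hHd'.clm_apply contDiffOn_const).mul (hFd'.clm_apply contDiffOn_const))
  set j : X × ℝ → ℝ := fun z => jac F H (z, Y z) with hj
  have hjs : ContDiffOn ℝ ((m + 1 : ℕ) : WithTop ℕ∞) j O :=
    hjac.comp (hmap.of_le (by norm_cast; omega)) fun z hz => (hYmem z hz).1
  have hYt0 : fderiv ℝ Y (α, 0) (0, 1) = 0 := by
    have h1 := hYt _ hαO (0, 1)
    rw [hsplit, hY0, hFt, zero_add] at h1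
    exact (mul_eq_zero.1 h1).resolve_right hFy.ne'
  have hjd : fderiv ℝ j (α, 0) (0, 1) = fderiv ℝ (jac F H) ((α, 0), 0) ((0, 1), 0) := by
    have h1 : HasFDerivAt (jac F H) _ ((α, 0), Y (α, 0)) :=
      ((hjac.contDiffAt (hΩ.mem_nhds (hYmem _ hαO).1)).differentiableAt (by simp)).hasFDerivAt
    have h2 := h1.comp (α, (0 : ℝ)) (hgraph _ hαO)
    have h3 : fderiv ℝ j (α, 0) = _ := h2.fderiv
    rw [h3, hY0]
    simp [hYt0]
  have hj0 : j (α, 0) = 0 := by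
    simp only [hj, hY0, jac, hHy, hHt]; ring
  obtain ⟨O₂, η₂, τ, hO₂, hαO₂, hη₂, hτ0, hbox₂, hτs, hτu⟩ :=
    exists_implicit (n := m) hO hjs hαO hj0 (by rw [hjd]; exact hJ)
  have hτm : ∀ β ∈ O₂, |τ β| < η₂ := fun β hβ => by simpa using (hτu β hβ).1
  have hτO : ∀ β ∈ O₂, (β, τ β) ∈ O := fun β hβ =>
    (hbox₂ β hβ _ (by simpa using (hτm β hβ).le)).1
  have hboxO : ∀ β ∈ O₂, ∀ t, |t| ≤ η₂ → (β, t) ∈ O := fun β hβ t ht =>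
    (hbox₂ β hβ t (by simpa using ht)).1
  have hline : ∀ (g : X × ℝ → ℝ), (∀ z ∈ O, HasFDerivAt g (fderiv ℝ g z) z) → ∀ β ∈ O₂, ∀ t,
      |t| ≤ η₂ → HasDerivAt (fun t => g (β, t)) (fderiv ℝ g (β, t) (0, 1)) t := by
    intro g hg β hβ t ht
    exact (hg _ (hboxO β hβ t ht)).comp_hasDerivAt t
      ((hasDerivAt_const t β).prodMk (hasDerivAt_id t))
  have hjdiff : ∀ z ∈ O, HasFDerivAt j (fderiv ℝ j z) z := fun z hz =>
    ((hjs.contDiffAt (hO.mem_nhds hz)).differentiableAt (by simp)).hasFDerivAt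
  have habs : ∀ t, t ∈ Icc (-η₂) η₂ ↔ |t| ≤ η₂ := fun t => abs_le.symm
  have hjmono : ∀ β ∈ O₂, StrictMonoOn (fun t => j (β, t)) (Icc (-η₂) η₂) := by
    intro β hβ
    refine strictMonoOn_of_deriv_pos (convex_Icc _ _) (fun t ht =>
      (hline j hjdiff β hβ t ((habs t).1 ht)).continuousAt.continuousWithinAt) fun t ht => ?_
    rw [interior_Icc] at ht
    have ht' := (habs t).1 (Ioo_subset_Icc_self ht)
    rw [(hline j hjdiff β hβ t ht').deriv]
    exact (hbox₂ β hβ t (by simpa using ht')).2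
  have hjτ : ∀ β ∈ O₂, j (β, τ β) = 0 := fun β hβ =>
    ((hτu β hβ).2 _ (by simpa using (hτm β hβ).le)).2 rfl
  have hτIcc : ∀ β ∈ O₂, τ β ∈ Icc (-η₂) η₂ := fun β hβ => (habs _).2 (hτm β hβ).le
  have hjneg : ∀ β ∈ O₂, ∀ t, |t| ≤ η₂ → t < τ β → j (β, t) < 0 := fun β hβ t ht hlt => by
    have := hjmono β hβ ((habs t).2 ht) (hτIcc β hβ) hlt
    simpa only [hjτ β hβ] using this
  have hjpos : ∀ β ∈ O₂, ∀ t, |t| ≤ η₂ → τ β < t → 0 < j (β, t) := fun β hβ t ht hlt => by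
    have := hjmono β hβ (hτIcc β hβ) ((habs t).2 ht) hlt
    simpa only [hjτ β hβ] using this
  have huc : ∀ β ∈ O₂, ContinuousOn (fun t => u (β, t)) (Icc (-η₂) η₂) := fun β hβ t ht =>
    (hline u hudiff β hβ t ((habs t).1 ht)).continuousAt.continuousWithinAt
  have huanti : ∀ β ∈ O₂, StrictAntiOn (fun t => u (β, t)) (Icc (-η₂) (τ β)) := by
    intro β hβ
    have hsub : Icc (-η₂) (τ β) ⊆ Icc (-η₂) η₂ := Icc_subset_Icc_right (hτIcc β hβ).2
    refine strictAntiOn_of_deriv_neg (convex_Icc _ _) ((huc β hβ).mono hsub) fun t ht => ?_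
    rw [interior_Icc] at ht
    have ht' := (habs t).1 (hsub (Ioo_subset_Icc_self ht))
    rw [(hline u hudiff β hβ t ht').deriv]
    have h1 := hut _ (hboxO β hβ t ht')
    have h2 := hjneg β hβ t ht' ht.2
    have h3 := (hYmem _ (hboxO β hβ t ht')).2
    simp only [hj] at h2
    rw [← h1] at h2
    exact (pos_iff_neg_of_mul_neg h2).1 h3
  have humono : ∀ β ∈ O₂, StrictMonoOn (fun t => u (β, t)) (Icc (τ β) η₂) := by
    intro β hβ
    have hsub : Icc (τ β) η₂ ⊆ Icc (-η₂) η₂ := Icc_subset_Icc_left (hτIcc β hβ).1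
    refine strictMonoOn_of_deriv_pos (convex_Icc _ _) ((huc β hβ).mono hsub) fun t ht => ?_
    rw [interior_Icc] at ht
    have ht' := (habs t).1 (hsub (Ioo_subset_Icc_self ht))
    rw [(hline u hudiff β hβ t ht').deriv]
    have h1 := hut _ (hboxO β hβ t ht')
    have h2 := hjpos β hβ t ht' ht.1
    have h3 := (hYmem _ (hboxO β hβ t ht')).2
    simp only [hj] at h2
    rw [← h1] at h2
    exact (pos_iff_pos_of_mul_pos h2).1 h3
  have hcs : ∀ t, |t| ≤ η₂ → ContinuousOn (fun β => u (β, t)) O₂ := fun t ht =>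
    hus.continuousOn.comp (by fun_prop) fun β hβ => hboxO β hβ t ht
  have hηl : |-η₂| ≤ η₂ := by rw [abs_neg, abs_of_pos hη₂]
  have hηr : |η₂| ≤ η₂ := by rw [abs_of_pos hη₂]
  have hu0 : u (α, τ α) = 0 := by simp only [hu, hτ0, hY0, hH0]
  have hBs : ContDiffOn ℝ ((m + 1 : ℕ) : WithTop ℕ∞) (fun β => u (β, τ β)) O₂ :=
    (hus.of_le (by norm_cast; omega)).comp (contDiffOn_id.prodMk hτs) hτO
  -- For parameters in this set u is positive at both ends of the t-interval, so no zero crosses the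
  -- boundary of the window.
  refine ⟨(O₂ ∩ (fun β => u (β, -η₂)) ⁻¹' Ioi 0) ∩ (O₂ ∩ (fun β => u (β, η₂)) ⁻¹' Ioi 0),
    Ioo (-η₂) η₂ ×ˢ Ioo (-η) η, fun β => u (β, τ β),
    ((hcs _ hηl).isOpen_inter_preimage hO₂ isOpen_Ioi).inter
      ((hcs _ hηr).isOpen_inter_preimage hO₂ isOpen_Ioi), ?_, isOpen_Ioo.prod isOpen_Ioo, ?_, ?_,
    hBs.mono fun β hβ => hβ.1.1, ?_, ?_⟩
  · have hτα := hτIcc α hαO₂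
    rw [hτ0] at hτα
    have h1 := huanti α hαO₂ (a := -η₂) (b := τ α) ⟨le_rfl, (hτIcc α hαO₂).1⟩
      ⟨(hτIcc α hαO₂).1, le_rfl⟩ (by rw [hτ0]; linarith)
    have h2 := humono α hαO₂ (a := τ α) (b := η₂) ⟨le_rfl, (hτIcc α hαO₂).2⟩
      ⟨(hτIcc α hαO₂).2, le_rfl⟩ (by rw [hτ0]; linarith)
    simp only [hu0] at h1 h2
    exact ⟨⟨hαO₂, h1⟩, ⟨hαO₂, h2⟩⟩
  · exact ⟨⟨by linarith, by linarith⟩, ⟨by linarith, by linarith⟩⟩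
  · rintro β hβ ⟨t, y⟩ ⟨ht, hy⟩
    have h1 := hboxO β hβ.1.1 t (abs_le.2 ⟨ht.1.le, ht.2.le⟩)
    exact (hbox _ h1 y (by rw [sub_zero]; exact abs_le.2 ⟨hy.1.le, hy.2.le⟩)).1
  -- Envelope argument: the partial derivatives of H in t and y vanish at the base point, so neither
  -- τ nor Y contributes to the derivative.
  · intro γ
    have hτd : HasFDerivAt τ (fderiv ℝ τ α) α :=
      ((hτs.contDiffAt (hO₂.mem_nhds hαO₂)).differentiableAt (by simp)).hasFDerivAt
    have h1 := (hudiff _ (hτO α hαO₂)).comp α ((hasFDerivAt_id α).prodMk hτd)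
    have h2 : fderiv ℝ (fun β => u (β, τ β)) α = _ := h1.fderiv
    have h3 : ((γ, fderiv ℝ τ α γ) : X × ℝ) = (γ, 0) + (fderiv ℝ τ α γ) • (0, 1) := by simp
    rw [h2]
    simp only [ContinuousLinearMap.comp_apply, ContinuousLinearMap.prod_apply,
      ContinuousLinearMap.id_apply]
    rw [hud _ (hτO α hαO₂), hτ0, hY0, hsplit, hHy, mul_zero, add_zero, h3]
    have h4 : (((γ, 0) + (fderiv ℝ τ α γ) • (0, 1), 0) : (X × ℝ) × ℝ)
        = ((γ, 0), 0) + (fderiv ℝ τ α γ) • ((0, 1), 0) := by simp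
    rw [h4, map_add, map_smul, hHt, smul_zero, add_zero]
  · rintro β ⟨⟨hβ, hβl⟩, -, hβr⟩
    obtain ⟨hv1, hv2, hv3⟩ := zeros_of_valley (hτm β hβ) (huc β hβ)
      (huanti β hβ) (humono β hβ) hβl hβr
    have hset : {w ∈ Ioo (-η₂) η₂ ×ˢ Ioo (-η) η | F ((β, w.1), w.2) = 0 ∧ H ((β, w.1), w.2) = 0}
        = (fun t => (t, Y (β, t))) '' {t | |t| < η₂ ∧ u (β, t) = 0} := by
      ext ⟨t, y⟩
      simp only [mem_ofPred_eq, mem_prod, mem_image, Prod.mk.injEq]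
      constructor
      · rintro ⟨⟨ht, hy⟩, h1, h2⟩
        have ht' := hboxO β hβ t (abs_le.2 ⟨ht.1.le, ht.2.le⟩)
        have hy' := ((hYu _ ht').2 y
          (by rw [sub_zero]; exact abs_le.2 ⟨hy.1.le, hy.2.le⟩)).1 h1
        exact ⟨t, ⟨abs_lt.2 ht, by simpa only [hu, ← hy'] using h2⟩, rfl, hy'.symm⟩
      · rintro ⟨t', ⟨ht, h2⟩, rfl, rfl⟩
        have ht' := hboxO β hβ t' ht.le
        have hy := (hYu _ ht').1
        rw [sub_zero] at hy
        exact ⟨⟨abs_lt.1 ht, abs_lt.1 hy⟩, hYF _ ht', h2⟩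
    rw [hset]
    refine ⟨fun h => ?_, fun h => ?_, fun h => ?_⟩
    · rw [hv1 h, image_empty]
    · exact ⟨_, by rw [hv2 h, image_singleton], hjτ β hβ⟩
    · obtain ⟨t₁, t₂, h1, h2, h12⟩ := hv3 h
      have hm1 : t₁ ∈ {t | |t| < η₂ ∧ u (β, t) = 0} := by rw [h12]; simp
      have hm2 : t₂ ∈ {t | |t| < η₂ ∧ u (β, t) = 0} := by rw [h12]; simp
      refine ⟨_, _, ?_, by rw [h12, image_pair], hjneg β hβ t₁ hm1.1.le h1,
        hjpos β hβ t₂ hm2.1.le h2⟩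
      intro he
      have := congrArg Prod.fst he
      simp only at this
      linarith

end Fold

/-! ### Families of evaluation maps on spaces of differentiable functions -/

section Weak

variable {X : Type*} [NormedAddCommGroup X] [NormedSpace ℝ X]
  {E : Type} [NormedAddCommGroup E] [NormedSpace ℝ E]
  {F : Type} [NormedAddCommGroup F] [NormedSpace ℝ F]

/-- The functions `y ↦ δ y β` are of class `C^k` on `U`, with derivatives bounded by `C * ‖β‖`. -/
def WeaklyContDiffOn (δ : E → X →L[ℝ] F) (U : Set E) (k : ℕ) (C : ℝ) : Prop :=
  ∀ β, ContDiffOn ℝ (k : WithTop ℕ∞) (fun y => δ y β) U ∧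
    ∀ j ≤ k, ∀ y ∈ U, ‖iteratedFDeriv ℝ j (fun y => δ y β) y‖ ≤ C * ‖β‖

theorem WeaklyContDiffOn.differentiableAt {δ : E → X →L[ℝ] F} {U : Set E} {k : ℕ} {C : ℝ}
    (h : WeaklyContDiffOn δ U (k + 1) C) (hU : IsOpen U) (β : X) {y : E} (hy : y ∈ U) :
    DifferentiableAt ℝ (fun y => δ y β) y :=
  ((h β).1.contDiffAt (hU.mem_nhds hy)).differentiableAt (by simp)

theorem WeaklyContDiffOn.norm_fderiv_le {δ : E → X →L[ℝ] F} {U : Set E} {k : ℕ} {C : ℝ}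
    (h : WeaklyContDiffOn δ U (k + 1) C) (β : X) {y : E} (hy : y ∈ U) :
    ‖fderiv ℝ (fun y => δ y β) y‖ ≤ C * ‖β‖ := by
  have h1 := (h β).2 1 (by omega) y hy
  rwa [← zero_add 1, ← norm_iteratedFDeriv_fderiv, norm_iteratedFDeriv_zero] at h1

/-- The derivative family is again linear in β and satisfies the same bounds one order lower, which
is what the inductions below consume. Off `U` it is set to 0; only its values on `U` are ever used.
-/
theorem WeaklyContDiffOn.exists_deriv {δ : E → X →L[ℝ] F} {U : Set E} {k : ℕ} {C : ℝ}
    (h : WeaklyContDiffOn δ U (k + 1) C) (hU : IsOpen U) :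
    ∃ δ₁ : E → X →L[ℝ] (E →L[ℝ] F), (∀ y ∈ U, ∀ β, δ₁ y β = fderiv ℝ (fun y => δ y β) y) ∧
      WeaklyContDiffOn δ₁ U k C := by
  classical
  have hd := fun β y hy => h.differentiableAt hU β (y := y) hy
  let δ₁ : E → X →L[ℝ] (E →L[ℝ] F) := fun y =>
    if hy : y ∈ U then LinearMap.mkContinuous
      { toFun := fun β => fderiv ℝ (fun y => δ y β) y
        map_add' := fun β γ => by
          simp only [map_add]
          exact fderiv_fun_add (hd β y hy) (hd γ y hy)
        map_smul' := fun c β => by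
          simp only [map_smul]
          exact fderiv_fun_const_smul (hd β y hy) c } C fun β => h.norm_fderiv_le β hy
    else 0
  have h1 : ∀ y ∈ U, ∀ β, δ₁ y β = fderiv ℝ (fun y => δ y β) y := by
    intro y hy β
    simp only [δ₁, hy, dif_pos]
    rfl
  refine ⟨δ₁, h1, fun β => ⟨?_, fun j hj y hy => ?_⟩⟩
  · exact ((h β).1.fderiv_of_isOpen hU (by norm_cast)).congr fun y hy => h1 y hy β
  · have h2 : (fun y => δ₁ y β) =ᶠ[𝓝 y] fderiv ℝ (fun y => δ y β) := by
      filter_upwards [hU.mem_nhds hy] with z hz using h1 z hz β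
    rw [(Filter.EventuallyEq.iteratedFDeriv ℝ h2 j).eq_of_nhds, norm_iteratedFDeriv_fderiv]
    exact (h β).2 (j + 1) (by omega) y hy

theorem WeaklyContDiffOn.norm_sub_le {δ : E → X →L[ℝ] F} {U : Set E} {k : ℕ} {C : ℝ} (hC : 0 ≤ C)
    (h : WeaklyContDiffOn δ U (k + 1) C) (hU : IsOpen U) (hconv : Convex ℝ U) {y z : E}
    (hy : y ∈ U) (hz : z ∈ U) : ‖δ z - δ y‖ ≤ C * ‖z - y‖ := by
  refine ContinuousLinearMap.opNorm_le_bound _ (by positivity) fun β => ?_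
  have := hconv.norm_image_sub_le_of_norm_fderiv_le (fun x hx => h.differentiableAt hU β hx)
    (fun x hx => h.norm_fderiv_le β hx) hy hz
  rw [sub_apply]
  linarith

/-- The second derivatives are bounded by C‖β‖ uniformly in β, so the first-order Taylor remainder
is O(|z - y|²) in operator norm and not merely for each β. -/
theorem WeaklyContDiffOn.hasFDerivAt {δ : E → X →L[ℝ] F} {U : Set E} {k : ℕ} {C : ℝ} (hC : 0 ≤ C)
    (h : WeaklyContDiffOn δ U (k + 2) C) (hU : IsOpen U) (hconv : Convex ℝ U)
    {δ₁ : E → X →L[ℝ] (E →L[ℝ] F)} (h1 : ∀ y ∈ U, ∀ β, δ₁ y β = fderiv ℝ (fun y => δ y β) y)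
    (h2 : WeaklyContDiffOn δ₁ U (k + 1) C) {y : E} (hy : y ∈ U) :
    HasFDerivAt δ (δ₁ y).flip y := by
  have key : (fun z => δ z - δ y - (δ₁ y).flip (z - y)) =O[𝓝 y] fun z => ‖z - y‖ ^ 2 := by
    refine Asymptotics.IsBigO.of_bound C ?_
    filter_upwards [hU.mem_nhds hy] with z hz
    rw [norm_pow, norm_norm]
    refine ContinuousLinearMap.opNorm_le_bound _ (by positivity) fun β => ?_
    have hs : Convex ℝ (U ∩ Metric.closedBall y ‖z - y‖) := hconv.inter (convex_closedBall _ _)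
    have := hs.norm_image_sub_le_of_norm_fderiv_le' (f := fun y => δ y β) (φ := δ₁ y β)
      (C := C * ‖z - y‖ * ‖β‖) (x := y) (y := z)
      (fun x hx => h.differentiableAt hU β hx.1) (fun x hx => ?_) ⟨hy, by simp⟩
      ⟨hz, by simp [dist_eq_norm]⟩
    · simp only [sub_apply, ContinuousLinearMap.flip_apply]
      nlinarith
    · rw [← h1 x hx.1 β, ← sub_apply]
      refine ((δ₁ x - δ₁ y).le_opNorm β).trans ?_
      have h3 := h2.norm_sub_le hC hU hconv hy hx.1
      have h4 : ‖x - y‖ ≤ ‖z - y‖ := by simpa [dist_eq_norm] using hx.2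
      have h5 := mul_le_mul_of_nonneg_left h4 hC
      exact mul_le_mul_of_nonneg_right (h3.trans h5) (norm_nonneg _)
  have h3 := key.hasFDerivAt (𝕜 := ℝ) (by norm_num)
  have h4 := (h3.add ((δ₁ y).flip.hasFDerivAt.comp y
    ((hasFDerivAt_id y).sub_const y))).add_const (δ y)
  refine (h4.congr_of_eventuallyEq (Eventually.of_forall fun z => ?_)).congr_fderiv ?_
  · simp
  · ext; simp

/-- In operator norm one order is lost: a bound on the derivative of order k + 1 yields only a
Lipschitz derivative of order k. -/
theorem WeaklyContDiffOn.contDiffOn {U : Set E} (hU : IsOpen U) (hconv : Convex ℝ U) {C : ℝ}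
    (hC : 0 ≤ C) (k : ℕ) : ∀ {F : Type} [NormedAddCommGroup F] [NormedSpace ℝ F]
    {δ : E → X →L[ℝ] F}, WeaklyContDiffOn δ U (k + 1) C →
      ContDiffOn ℝ (k : WithTop ℕ∞) δ U := by
  induction k with
  | zero =>
    intro F _ _ δ h
    rw [Nat.cast_zero, contDiffOn_zero]
    refine (LipschitzOnWith.of_dist_le_mul (K := ⟨C, hC⟩) fun z hz y hy => ?_).continuousOn
    rw [dist_eq_norm, dist_eq_norm]
    exact h.norm_sub_le hC hU hconv hy hz
  | succ k ih =>
    intro F _ _ δ h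
    obtain ⟨δ₁, h1, h2⟩ := h.exists_deriv hU
    have hflip : ContDiff ℝ (k : WithTop ℕ∞) fun T : X →L[ℝ] E →L[ℝ] F => T.flip := by
      refine IsBoundedLinearMap.contDiff ⟨⟨fun S T => rfl, fun c T => rfl⟩, 1, one_pos, fun T => ?_⟩
      rw [ContinuousLinearMap.opNorm_flip, one_mul]
    exact contDiffOn_nat_succ_of_hasFDerivAt hU
      (fun y hy => h.hasFDerivAt hC hU hconv h1 h2 hy) (hflip.comp_contDiffOn (ih h2))

/-- Evaluation loses no order. Its derivative at (β, y) is the functional δ y plus the derivative of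
y ↦ δ y β; the former is one order smoother than evaluation needs after differentiation, and the
latter is an evaluation of the derivative family, covered by induction. -/
theorem WeaklyContDiffOn.contDiffOn_eval {U : Set E} (hU : IsOpen U) (hconv : Convex ℝ U) {C : ℝ}
    (hC : 0 ≤ C) (k : ℕ) : ∀ {F : Type} [NormedAddCommGroup F] [NormedSpace ℝ F]
    {δ : E → X →L[ℝ] F}, WeaklyContDiffOn δ U k C →
      ContDiffOn ℝ (k : WithTop ℕ∞) (fun q : X × E => δ q.2 q.1) (univ ×ˢ U) := by
  induction k with
  | zero =>
    intro F _ _ δ h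
    rw [Nat.cast_zero, contDiffOn_zero]
    rintro ⟨β, y⟩ ⟨-, hy⟩
    refine ContinuousAt.continuousWithinAt ?_
    have h1 : Tendsto (fun q : X × E => δ q.2 (q.1 - β)) (𝓝 (β, y)) (𝓝 0) := by
      have h2 : Tendsto (fun q : X × E => C * ‖q.1 - β‖) (𝓝 (β, y)) (𝓝 0) := by
        have : Continuous fun q : X × E => C * ‖q.1 - β‖ := by fun_prop
        simpa using this.tendsto (β, y)
      refine squeeze_zero_norm' ?_ h2
      filter_upwards [prod_mem_nhds univ_mem (hU.mem_nhds hy)] with q hq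
      have := (h (q.1 - β)).2 0 le_rfl q.2 hq.2
      rwa [norm_iteratedFDeriv_zero] at this
    have h3 : Tendsto (fun q : X × E => δ q.2 β) (𝓝 (β, y)) (𝓝 (δ y β)) :=
      ((h β).1.continuousOn.continuousAt (hU.mem_nhds hy)).tendsto.comp
        (continuous_snd.tendsto (β, y))
    have h4 := h1.add h3
    rw [zero_add] at h4
    refine h4.congr fun q => ?_
    rw [← map_add, sub_add_cancel]
  | succ k ih =>
    intro F _ _ δ h
    obtain ⟨δ₁, h1, h2⟩ := h.exists_deriv hU
    refine contDiffOn_nat_succ_of_hasFDerivAt (isOpen_univ.prod hU)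
      (f' := fun q => (δ q.2).comp (ContinuousLinearMap.fst ℝ X E) +
        (δ₁ q.2 q.1).comp (ContinuousLinearMap.snd ℝ X E)) ?_ ?_
    · rintro ⟨β, y⟩ ⟨-, hy⟩
      -- The mixed increment is a product of a Lipschitz factor and β' - β, hence quadratically
      -- small; the remaining two increments are separate in β and y.
      have h3 : (fun q : X × E => (δ q.2 - δ y) (q.1 - β)) =O[𝓝 (β, y)]
          fun q => ‖q - (β, y)‖ ^ 2 := by
        refine Asymptotics.IsBigO.of_bound C ?_
        filter_upwards [prod_mem_nhds univ_mem (hU.mem_nhds hy)] with q hq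
        rw [norm_pow, norm_norm]
        refine ((δ q.2 - δ y).le_opNorm _).trans ?_
        have h4 := h.norm_sub_le hC hU hconv hy hq.2
        have h5 : ‖q.2 - y‖ ≤ ‖q - (β, y)‖ := norm_snd_le (q - (β, y))
        have h6 : ‖q.1 - β‖ ≤ ‖q - (β, y)‖ := norm_fst_le (q - (β, y))
        have h7 := h4.trans (mul_le_mul_of_nonneg_left h5 hC)
        have h8 := mul_le_mul h7 h6 (norm_nonneg _) (by positivity)
        linarith
      have h4 := h3.hasFDerivAt (𝕜 := ℝ) (by norm_num)
      have h5 : HasFDerivAt (fun q : X × E => δ q.2 β)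
          ((δ₁ y β).comp (ContinuousLinearMap.snd ℝ X E)) (β, y) := by
        rw [h1 y hy β]
        exact (h.differentiableAt hU β hy).hasFDerivAt.comp (β, y) hasFDerivAt_snd
      have h6 : HasFDerivAt (fun q : X × E => δ y q.1)
          ((δ y).comp (ContinuousLinearMap.fst ℝ X E)) (β, y) :=
        (δ y).hasFDerivAt.comp (β, y) hasFDerivAt_fst
      refine ((((h4.add h5).add h6).sub_const (δ y β)).congr_of_eventuallyEq
        (Eventually.of_forall fun q => ?_)).congr_fderiv ?_
      · simp only [Pi.add_apply, sub_apply, map_sub]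
        abel
      · simp only [zero_add]
        rw [add_comm]
    · have h3 := (h.contDiffOn hU hconv hC k).comp (contDiffOn_snd (E := X) (s := univ ×ˢ U))
        fun q hq => hq.2
      exact (h3.clm_comp contDiffOn_const).add ((ih h2).clm_comp contDiffOn_const)

end Weak

/-! ### Evaluation on the space of `C^r` maps, and openness of the set of immersions -/

section Charts

theorem contDiffOn_transition {M : Type*} [TopologicalSpace M] [ChartedSpace Plane M]
    {φ ψ : OpenPartialHomeomorph M Plane}
    (hφ : φ ∈ IsManifold.maximalAtlas (𝓡 2) ∞ M) (hψ : ψ ∈ IsManifold.maximalAtlas (𝓡 2) ∞ M) :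
    ContDiffOn ℝ ∞ (ψ ∘ φ.symm) (φ.target ∩ φ.symm ⁻¹' ψ.source) := by
  rw [← contMDiffOn_iff_contDiffOn]
  exact (contMDiffOn_of_mem_maximalAtlas hψ).comp
    ((contMDiffOn_symm_of_mem_maximalAtlas hφ).mono inter_subset_left) fun y hy => hy.2

theorem isOpen_transition_source {M : Type*} [TopologicalSpace M]
    {φ ψ : OpenPartialHomeomorph M Plane} :
    IsOpen (φ.target ∩ φ.symm ⁻¹' ψ.source) :=
  φ.symm.isOpen_inter_preimage ψ.open_source

variable {M : Type*} [TopologicalSpace M] [ChartedSpace Plane M] {r : ℕ}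

theorem contDiffOn_comp_symm [IsManifold (𝓡 2) ∞ M] (β : CrMap M r) {φ : OpenPartialHomeomorph M Plane}
    (hφ : φ ∈ IsManifold.maximalAtlas (𝓡 2) ∞ M) :
    ContDiffOn ℝ (r : WithTop ℕ∞) (β ∘ φ.symm) φ.target := by
  have : IsManifold (𝓡 2) (r : WithTop ℕ∞) M :=
    IsManifold.of_le (n := ∞) (by exact_mod_cast le_top)
  rw [← contMDiffOn_iff_contDiffOn]
  exact (ContMDiffMap.contMDiff β).comp_contMDiffOn
    ((contMDiffOn_symm_of_mem_maximalAtlas hφ).of_le (by exact_mod_cast le_top))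

theorem injective_mfderiv_iff (hr : 1 ≤ r) (β : CrMap M r) {φ : OpenPartialHomeomorph M Plane}
    (hφ : φ ∈ IsManifold.maximalAtlas (𝓡 2) ∞ M) {x : M} (hx : x ∈ φ.source) :
    Function.Injective (mfderiv (𝓡 2) 𝓘(ℝ, Space) β x) ↔
      Function.Injective (fderiv ℝ (β ∘ φ.symm) (φ x)) := by
  have hφd : φ.MDifferentiable (𝓡 2) (𝓡 2) :=
    ⟨(contMDiffOn_of_mem_maximalAtlas hφ).mdifferentiableOn (by simp),
      (contMDiffOn_symm_of_mem_maximalAtlas hφ).mdifferentiableOn (by simp)⟩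
  have hβ : MDifferentiableAt (𝓡 2) 𝓘(ℝ, Space) β (φ.symm (φ x)) :=
    (ContMDiffMap.contMDiff β).mdifferentiable
      (by exact_mod_cast (by omega : r ≠ 0)) _
  have hcomp := mfderiv_comp (φ x) hβ (hφd.mdifferentiableAt_symm (φ.map_source hx))
  rw [mfderiv_eq_fderiv, φ.left_inv hx] at hcomp
  have hbij := hφd.symm.mfderiv_bijective (x := φ x) (φ.map_source hx)
  have heq : (fderiv ℝ (β ∘ φ.symm) (φ x) : Plane → Space) =
      mfderiv (𝓡 2) 𝓘(ℝ, Space) β x ∘ mfderiv (𝓡 2) (𝓡 2) φ.symm (φ x) := by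
    rw [hcomp]; rfl
  rw [heq]
  exact ⟨fun h => h.comp hbij.1, fun h => (Function.Injective.of_comp_iff' _ hbij).1 h⟩

end Charts

section Eval

variable {M : Type*} [TopologicalSpace M] [CompactSpace M] [ChartedSpace Plane M]
  [IsManifold (𝓡 2) ∞ M] {r : ℕ}

theorem norm_iteratedFDeriv_coord_le (f : CrMap M r) {c : M} (hc : c ∈ (chosenCover M).centers)
    {j : ℕ} (hj : j ≤ r) {y : Plane} (hy : y ∈ coordCpt M c) :
    ‖iteratedFDeriv ℝ j (f ∘ (chartAt Plane c).symm) y‖ ≤ ‖f‖ := by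
  have h0 : ‖f‖ = ‖jetMap M r f‖ := rfl
  have h1 : ‖jetMap M r f ⟨c, hc⟩‖ ≤ ‖jetMap M r f‖ := norm_le_pi_norm (jetMap M r f) ⟨c, hc⟩
  have h2 : ‖jetMap M r f ⟨c, hc⟩ ⟨j, Nat.lt_succ_of_le hj⟩‖ ≤ ‖jetMap M r f ⟨c, hc⟩‖ :=
    norm_le_pi_norm (jetMap M r f ⟨c, hc⟩) ⟨j, Nat.lt_succ_of_le hj⟩
  have h3 := (jetMap M r f ⟨c, hc⟩ ⟨j, Nat.lt_succ_of_le hj⟩).norm_coe_le_norm ⟨y, hy⟩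
  exact h3.trans (h2.trans (h1.trans h0.ge))

theorem exists_evalCLM {c : M} (hc : c ∈ (chosenCover M).centers) :
    ∃ δ : Plane → CrMap M r →L[ℝ] Space, ∀ y ∈ coordCpt M c, ∀ β,
      δ y β = β ((chartAt Plane c).symm y) := by
  classical
  refine ⟨fun y => if hy : y ∈ coordCpt M c then LinearMap.mkContinuous
    { toFun := fun β => β ((chartAt Plane c).symm y)
      map_add' := fun β γ => rfl
      map_smul' := fun a β => rfl } 1 fun β => ?_ else 0, fun y hy β => ?_⟩
  · have := norm_iteratedFDeriv_coord_le β hc (Nat.zero_le r) hy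
    rw [norm_iteratedFDeriv_zero] at this
    rw [one_mul]
    exact this
  · simp only [hy, dif_pos]
    rfl

theorem contDiffOn_eval_chartAt {c : M} (hc : c ∈ (chosenCover M).centers) {U : Set Plane}
    (hU : IsOpen U) (hconv : Convex ℝ U) (hsub : U ⊆ coordCpt M c) :
    ContDiffOn ℝ (r : WithTop ℕ∞)
      (fun q : CrMap M r × Plane => q.1 ((chartAt Plane c).symm q.2)) (univ ×ˢ U) := by
  obtain ⟨δ, hδ⟩ := exists_evalCLM (r := r) hc
  have hw : WeaklyContDiffOn δ U r 1 := by
    intro β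
    have h1 : ∀ y ∈ U, (fun y => δ y β) =ᶠ[𝓝 y] β ∘ (chartAt Plane c).symm := fun y hy => by
      filter_upwards [hU.mem_nhds hy] with z hz using hδ z (hsub hz) β
    refine ⟨((contDiffOn_coord β c).mono (hsub.trans (coordCpt_subset c))).congr
      fun y hy => hδ y (hsub hy) β, fun j hj y hy => ?_⟩
    rw [(Filter.EventuallyEq.iteratedFDeriv ℝ (h1 y hy) j).eq_of_nhds, one_mul]
    exact norm_iteratedFDeriv_coord_le β hc hj (hsub hy)
  exact (hw.contDiffOn_eval hU hconv zero_le_one r).congr fun q hq =>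
    (hδ q.2 (hsub hq.2) q.1).symm

/-- The norm bounds derivatives only in the charts of the chosen cover. An arbitrary smooth chart is
reached by composing with a smooth transition map, on a small set where that map lands in a ball
inside a coordinate compactum. -/
theorem exists_contDiffOn_eval {φ : OpenPartialHomeomorph M Plane}
    (hφ : φ ∈ IsManifold.maximalAtlas (𝓡 2) ∞ M) {q : M} (hq : q ∈ φ.source) :
    ∃ U : Set Plane, IsOpen U ∧ φ q ∈ U ∧ U ⊆ φ.target ∧
      ContDiffOn ℝ (r : WithTop ℕ∞)
        (fun z : CrMap M r × Plane => (z.1 ∘ φ.symm) z.2) (univ ×ˢ U) := by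
  obtain ⟨c, hc, hqc⟩ := (chosenCover M).covers q
  set ψ := chartAt Plane c with hψ
  have hψm : ψ ∈ IsManifold.maximalAtlas (𝓡 2) ∞ M := IsManifold.chart_mem_maximalAtlas c
  have hKs := (chosenCover M).cpt_subset c
  have hqs : q ∈ ψ.source := hKs (interior_subset hqc)
  have hopen : IsOpen (ψ '' interior ((chosenCover M).cpt c)) :=
    ψ.isOpen_image_of_subset_source isOpen_interior (interior_subset.trans hKs)
  obtain ⟨ε, hε, hball⟩ := Metric.isOpen_iff.1 hopen (ψ q) ⟨q, hqc, rfl⟩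
  have hsub : Metric.ball (ψ q) ε ⊆ coordCpt M c :=
    hball.trans (image_mono interior_subset)
  have hev := contDiffOn_eval_chartAt (r := r) hc Metric.isOpen_ball (convex_ball (ψ q) ε) hsub
  have htr := contDiffOn_transition hφ hψm
  refine ⟨(φ.target ∩ φ.symm ⁻¹' ψ.source) ∩ (ψ ∘ φ.symm) ⁻¹' Metric.ball (ψ q) ε,
    htr.continuousOn.isOpen_inter_preimage isOpen_transition_source Metric.isOpen_ball,
    ⟨⟨φ.map_source hq, by rwa [mem_preimage, φ.left_inv hq]⟩,
      by simp [φ.left_inv hq, hε]⟩, fun y hy => hy.1.1, ?_⟩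
  have htr' : ContDiffOn ℝ (r : WithTop ℕ∞) (ψ ∘ φ.symm) (φ.target ∩ φ.symm ⁻¹' ψ.source) :=
    htr.of_le (by exact_mod_cast le_top)
  refine (hev.comp (contDiffOn_fst.prodMk (htr'.comp contDiffOn_snd fun z hz => hz.2.1))
    fun z hz => ⟨mem_univ _, hz.2.2⟩).congr fun z hz => ?_
  simp only [Function.comp]
  rw [ψ.left_inv hz.2.1.2]

/-- On each of the finitely many compacta the differentials of α form a compact subset of the open
set of injective maps. A whole thickening of it stays inside, and the norm controls the distance of
first derivatives. -/
theorem immersions_mem_nhds (hr : 1 ≤ r) {α : CrMap M r} (hα : α ∈ immersions M r) :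
    immersions M r ∈ 𝓝 α := by
  have hopen : IsOpen {T : Plane →L[ℝ] Space | Function.Injective T} :=
    ContinuousLinearMap.isOpen_injective
  have hcpt : ∀ c ∈ (chosenCover M).centers, IsCompact (coordCpt M c) := fun c hc =>
    isCompact_iff_compactSpace.2 inferInstance
  have hdiff : ∀ (β : CrMap M r) (c : M), ∀ y ∈ coordCpt M c,
      DifferentiableAt ℝ (β ∘ (chartAt Plane c).symm) y := fun β c y hy =>
    (contDiffAt_coord β c ⟨y, hy⟩).differentiableAt (by exact_mod_cast (by omega : r ≠ 0))
  have key : ∀ c ∈ (chosenCover M).centers, ∀ᶠ β : CrMap M r in 𝓝 α, ∀ y ∈ coordCpt M c,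
      Function.Injective (fderiv ℝ (β ∘ (chartAt Plane c).symm) y) := by
    intro c hc
    have hcont : ContinuousOn (fderiv ℝ (α ∘ (chartAt Plane c).symm)) (coordCpt M c) :=
      ((contDiffOn_coord α c).continuousOn_fderiv_of_isOpen (chartAt Plane c).open_target
        (by exact_mod_cast hr)).mono (coordCpt_subset c)
    have hK := (hcpt c hc).image_of_continuousOn hcont
    have hsub : fderiv ℝ (α ∘ (chartAt Plane c).symm) '' coordCpt M c ⊆
        {T : Plane →L[ℝ] Space | Function.Injective T} := by
      rintro _ ⟨_, ⟨x, hx, rfl⟩, rfl⟩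
      exact (injective_mfderiv_iff hr α (IsManifold.chart_mem_maximalAtlas c)
        ((chosenCover M).cpt_subset c hx)).1 (hα x)
    obtain ⟨ε, hε, hthick⟩ := hK.exists_thickening_subset_open hopen hsub
    filter_upwards [Metric.ball_mem_nhds α hε] with β hβ y hy
    refine hthick (Metric.mem_thickening_iff.2 ⟨_, ⟨y, hy, rfl⟩, ?_⟩)
    have h1 := norm_iteratedFDeriv_coord_le (β - α) hc hr hy
    rw [← zero_add 1, ← norm_iteratedFDeriv_fderiv, norm_iteratedFDeriv_zero] at h1
    have h2 : ((β - α : CrMap M r) : M → Space) ∘ (chartAt Plane c).symm =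
        β ∘ (chartAt Plane c).symm - α ∘ (chartAt Plane c).symm := rfl
    rw [h2, fderiv_sub (hdiff β c y hy) (hdiff α c y hy)] at h1
    rw [dist_eq_norm]
    rw [Metric.mem_ball, dist_eq_norm] at hβ
    exact h1.trans_lt hβ
  filter_upwards [(eventually_all_finset _).2 key] with β hβ x
  obtain ⟨c, hc, hx⟩ := (chosenCover M).covers x
  have hxK := interior_subset hx
  exact (injective_mfderiv_iff hr β (IsManifold.chart_mem_maximalAtlas c)
    ((chosenCover M).cpt_subset c hxK)).2 (hβ c hc _ ⟨x, hxK, rfl⟩)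

end Eval

/-! ### Coefficients of the torsion form -/

/-- The coefficient of `dv²` in the torsion form. -/
def coefL (f : Plane → Space) (x : Plane) : ℝ :=
  firstForm f x 0 1 * secondForm f x 1 1 - firstForm f x 1 1 * secondForm f x 0 1

/-- The coefficient of `du dv` in the torsion form. -/
def coefM (f : Plane → Space) (x : Plane) : ℝ :=
  firstForm f x 0 0 * secondForm f x 1 1 - firstForm f x 1 1 * secondForm f x 0 0

/-- The coefficient of `du²` in the torsion form. -/
def coefN (f : Plane → Space) (x : Plane) : ℝ :=
  firstForm f x 0 0 * secondForm f x 0 1 - firstForm f x 0 1 * secondForm f x 0 0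

/-- The quadratic form `a w₁² + b w₀ w₁ + c w₀²`. -/
def quad (a b c : ℝ) (w : Plane) : ℝ := a * w 1 ^ 2 + b * (w 0 * w 1) + c * w 0 ^ 2

/-- Twice the polar form of `quad`. -/
def polar (a b c : ℝ) (w d : Plane) : ℝ :=
  a * (2 * w 1 * d 1) + b * (w 0 * d 1 + w 1 * d 0) + c * (2 * w 0 * d 0)

/-- The determinant of two vectors of the plane. -/
def wedge (v w : Plane) : ℝ := v 0 * w 1 - v 1 * w 0

/-- Rotation by a right angle. -/
def rot (w : Plane) : Plane := !₂[-w 1, w 0]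

@[simp] theorem rot_zero_apply (w : Plane) : rot w 0 = -w 1 := by simp [rot]

@[simp] theorem rot_one_apply (w : Plane) : rot w 1 = w 0 := by simp [rot]

/-- The form 𝒯 is the Jacobian of the two fundamental forms and is therefore apolar to the first
one. As E > 0, the coefficient L and its jets are determined by M and N. -/
theorem coef_relation (f : Plane → Space) (x : Plane) :
    firstForm f x 0 0 * coefL f x - firstForm f x 0 1 * coefM f x + firstForm f x 1 1 * coefN f x
      = 0 := by
  simp only [coefL, coefM, coefN]; ring

theorem firstForm_symm (f : Plane → Space) (x : Plane) : firstForm f x 1 0 = firstForm f x 0 1 := by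
  simp only [firstForm, Matrix.of_apply]
  exact real_inner_comm _ _

theorem norm_vecProd_sq (a b : Space) :
    ‖vecProd a b‖ ^ 2 = inner ℝ a a * inner ℝ b b - inner ℝ a b ^ 2 := by
  rw [← real_inner_self_eq_norm_sq]
  simp only [vecProd, PiLp.inner_apply, Fin.sum_univ_three, cross_apply, RCLike.inner_apply,
    conj_trivial, Matrix.cons_val]
  ring

theorem inner_vecProd_left (a b : Space) : inner ℝ (vecProd a b) a = (0 : ℝ) := by
  simp only [vecProd, PiLp.inner_apply, Fin.sum_univ_three, cross_apply, RCLike.inner_apply,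
    conj_trivial, Matrix.cons_val]
  ring

theorem inner_vecProd_right (a b : Space) : inner ℝ (vecProd a b) b = (0 : ℝ) := by
  simp only [vecProd, PiLp.inner_apply, Fin.sum_univ_three, cross_apply, RCLike.inner_apply,
    conj_trivial, Matrix.cons_val]
  ring

theorem vecProd_linear_comb (a b : Space) (p q s t : ℝ) :
    vecProd (p • a + q • b) (s • a + t • b) = (p * t - q * s) • vecProd a b := by
  ext i
  fin_cases i <;>
  · simp [vecProd, cross_apply]
    ring

/-- The coordinate vectors `f_u`, `f_v` are independent. -/
def Immersive (f : Plane → Space) (x : Plane) : Prop :=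
  vecProd (partialD 0 f x) (partialD 1 f x) ≠ 0

theorem gram_pos {f : Plane → Space} {x : Plane} (h : Immersive f x) :
    0 < firstForm f x 0 0 ∧ 0 < firstForm f x 0 0 * firstForm f x 1 1 - firstForm f x 0 1 ^ 2 := by
  have h1 : 0 < firstForm f x 0 0 * firstForm f x 1 1 - firstForm f x 0 1 ^ 2 := by
    have := norm_vecProd_sq (partialD 0 f x) (partialD 1 f x)
    simp only [firstForm, Matrix.of_apply]
    rw [← this]
    exact pow_pos (norm_pos_iff.2 h) 2
  refine ⟨?_, h1⟩
  have hE : 0 ≤ firstForm f x 0 0 := by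
    simp only [firstForm, Matrix.of_apply]; exact real_inner_self_nonneg
  rcases hE.lt_or_eq with h2 | h2
  · exact h2
  · rw [← h2] at h1
    nlinarith [sq_nonneg (firstForm f x 0 1)]

theorem plane_eq (w : Plane) :
    w = w 0 • EuclideanSpace.single 0 (1 : ℝ) + w 1 • EuclideanSpace.single 1 (1 : ℝ) := by
  ext i; fin_cases i <;> simp

theorem clm_plane_apply {F : Type*} [NormedAddCommGroup F] [NormedSpace ℝ F] (T : Plane →L[ℝ] F)
    (w : Plane) :
    T w = w 0 • T (EuclideanSpace.single 0 1) + w 1 • T (EuclideanSpace.single 1 1) := by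
  conv_lhs => rw [plane_eq w]
  simp only [map_add, map_smul]

theorem injective_fderiv_iff_immersive {f : Plane → Space} {x : Plane} :
    Function.Injective (fderiv ℝ f x) ↔ Immersive f x := by
  have hsplit := clm_plane_apply (fderiv ℝ f x)
  constructor
  · intro h h0
    have hLI : LinearIndependent ℝ ![partialD 0 f x, partialD 1 f x] := by
      rw [LinearIndependent.pair_iff]
      intro s t hst
      have h1 : fderiv ℝ f x !₂[s, t] = 0 := by
        rw [hsplit]; simpa [partialD] using hst
      have h2 : (!₂[s, t] : Plane) = 0 := h (by rw [h1, map_zero])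
      exact ⟨by simpa using congrArg (fun w : Plane => w 0) h2,
        by simpa using congrArg (fun w : Plane => w 1) h2⟩
    have hg := norm_vecProd_sq (partialD 0 f x) (partialD 1 f x)
    rw [h0, norm_zero] at hg
    have h3 := LinearIndependent.pair_iff.1 hLI
    set a := partialD 0 f x
    set b := partialD 1 f x
    have hb : b ≠ 0 := hLI.ne_zero 1
    -- The squared norm of this combination is |b|² times the Gram determinant, which vanishes here.
    have h4 : inner ℝ b b • a + (-inner ℝ a b : ℝ) • b = 0 := by
      rw [← inner_self_eq_zero (𝕜 := ℝ)]
      simp only [inner_add_left, inner_add_right, inner_smul_left, inner_smul_right, conj_trivial,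
        real_inner_comm a b]
      linear_combination -(inner ℝ b b : ℝ) * hg
    exact hb (inner_self_eq_zero.1 (h3 _ _ h4).1)
  · intro h
    rw [injective_iff_map_eq_zero]
    intro w hw
    rw [hsplit] at hw
    have h1 : ∀ p q : ℝ, p * (w 1) - q * (w 0) = 0 := fun p q => by
      have h2 := vecProd_linear_comb (partialD 0 f x) (partialD 1 f x) p q (w 0) (w 1)
      have h3 : w 0 • partialD 0 f x + w 1 • partialD 1 f x = 0 := hw
      rw [h3] at h2
      have h4 : ∀ c : Space, vecProd c 0 = 0 := fun c => by simp [vecProd]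
      rw [h4] at h2
      exact (smul_eq_zero.1 h2.symm).resolve_right h
    ext i
    fin_cases i
    · simpa using h1 0 (-1)
    · simpa using h1 1 0

theorem secondForm_symm {f : Plane → Space} {x : Plane} (hf : ContDiffAt ℝ 2 f x) :
    secondForm f x 1 0 = secondForm f x 0 1 := by
  have hd : DifferentiableAt ℝ (fderiv ℝ f) x :=
    (hf.fderiv_right (m := 1) (by norm_num)).differentiableAt (by simp)
  have h1 : ∀ i j, partialD i (partialD j f) x =
      fderiv ℝ (fderiv ℝ f) x (EuclideanSpace.single i 1) (EuclideanSpace.single j 1) := by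
    intro i j
    change fderiv ℝ (fun y => fderiv ℝ f y (EuclideanSpace.single j 1)) x _ = _
    rw [fderiv_clm_apply hd (differentiableAt_const _)]
    simp
  have h2 := hf.isSymmSndFDerivAt (by simp)
  simp only [secondForm, Matrix.of_apply, h1]
  rw [h2.eq]

/-- With Δ = EG - F², the identity 4E²Δ²(H² - K) = (EM - 2FN)² + 4ΔN² displays the discriminant as a
sum of two nonnegative terms. -/
theorem locUmbilic_iff {f : Plane → Space} {x : Plane} (hf : ContDiffAt ℝ 2 f x)
    (him : Immersive f x) : LocUmbilic f x ↔ coefM f x = 0 ∧ coefN f x = 0 := by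
  obtain ⟨hE, hΔ⟩ := gram_pos him
  have hs := secondForm_symm hf
  have hf1 := firstForm_symm f x
  have hdet : (firstForm f x).det =
      firstForm f x 0 0 * firstForm f x 1 1 - firstForm f x 0 1 ^ 2 := by
    rw [Matrix.det_fin_two, hf1]; ring
  have hK : gaussCurv f x = (firstForm f x 0 0 * firstForm f x 1 1 - firstForm f x 0 1 ^ 2)⁻¹ *
      (secondForm f x 0 0 * secondForm f x 1 1 - secondForm f x 0 1 ^ 2) := by
    rw [gaussCurv, shapeMatrix, Matrix.det_mul, Matrix.det_nonsing_inv, Ring.inverse_eq_inv', hdet,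
      Matrix.det_fin_two (secondForm f x), hs]
    ring
  have key : 4 * (firstForm f x 0 0) ^ 2 *
      (firstForm f x 0 0 * firstForm f x 1 1 - firstForm f x 0 1 ^ 2) ^ 2 *
      (meanCurv f x ^ 2 - gaussCurv f x) =
      (firstForm f x 0 0 * coefM f x - 2 * firstForm f x 0 1 * coefN f x) ^ 2 +
      4 * (firstForm f x 0 0 * firstForm f x 1 1 - firstForm f x 0 1 ^ 2) * coefN f x ^ 2 := by
    rw [hK]
    simp only [meanCurv, shapeMatrix, Matrix.inv_def, Ring.inverse_eq_inv', hdet, Matrix.adjugate_fin_two, Matrix.trace_fin_two,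
      Matrix.mul_apply, Fin.sum_univ_two, Matrix.smul_apply, Matrix.of_apply, Matrix.cons_val,
      hs, hf1, smul_eq_mul, coefM, coefN]
    field_simp
    ring
  constructor
  · intro h
    unfold LocUmbilic at h
    rw [h, mul_zero] at key
    have h1 : 0 ≤ 4 * (firstForm f x 0 0 * firstForm f x 1 1 - firstForm f x 0 1 ^ 2)
      * coefN f x ^ 2 := by positivity
    have h2 := sq_nonneg (firstForm f x 0 0 * coefM f x - 2 * firstForm f x 0 1 * coefN f x)
    have h3 : 4 * (firstForm f x 0 0 * firstForm f x 1 1 - firstForm f x 0 1 ^ 2)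
      * coefN f x ^ 2 = 0 := by linarith
    have hN : coefN f x = 0 := by
      rcases mul_eq_zero.1 h3 with h4 | h4
      · linarith
      · exact pow_eq_zero_iff (two_ne_zero) |>.1 h4
    rw [hN] at key
    have h5 : (firstForm f x 0 0 * coefM f x) ^ 2 = 0 := by linear_combination -key
    exact ⟨(mul_eq_zero.1 (pow_eq_zero_iff (two_ne_zero) |>.1 h5)).resolve_left hE.ne', hN⟩
  · rintro ⟨h1, h2⟩
    rw [h1, h2] at key
    have h3 : 4 * (firstForm f x 0 0) ^ 2 *
      (firstForm f x 0 0 * firstForm f x 1 1 - firstForm f x 0 1 ^ 2) ^ 2 ≠ 0 := by positivity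
    exact (mul_eq_zero.1 (key.trans (by ring))).resolve_left h3

theorem coefL_eq_zero {f : Plane → Space} {x : Plane} (him : Immersive f x)
    (hM : coefM f x = 0) (hN : coefN f x = 0) : coefL f x = 0 := by
  have h := coef_relation f x
  rw [hM, hN] at h
  exact (mul_eq_zero.1 (by linarith : firstForm f x 0 0 * coefL f x = 0)).resolve_left
    (gram_pos him).1.ne'

/-! ### Derivatives of the lifted function and of the Lie-Cartan field -/

/-- The velocity of `affineDir l`. -/
def dirVel : OnePoint ℝ → Plane
  | OnePoint.some _ => !₂[0, 1]
  | OnePoint.infty => !₂[1, 0]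

/-- The direction represented by a point of the projective line. -/
def dir (l : OnePoint ℝ) : Plane := affineDir l (affineCoord l)

theorem hasDerivAt_affineDir_apply (l : OnePoint ℝ) (s : ℝ) (i : Fin 2) :
    HasDerivAt (fun s => affineDir l s i) (dirVel l i) s := by
  induction l using OnePoint.rec <;> fin_cases i <;>
    simp [affineDir, dirVel, hasDerivAt_id', hasDerivAt_const]

theorem hasFDerivAt_affineDir_apply (l : OnePoint ℝ) (z : Plane × ℝ) (i : Fin 2) :
    HasFDerivAt (fun z : Plane × ℝ => affineDir l z.2 i)
      (dirVel l i • ContinuousLinearMap.snd ℝ Plane ℝ) z :=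
  (hasDerivAt_affineDir_apply l z.2 i).comp_hasFDerivAt z hasFDerivAt_snd

theorem affineDir_add (l : OnePoint ℝ) (s t : ℝ) :
    affineDir l (s + t) = affineDir l s + t • dirVel l := by
  induction l using OnePoint.rec <;> ext i <;> fin_cases i <;> simp [affineDir, dirVel]

/-- The determinant is 1 in the chart p and -1 in the chart q; squaring treats the two charts at
once. -/
theorem wedge_dir_sq (l : OnePoint ℝ) : wedge (dir l) (dirVel l) ^ 2 = 1 := by
  induction l using OnePoint.rec <;> simp [dir, wedge, affineDir, dirVel, affineCoord]

theorem dir_ne_zero (l : OnePoint ℝ) : dir l ≠ 0 := by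
  intro h
  have := wedge_dir_sq l
  rw [h] at this
  simp [wedge] at this

section Calculus

variable {a b c : Plane → ℝ} {l : OnePoint ℝ} {z : Plane × ℝ}

theorem hasFDerivAt_quad (ha : DifferentiableAt ℝ a z.1) (hb : DifferentiableAt ℝ b z.1)
    (hc : DifferentiableAt ℝ c z.1) :
    ∃ D : Plane × ℝ →L[ℝ] ℝ, HasFDerivAt
      (fun z : Plane × ℝ => quad (a z.1) (b z.1) (c z.1) (affineDir l z.2)) D z ∧
      ∀ v σ, D (v, σ) = quad (fderiv ℝ a z.1 v) (fderiv ℝ b z.1 v) (fderiv ℝ c z.1 v)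
        (affineDir l z.2) + σ * polar (a z.1) (b z.1) (c z.1) (affineDir l z.2) (dirVel l) := by
  have hw := hasFDerivAt_affineDir_apply l z
  have hl : ∀ {g : Plane → ℝ}, DifferentiableAt ℝ g z.1 → HasFDerivAt (fun z : Plane × ℝ => g z.1)
      ((fderiv ℝ g z.1).comp (ContinuousLinearMap.fst ℝ Plane ℝ)) z := fun h =>
    h.hasFDerivAt.comp z hasFDerivAt_fst
  refine ⟨_, (((hl ha).mul ((hw 1).pow 2)).add ((hl hb).mul ((hw 0).mul (hw 1)))).add
    ((hl hc).mul ((hw 0).pow 2)), fun v σ => ?_⟩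
  simp [quad, polar]
  ring

theorem hasFDerivAt_polar (ha : DifferentiableAt ℝ a z.1) (hb : DifferentiableAt ℝ b z.1)
    (hc : DifferentiableAt ℝ c z.1) :
    ∃ D : Plane × ℝ →L[ℝ] ℝ, HasFDerivAt
      (fun z : Plane × ℝ => polar (a z.1) (b z.1) (c z.1) (affineDir l z.2) (dirVel l)) D z ∧
      ∀ v σ, D (v, σ) = polar (fderiv ℝ a z.1 v) (fderiv ℝ b z.1 v) (fderiv ℝ c z.1 v)
        (affineDir l z.2) (dirVel l)
        + σ * polar (a z.1) (b z.1) (c z.1) (dirVel l) (dirVel l) := by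
  have hw := hasFDerivAt_affineDir_apply l z
  have hl : ∀ {g : Plane → ℝ}, DifferentiableAt ℝ g z.1 → HasFDerivAt (fun z : Plane × ℝ => g z.1)
      ((fderiv ℝ g z.1).comp (ContinuousLinearMap.fst ℝ Plane ℝ)) z := fun h =>
    h.hasFDerivAt.comp z hasFDerivAt_fst
  refine ⟨_, (((hl ha).mul (((hw 1).const_mul 2).mul_const (dirVel l 1))).add
    ((hl hb).mul (((hw 0).mul_const (dirVel l 1)).add ((hw 1).mul_const (dirVel l 0))))).add
    ((hl hc).mul (((hw 0).const_mul 2).mul_const (dirVel l 0))), fun v σ => ?_⟩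
  simp [polar]
  ring

end Calculus

/-- `∂_u 𝒯` in the direction `w` at an umbilic point. -/
def dquad (f : Plane → Space) (x u w : Plane) : ℝ :=
  quad (fderiv ℝ (coefL f) x u) (fderiv ℝ (coefM f) x u) (fderiv ℝ (coefN f) x u) w

/-- The derivative of `dquad f x u` at `w` in the direction `d`. -/
def dpolar (f : Plane → Space) (x u w d : Plane) : ℝ :=
  polar (fderiv ℝ (coefL f) x u) (fderiv ℝ (coefM f) x u) (fderiv ℝ (coefN f) x u) w d

/-- `∂_v ∂_u 𝒯` in the direction `w` at an umbilic point. -/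
def ddquad (f : Plane → Space) (x v u w : Plane) : ℝ :=
  quad (fderiv ℝ (fderiv ℝ (coefL f)) x v u) (fderiv ℝ (fderiv ℝ (coefM f)) x v u)
    (fderiv ℝ (fderiv ℝ (coefN f)) x v u) w

/-- The coefficients of the torsion form are of class `C²` and vanish at `x`. -/
structure FlatAt (f : Plane → Space) (x : Plane) : Prop where
  contL : ContDiffAt ℝ 2 (coefL f) x
  contM : ContDiffAt ℝ 2 (coefM f) x
  contN : ContDiffAt ℝ 2 (coefN f) x
  zeroL : coefL f x = 0
  zeroM : coefM f x = 0
  zeroN : coefN f x = 0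

section Flat

variable {f : Plane → Space} {x : Plane}

theorem _root_.ContDiffAt.differentiableAt_fderiv {E F : Type*} [NormedAddCommGroup E]
    [NormedSpace ℝ E] [NormedAddCommGroup F] [NormedSpace ℝ F] {g : E → F} {x : E}
    (h : ContDiffAt ℝ 2 g x) : DifferentiableAt ℝ (fderiv ℝ g) x :=
  (h.fderiv_right (m := 1) (by norm_num)).differentiableAt (by simp)

theorem _root_.ContDiffAt.eventually_differentiableAt {E F : Type*} [NormedAddCommGroup E]
    [NormedSpace ℝ E] [NormedAddCommGroup F] [NormedSpace ℝ F] {g : E → F} {x : E}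
    (h : ContDiffAt ℝ 2 g x) : ∀ᶠ y in 𝓝 x, DifferentiableAt ℝ g y := by
  filter_upwards [h.eventually (by simp)] with y hy using hy.differentiableAt (by simp)

theorem quad_zero (w : Plane) : quad 0 0 0 w = 0 := by simp [quad]

theorem polar_zero (w d : Plane) : polar 0 0 0 w d = 0 := by simp [polar]

theorem FlatAt.eventually_fderiv (h : FlatAt f x) (l : OnePoint ℝ) (s : ℝ) :
    ∀ᶠ z in 𝓝 ((x, s) : Plane × ℝ), DifferentiableAt ℝ (liftFun f l) z ∧
      ∀ v σ, fderiv ℝ (liftFun f l) z (v, σ) = dquad f z.1 v (affineDir l z.2) +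
        σ * polar (coefL f z.1) (coefM f z.1) (coefN f z.1) (affineDir l z.2) (dirVel l) := by
  have hfst : Tendsto Prod.fst (𝓝 ((x, s) : Plane × ℝ)) (𝓝 x) := continuous_fst.tendsto (x, s)
  filter_upwards [hfst.eventually h.contL.eventually_differentiableAt,
    hfst.eventually h.contM.eventually_differentiableAt,
    hfst.eventually h.contN.eventually_differentiableAt] with z h1 h2 h3
  obtain ⟨D, hD, hDv⟩ := hasFDerivAt_quad (l := l) h1 h2 h3
  have hD' : HasFDerivAt (liftFun f l) D z := hD
  refine ⟨hD'.differentiableAt, fun v σ => ?_⟩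
  rw [hD'.fderiv, hDv]
  rfl

theorem FlatAt.fderiv_liftFun (h : FlatAt f x) (l : OnePoint ℝ) (v : Plane) (σ : ℝ) :
    fderiv ℝ (liftFun f l) (x, affineCoord l) (v, σ) = dquad f x v (dir l) := by
  rw [(h.eventually_fderiv l (affineCoord l)).self_of_nhds.2 v σ]
  simp only [h.zeroL, h.zeroM, h.zeroN, polar_zero, mul_zero, add_zero]
  rfl

theorem FlatAt.regularAt_iff (h : FlatAt f x) (l : OnePoint ℝ) :
    RegularAt f x l ↔ ∃ u, dquad f x u (dir l) ≠ 0 := by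
  unfold RegularAt
  rw [← not_iff_not]
  push Not
  constructor
  · intro h0 u
    rw [← h.fderiv_liftFun l u 0, h0]; rfl
  · intro h0
    refine ContinuousLinearMap.ext fun ⟨v, σ⟩ => ?_
    rw [h.fderiv_liftFun, h0]; rfl

theorem FlatAt.eventually_lieCartan (h : FlatAt f x) (l : OnePoint ℝ) (s : ℝ) :
    ∀ᶠ z in 𝓝 ((x, s) : Plane × ℝ), lieCartan f l z =
      (polar (coefL f z.1) (coefM f z.1) (coefN f z.1) (affineDir l z.2) (dirVel l) •
        affineDir l z.2, -dquad f z.1 (affineDir l z.2) (affineDir l z.2)) := by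
  filter_upwards [h.eventually_fderiv l s] with z hz
  rw [lieCartan, hz.2, hz.2]
  simp [dquad, quad_zero]

theorem FlatAt.singularAt_iff (h : FlatAt f x) (l : OnePoint ℝ) :
    SingularAt f x l ↔ dquad f x (dir l) (dir l) = 0 := by
  unfold SingularAt
  rw [(h.eventually_lieCartan l (affineCoord l)).self_of_nhds]
  simp only [h.zeroL, h.zeroM, h.zeroN, polar_zero, zero_smul]
  rw [Prod.ext_iff]
  simp [dir]

/-- All torsion coefficients vanish at `x`, so the fibre direction is invariant, with eigenvalue
minus the derivative of the cubic form. Modulo the fibre, `(dir l, 0)` is multiplied by the mixed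
derivative of 𝒯. The entry κ lies off the diagonal and does not affect the eigenvalues. -/
theorem FlatAt.fderiv_lieCartan (h : FlatAt f x) (l : OnePoint ℝ) :
    (fderiv ℝ (lieCartan f l) (x, affineCoord l) (0, 1) =
      (0, -(dquad f x (dirVel l) (dir l) + dpolar f x (dir l) (dir l) (dirVel l)))) ∧
    ∃ κ, fderiv ℝ (lieCartan f l) (x, affineCoord l) (dir l, 0) =
      (dpolar f x (dir l) (dir l) (dirVel l) • dir l, κ) := by
  have hdL := h.contL.differentiableAt_fderiv
  have hdM := h.contM.differentiableAt_fderiv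
  have hdN := h.contN.differentiableAt_fderiv
  obtain ⟨D₁, hD₁, hD₁v⟩ := hasFDerivAt_polar (l := l) (z := (x, affineCoord l))
    (h.contL.differentiableAt (by simp)) (h.contM.differentiableAt (by simp))
    (h.contN.differentiableAt (by simp))
  have hw : HasFDerivAt (fun z : Plane × ℝ => affineDir l z.2)
      ((ContinuousLinearMap.snd ℝ Plane ℝ).smulRight (dirVel l)) (x, affineCoord l) := by
    have h1 : ∀ z : Plane × ℝ, affineDir l z.2 = affineDir l 0 + z.2 • dirVel l := fun z => by
      rw [← affineDir_add, zero_add]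
    simp only [h1]
    exact ((hasFDerivAt_snd (𝕜 := ℝ) (p := (x, affineCoord l))).smul_const (dirVel l)).const_add _
  have h2 : ∀ {g : Plane → ℝ}, DifferentiableAt ℝ (fderiv ℝ g) x →
      HasFDerivAt (fun z : Plane × ℝ => fderiv ℝ g z.1 (affineDir l z.2))
      _ (x, affineCoord l) := fun hg =>
    HasFDerivAt.clm_apply (HasFDerivAt.comp (x, affineCoord l) hg.hasFDerivAt hasFDerivAt_fst) hw
  have hwi := hasFDerivAt_affineDir_apply l (x, affineCoord l)
  have hD₂ := ((((h2 hdL).mul ((hwi 1).pow 2)).add ((h2 hdM).mul ((hwi 0).mul (hwi 1)))).add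
    ((h2 hdN).mul ((hwi 0).pow 2))).neg
  have hX := ((hD₁.smul hw).prodMk hD₂).congr_of_eventuallyEq
    (h.eventually_lieCartan l (affineCoord l))
  rw [hX.fderiv]
  constructor
  · refine Prod.ext ?_ ?_
    · simp [hD₁v, h.zeroL, h.zeroM, h.zeroN, polar]
    · simp [dquad, dpolar, quad, polar, dir]
      ring
  · refine ⟨_, Prod.ext ?_ rfl⟩
    simp [hD₁v, h.zeroL, h.zeroM, h.zeroN, polar_zero, dpolar, dir]

theorem FlatAt.tangentEigenvalues (h : FlatAt f x) (l : OnePoint ℝ)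
    (hs : dquad f x (dir l) (dir l) = 0) :
    TangentEigenvalues f x l
      (-(dquad f x (dirVel l) (dir l) + dpolar f x (dir l) (dir l) (dirVel l)))
      (dpolar f x (dir l) (dir l) (dirVel l)) := by
  obtain ⟨h1, κ, h2⟩ := h.fderiv_lieCartan l
  refine ⟨(0, 1), (dir l, 0), ?_, ?_, ?_, ?_, κ, ?_⟩
  · rw [LinearIndependent.pair_iff]
    intro s t hst
    have h3 := congrArg Prod.fst hst
    have h4 := congrArg Prod.snd hst
    simp only [Prod.fst_add, Prod.smul_fst, smul_zero, zero_add, Prod.fst_zero, smul_eq_zero,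
      dir_ne_zero, or_false] at h3
    simp only [Prod.snd_add, Prod.smul_snd, smul_eq_mul, mul_one, mul_zero, add_zero,
      Prod.snd_zero] at h4
    exact ⟨h4, h3⟩
  · rw [h.fderiv_liftFun]
    simp [dquad, quad_zero]
  · rw [h.fderiv_liftFun, hs]
  · rw [h1]; simp
  · rw [h2]; simp

theorem FlatAt.saddleAt (h : FlatAt f x) (l : OnePoint ℝ) (hs : dquad f x (dir l) (dir l) = 0)
    (hr : dquad f x (dirVel l) (dir l) ≠ 0)
    (hp : 0 < (dquad f x (dirVel l) (dir l) + dpolar f x (dir l) (dir l) (dirVel l)) *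
      dpolar f x (dir l) (dir l) (dirVel l)) : SaddleAt f x l :=
  ⟨(h.regularAt_iff l).2 ⟨_, hr⟩, (h.singularAt_iff l).2 hs, _, _, by linarith,
    h.tangentEigenvalues l hs⟩

theorem FlatAt.nodeAt (h : FlatAt f x) (l : OnePoint ℝ) (hs : dquad f x (dir l) (dir l) = 0)
    (hr : dquad f x (dirVel l) (dir l) ≠ 0)
    (hp : (dquad f x (dirVel l) (dir l) + dpolar f x (dir l) (dir l) (dirVel l)) *
      dpolar f x (dir l) (dir l) (dirVel l) < 0) : NodeAt f x l :=
  ⟨(h.regularAt_iff l).2 ⟨_, hr⟩, (h.singularAt_iff l).2 hs, _, _, by linarith,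
    h.tangentEigenvalues l hs⟩

/-- There is no term in σ τ: the second fibre derivative is a combination of torsion coefficients,
which vanish at `x`. -/
theorem FlatAt.fderiv_fderiv_liftFun (h : FlatAt f x) (l : OnePoint ℝ) (v u : Plane) (σ τ : ℝ) :
    fderiv ℝ (fderiv ℝ (liftFun f l)) (x, affineCoord l) (v, σ) (u, τ) =
      ddquad f x v u (dir l) + σ * dpolar f x u (dir l) (dirVel l)
        + τ * dpolar f x v (dir l) (dirVel l) := by
  have hdir : ContDiff ℝ 2 (affineDir l) := by
    have h1 : ∀ s : ℝ, affineDir l s = affineDir l 0 + s • dirVel l := fun s => by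
      rw [← affineDir_add, zero_add]
    have h2 : affineDir l = fun s => affineDir l 0 + s • dirVel l := funext h1
    rw [h2]
    exact contDiff_const.add (contDiff_id.smul contDiff_const)
  have hdiri : ∀ i, ContDiffAt ℝ 2 (fun z : Plane × ℝ => affineDir l z.2 i) (x, affineCoord l) :=
    fun i => ((contDiff_euclidean.1 hdir i).comp contDiff_snd).contDiffAt
  have hlift : ContDiffAt ℝ 2 (liftFun f l) (x, affineCoord l) := by
    have hc : ∀ {g : Plane → ℝ}, ContDiffAt ℝ 2 g x →
        ContDiffAt ℝ 2 (fun z : Plane × ℝ => g z.1) (x, affineCoord l) := fun hg =>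
      ContDiffAt.comp (x, affineCoord l) hg contDiffAt_fst
    exact (((hc h.contL).mul ((hdiri 1).pow 2)).add
      ((hc h.contM).mul ((hdiri 0).mul (hdiri 1)))).add ((hc h.contN).mul ((hdiri 0).pow 2))
  have h1 : fderiv ℝ (fderiv ℝ (liftFun f l)) (x, affineCoord l) (v, σ) (u, τ) =
      fderiv ℝ (fun z => fderiv ℝ (liftFun f l) z (u, τ)) (x, affineCoord l) (v, σ) := by
    rw [fderiv_clm_apply hlift.differentiableAt_fderiv (differentiableAt_const _)]
    simp
  have happ : ∀ {g : Plane → ℝ}, ContDiffAt ℝ 2 g x →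
      DifferentiableAt ℝ (fun y => fderiv ℝ g y u) x ∧
        ∀ v, fderiv ℝ (fun y => fderiv ℝ g y u) x v = fderiv ℝ (fderiv ℝ g) x v u := by
    intro g hg
    refine ⟨hg.differentiableAt_fderiv.clm_apply (differentiableAt_const _), fun v => ?_⟩
    rw [fderiv_clm_apply hg.differentiableAt_fderiv (differentiableAt_const _)]
    simp
  obtain ⟨D₁, hD₁, hD₁v⟩ := hasFDerivAt_quad (l := l) (z := (x, affineCoord l))
    (happ h.contL).1 (happ h.contM).1 (happ h.contN).1
  obtain ⟨D₂, hD₂, hD₂v⟩ := hasFDerivAt_polar (l := l) (z := (x, affineCoord l))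
    (h.contL.differentiableAt (by simp)) (h.contM.differentiableAt (by simp))
    (h.contN.differentiableAt (by simp))
  have h3 := (hD₁.add (hD₂.const_mul τ)).congr_of_eventuallyEq
    ((h.eventually_fderiv l (affineCoord l)).mono fun z hz => hz.2 u τ)
  rw [h1, h3.fderiv]
  simp only [add_apply, smul_apply, hD₁v, hD₂v, (happ h.contL).2, (happ h.contM).2,
    (happ h.contN).2, h.zeroL, h.zeroM, h.zeroN, polar_zero, mul_zero, add_zero, smul_eq_mul]
  rfl

end Flat

/-! ### Directions and points of the projective line -/

open Classical in
/-- The point of the projective line given by a direction. -/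
def toLine (w : Plane) : OnePoint ℝ := if w 0 = 0 then OnePoint.infty else OnePoint.some (w 1 / w 0)

theorem dir_toLine {w : Plane} (hw : w ≠ 0) : ∃ ρ : ℝ, ρ ≠ 0 ∧ dir (toLine w) = ρ • w := by
  by_cases h : w 0 = 0
  · have h1 : w 1 ≠ 0 := fun h1 => hw (by ext i; fin_cases i <;> simp [h, h1])
    refine ⟨(w 1)⁻¹, inv_ne_zero h1, ?_⟩
    ext i; fin_cases i <;> simp [toLine, h, dir, affineDir, affineCoord, h1]
  · refine ⟨(w 0)⁻¹, inv_ne_zero h, ?_⟩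
    ext i; fin_cases i <;> simp [toLine, h, dir, affineDir, affineCoord]
    field_simp

theorem eq_of_wedge_dir {l l' : OnePoint ℝ} (h : wedge (dir l) (dir l') = 0) : l = l' := by
  induction l using OnePoint.rec <;> induction l' using OnePoint.rec <;>
    simp_all [dir, affineDir, affineCoord, wedge]
  linarith

theorem wedge_smul_right (v w : Plane) (c : ℝ) : wedge v (c • w) = c * wedge v w := by
  simp [wedge]; ring

theorem wedge_smul_left (v w : Plane) (c : ℝ) : wedge (c • v) w = c * wedge v w := by
  simp [wedge]; ring

theorem ne_zero_of_wedge {v w : Plane} (h : wedge v w ≠ 0) : v ≠ 0 ∧ w ≠ 0 := by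
  constructor <;> rintro rfl <;> simp [wedge] at h

theorem normSq_pos {w : Plane} (h : w ≠ 0) : 0 < w 0 ^ 2 + w 1 ^ 2 := by
  by_contra hc
  have h0 : w 0 = 0 := by nlinarith [sq_nonneg (w 0), sq_nonneg (w 1)]
  have h1 : w 1 = 0 := by nlinarith [sq_nonneg (w 0), sq_nonneg (w 1)]
  exact h (by ext i; fin_cases i <;> simp [h0, h1])

theorem toLine_ne {v w : Plane} (h : wedge v w ≠ 0) : toLine v ≠ toLine w := by
  intro he
  obtain ⟨hv, hw⟩ := ne_zero_of_wedge h
  obtain ⟨ρ, hρ, h1⟩ := dir_toLine hv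
  obtain ⟨σ, hσ, h2⟩ := dir_toLine hw
  rw [he, h2] at h1
  have h3 : wedge (ρ • v) (σ • w) = 0 := by rw [← h1]; simp [wedge]; ring
  rw [wedge_smul_left, wedge_smul_right] at h3
  simp_all

theorem eq_toLine {l : OnePoint ℝ} {w : Plane} (hw : w ≠ 0) (h : wedge (dir l) w = 0) :
    l = toLine w := by
  obtain ⟨ρ, hρ, h1⟩ := dir_toLine hw
  exact eq_of_wedge_dir (by rw [h1, wedge_smul_right, h, mul_zero])

/-! ### Quadratic forms with values in covectors -/

/-- The value at the direction `w` and the vector `u` of the quadratic form with values in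
covectors whose coefficients are listed in `j`. -/
def cquad (j : Fin 6 → ℝ) (u w : Plane) : ℝ :=
  quad (u 0 * j 0 + u 1 * j 1) (u 0 * j 2 + u 1 * j 3) (u 0 * j 4 + u 1 * j 5) w

/-- The derivative of `cquad j u` at `w` in the direction `d`. -/
def cpolar (j : Fin 6 → ℝ) (u w d : Plane) : ℝ :=
  polar (u 0 * j 0 + u 1 * j 1) (u 0 * j 2 + u 1 * j 3) (u 0 * j 4 + u 1 * j 5) w d

/-- The derivative of the cubic form `w ↦ cquad j w w` at `w` in the direction `d`. -/
def ccubic (j : Fin 6 → ℝ) (w d : Plane) : ℝ := cquad j d w + cpolar j w w d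

/-- Passes from the chart velocity `dirVel` to `rot w`. Splitting the velocity along w and `rot w`,
the part along w contributes a multiple of `cquad j w w`, which is 0. Both numbers acquire the same
factor μ, so signs of their products are unchanged. -/
theorem exists_scale {w : Plane} (hw : w ≠ 0) : ∃ ρ μ : ℝ, ρ ≠ 0 ∧ μ ≠ 0 ∧
    dir (toLine w) = ρ • w ∧ ∀ j, cquad j w w = 0 →
      cquad j (dirVel (toLine w)) (dir (toLine w)) = μ * cquad j (rot w) w ∧
      cpolar j (dir (toLine w)) (dir (toLine w)) (dirVel (toLine w)) =
        μ * cpolar j w w (rot w) := by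
  obtain ⟨ρ, hρ, h1⟩ := dir_toLine hw
  set d := dirVel (toLine w) with hd
  have h2 : wedge w d ≠ 0 := by
    intro h0
    have := wedge_dir_sq (toLine w)
    rw [h1, wedge_smul_left, h0] at this
    simp at this
  have h3 := (normSq_pos hw).ne'
  refine ⟨ρ, ρ ^ 2 * (wedge w d / (w 0 ^ 2 + w 1 ^ 2)), hρ, by positivity, h1, fun j hj => ?_⟩
  rw [h1]
  constructor
  · have h4 : (w 0 ^ 2 + w 1 ^ 2) * cquad j d w =
        (w 0 * d 0 + w 1 * d 1) * cquad j w w + wedge w d * cquad j (rot w) w := by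
      simp [cquad, quad, wedge]; ring
    rw [hj, mul_zero, zero_add] at h4
    have h5 : cquad j d (ρ • w) = ρ ^ 2 * cquad j d w := by
      simp [cquad, quad]; ring
    rw [h5]
    field_simp
    linear_combination h4
  · have h4 : (w 0 ^ 2 + w 1 ^ 2) * cpolar j w w d =
        (w 0 * d 0 + w 1 * d 1) * (2 * cquad j w w) + wedge w d * cpolar j w w (rot w) := by
      simp [cquad, cpolar, quad, polar, wedge]; ring
    rw [hj, mul_zero, mul_zero, zero_add] at h4
    have h5 : cpolar j (ρ • w) (ρ • w) d = ρ ^ 2 * cpolar j w w d := by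
      simp [cpolar, polar]; ring
    rw [h5]
    field_simp
    linear_combination h4

/-- The coefficients are those of `𝒯` at an umbilic point where the first fundamental form is
`E du² + 2 F du dv + G dv²`. -/
def Compatible (j : Fin 6 → ℝ) (E F G : ℝ) : Prop :=
  E * j 0 - F * j 2 + G * j 4 = 0 ∧ E * j 1 - F * j 3 + G * j 5 = 0

/-- The Jacobian determinant of the coefficients of `du²` and `du dv`. -/
def jacNM (j : Fin 6 → ℝ) : ℝ := j 4 * j 3 - j 5 * j 2

/-- The source of the distinction between D₂ and D₃. Consider the determinant of the covector Q(w)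
and its derivative in the direction `rot w`, computed in the frame w, `rot w`. Once the coefficients
of dv² are eliminated by compatibility, it equals the Jacobian times the metric on w, up to positive
factors. At a zero of the cubic only one product of the determinant survives. -/
theorem cquad_mul_cpolar {j : Fin 6 → ℝ} {E F G : ℝ} (hE : E ≠ 0) (hj : Compatible j E F G)
    {w : Plane} (hw : cquad j w w = 0) :
    E * (cquad j (rot w) w * cpolar j w w (rot w)) =
      -(jacNM j * (E * w 0 ^ 2 + 2 * F * (w 0 * w 1) + G * w 1 ^ 2)
        * (w 0 ^ 2 + w 1 ^ 2) ^ 2) := by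
  obtain ⟨h0, h1⟩ := hj
  have h0' : j 0 = (F * j 2 - G * j 4) / E := by field_simp; linarith
  have h1' : j 1 = (F * j 3 - G * j 5) / E := by field_simp; linarith
  have key : E * (cquad j w w * cpolar j (rot w) w (rot w)
      - cquad j (rot w) w * cpolar j w w (rot w)) =
      jacNM j * (E * w 0 ^ 2 + 2 * F * (w 0 * w 1) + G * w 1 ^ 2) * (w 0 ^ 2 + w 1 ^ 2) ^ 2 := by
    simp only [cquad, cpolar, quad, polar, jacNM, h0', h1', rot_zero_apply, rot_one_apply]
    field_simp
    ring
  rw [hw] at key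
  linear_combination -key

theorem metric_pos {E F G : ℝ} (hE : 0 < E) (hΔ : 0 < E * G - F ^ 2) {w : Plane} (hw : w ≠ 0) :
    0 < E * w 0 ^ 2 + 2 * F * (w 0 * w 1) + G * w 1 ^ 2 := by
  have h1 : E * (E * w 0 ^ 2 + 2 * F * (w 0 * w 1) + G * w 1 ^ 2) =
      (E * w 0 + F * w 1) ^ 2 + (E * G - F ^ 2) * w 1 ^ 2 := by ring
  refine pos_of_mul_pos_right (a := E) ?_ hE.le
  rw [h1]
  by_cases h : w 1 = 0
  · have h0 : w 0 ≠ 0 := fun h0 => hw (by ext i; fin_cases i <;> simp [h, h0])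
    rw [h]; simp only [mul_zero, add_zero]; positivity
  · positivity

/-- Three different zeros of the cubic form, with the signs of a `D¹₂,₃` umbilic. -/
structure GoodDirs (j : Fin 6 → ℝ) (w₁ w₂ w₃ : Plane) : Prop where
  ne12 : wedge w₁ w₂ ≠ 0
  ne13 : wedge w₁ w₃ ≠ 0
  ne23 : wedge w₂ w₃ ≠ 0
  zero1 : cquad j w₁ w₁ = 0
  zero2 : cquad j w₂ w₂ = 0
  zero3 : cquad j w₃ w₃ = 0
  pos1 : 0 < ccubic j w₁ (rot w₁) * cpolar j w₁ w₁ (rot w₁)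
  pos2 : 0 < ccubic j w₂ (rot w₂) * cpolar j w₂ w₂ (rot w₂)
  pos3 : 0 < ccubic j w₃ (rot w₃) * cquad j (rot w₃) w₃

/-- A cubic with roots w₁, w₂ is, in the basis they form, the product of two linear forms and a
third. Two further independent roots make the third form vanish, so w₁ becomes a multiple root,
against `pos1`. -/
theorem GoodDirs.eq_of_zero {j : Fin 6 → ℝ} {w₁ w₂ w₃ : Plane} (h : GoodDirs j w₁ w₂ w₃)
    {w : Plane} (hw : cquad j w w = 0) : wedge w w₁ = 0 ∨ wedge w w₂ = 0 ∨ wedge w w₃ = 0 := by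
  by_contra hc
  push Not at hc
  obtain ⟨h1, h2, h3⟩ := hc
  have key : ∀ w : Plane, wedge w₁ w₂ ^ 3 * cquad j w w =
      wedge w w₂ ^ 3 * cquad j w₁ w₁ + wedge w₁ w ^ 3 * cquad j w₂ w₂ +
      wedge w w₂ * wedge w₁ w *
        (wedge w w₂ * ccubic j w₁ w₂ + wedge w₁ w * ccubic j w₂ w₁) := by
    intro w
    simp only [wedge, ccubic, cquad, cpolar, quad, polar]; ring
  have hanti : ∀ v w : Plane, wedge v w = -wedge w v := fun v w => by simp [wedge]; ring
  have k1 := key w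
  have k2 := key w₃
  rw [hw, h.zero1, h.zero2] at k1
  rw [h.zero3, h.zero1, h.zero2] at k2
  simp only [mul_zero, zero_add] at k1 k2
  have h1' : wedge w₁ w ≠ 0 := by rw [hanti]; exact neg_ne_zero.2 h1
  have h23 : wedge w₃ w₂ ≠ 0 := by rw [hanti]; exact neg_ne_zero.2 h.ne23
  have k1' := (mul_eq_zero.1 k1.symm).resolve_left (mul_ne_zero h2 h1')
  have k2' := (mul_eq_zero.1 k2.symm).resolve_left (mul_ne_zero h23 h.ne13)
  have hα : ccubic j w₁ w₂ = 0 := by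
    have h4 : ccubic j w₁ w₂ * (wedge w w₂ * wedge w₁ w₃ - wedge w₃ w₂ * wedge w₁ w) = 0 := by
      linear_combination wedge w₁ w₃ * k1' - wedge w₁ w * k2'
    have h5 : wedge w w₂ * wedge w₁ w₃ - wedge w₃ w₂ * wedge w₁ w = wedge w₁ w₂ * wedge w w₃ := by
      simp only [wedge]; ring
    rw [h5] at h4
    exact (mul_eq_zero.1 h4).resolve_right (mul_ne_zero h.ne12 h3)
  have h6 : (w₁ 0 ^ 2 + w₁ 1 ^ 2) * ccubic j w₁ w₂ =
      (w₁ 0 * w₂ 0 + w₁ 1 * w₂ 1) * (3 * cquad j w₁ w₁) + wedge w₁ w₂ * ccubic j w₁ (rot w₁) := by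
    simp [ccubic, cquad, cpolar, quad, polar, wedge]; ring
  rw [hα, h.zero1] at h6
  have h7 : ccubic j w₁ (rot w₁) = 0 :=
    (mul_eq_zero.1 (by linarith : wedge w₁ w₂ * ccubic j w₁ (rot w₁) = 0)).resolve_left h.ne12
  have := h.pos1
  rw [h7, zero_mul] at this
  exact lt_irrefl _ this

theorem GoodDirs.zeroSet {j : Fin 6 → ℝ} {w₁ w₂ w₃ : Plane} (h : GoodDirs j w₁ w₂ w₃) :
    {l | cquad j (dir l) (dir l) = 0} = {toLine w₁, toLine w₂, toLine w₃} := by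
  have hw1 := (ne_zero_of_wedge h.ne12).1
  have hw2 := (ne_zero_of_wedge h.ne12).2
  have hw3 := (ne_zero_of_wedge h.ne13).2
  have hz : ∀ w : Plane, w ≠ 0 → cquad j w w = 0 →
      cquad j (dir (toLine w)) (dir (toLine w)) = 0 := by
    intro w hw h0
    obtain ⟨ρ, -, h1⟩ := dir_toLine hw
    rw [h1]
    have : cquad j (ρ • w) (ρ • w) = ρ ^ 3 * cquad j w w := by simp [cquad, quad]; ring
    rw [this, h0, mul_zero]
  ext l
  simp only [mem_ofPred_eq, mem_insert_iff, mem_singleton_iff]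
  constructor
  · intro hl
    rcases h.eq_of_zero hl with h1 | h1 | h1
    · exact Or.inl (eq_toLine hw1 h1)
    · exact Or.inr (Or.inl (eq_toLine hw2 h1))
    · exact Or.inr (Or.inr (eq_toLine hw3 h1))
  · rintro (rfl | rfl | rfl)
    · exact hz _ hw1 h.zero1
    · exact hz _ hw2 h.zero2
    · exact hz _ hw3 h.zero3

/-! ### Forms whose coefficients are proportional covectors -/

/-- The coefficients obtained from the quadratic form `quad a b c` and the covector `ξ`. -/
def tensorJet (a b c : ℝ) (ξ : Plane) : Fin 6 → ℝ :=
  ![a * ξ 0, a * ξ 1, b * ξ 0, b * ξ 1, c * ξ 0, c * ξ 1]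

theorem cquad_tensorJet (a b c : ℝ) (ξ u w : Plane) :
    cquad (tensorJet a b c ξ) u w = quad a b c w * (u 0 * ξ 0 + u 1 * ξ 1) := by
  simp [cquad, tensorJet, quad]; ring

theorem cpolar_tensorJet (a b c : ℝ) (ξ u w d : Plane) :
    cpolar (tensorJet a b c ξ) u w d = polar a b c w d * (u 0 * ξ 0 + u 1 * ξ 1) := by
  simp [cpolar, tensorJet, polar]; ring

/-- A vanishing Jacobian makes dM and dN proportional, and compatibility then makes dL a multiple of
the same covector. That covector is dM, or dN if dM = 0. -/
theorem exists_tensorJet {j : Fin 6 → ℝ} {E F G : ℝ} (hE : 0 < E)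
    (hj : Compatible j E F G) (hJ : jacNM j = 0) (hne : j ≠ 0) :
    ∃ (a b c : ℝ) (ξ : Plane), ξ ≠ 0 ∧ j = tensorJet a b c ξ ∧ E * a - F * b + G * c = 0 := by
  obtain ⟨h0, h1⟩ := hj
  unfold jacNM at hJ
  have hj0 : j 0 = (F * j 2 - G * j 4) / E := by field_simp; linarith
  have hj1 : j 1 = (F * j 3 - G * j 5) / E := by field_simp; linarith
  by_cases hm : (!₂[j 2, j 3] : Plane) = 0
  · have h2 : j 2 = 0 := by simpa using congrArg (fun w : Plane => w 0) hm
    have h3 : j 3 = 0 := by simpa using congrArg (fun w : Plane => w 1) hm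
    refine ⟨-G / E, 0, 1, !₂[j 4, j 5], ?_, ?_, by field_simp; ring⟩
    · intro h4
      have h5 : j 4 = 0 := by simpa using congrArg (fun w : Plane => w 0) h4
      have h6 : j 5 = 0 := by simpa using congrArg (fun w : Plane => w 1) h4
      apply hne
      ext i
      fin_cases i <;> simp [hj0, hj1, h2, h3, h5, h6]
    · ext i
      fin_cases i <;> simp [tensorJet, hj0, hj1, h2, h3] <;> ring
  · have hp := normSq_pos hm
    simp only [Matrix.cons_val_zero, Matrix.cons_val_one] at hp
    -- The projection coefficient of dN on dM; parallelism makes the projection exact.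
    set c := (j 4 * j 2 + j 5 * j 3) / (j 2 ^ 2 + j 3 ^ 2) with hc
    have h4 : j 4 = c * j 2 := by
      rw [hc]; field_simp; linear_combination j 3 * hJ
    have h5 : j 5 = c * j 3 := by
      rw [hc]; field_simp; linear_combination -j 2 * hJ
    refine ⟨(F - G * c) / E, 1, c, !₂[j 2, j 3], hm, ?_, by field_simp; ring⟩
    ext i
    fin_cases i <;> simp [tensorJet, hj0, hj1] <;> 
      first | exact h4 | exact h5 | (rw [h4]; ring) | (rw [h5]; ring)

/-- Apolarity to the metric makes (b, c) coordinates on the space of forms, so proportional pairs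
come from proportional forms. -/
theorem quad_eq_zero_of_parallel {E F G a b c a' b' c' : ℝ} (hE : 0 < E)
    (h : E * a - F * b + G * c = 0) (h' : E * a' - F * b' + G * c' = 0)
    (hne : b ≠ 0 ∨ c ≠ 0) (hp : c * b' - b * c' = 0) {w : Plane} (hw : quad a b c w = 0) :
    quad a' b' c' w = 0 := by
  have h1 : E * (a * c' - c * a') = 0 := by linear_combination c' * h - c * h' - F * hp
  have h2 : E * (a * b' - b * a') = 0 := by linear_combination b' * h - b * h' - G * hp
  have h1' := (mul_eq_zero.1 h1).resolve_left hE.ne'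
  have h2' := (mul_eq_zero.1 h2).resolve_left hE.ne'
  unfold quad at *
  rcases hne with hb | hc
  · have h3 : b * (a' * w 1 ^ 2 + b' * (w 0 * w 1) + c' * w 0 ^ 2) = 0 := by
      linear_combination b' * hw - w 1 ^ 2 * h2' - w 0 ^ 2 * hp
    exact (mul_eq_zero.1 h3).resolve_left hb
  · have h3 : c * (a' * w 1 ^ 2 + b' * (w 0 * w 1) + c' * w 0 ^ 2) = 0 := by
      linear_combination c' * hw - w 1 ^ 2 * h1' + (w 0 * w 1) * hp
    exact (mul_eq_zero.1 h3).resolve_left hc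

/-- The roots of a nonzero form apolar to a definite metric are orthogonal for that metric, so one
root determines the form up to a scalar. In coordinates, a nonzero minor X would force both w₁(E w₀
+ F w₁) = 0 and E w₀² = G w₁², which definiteness excludes. -/
theorem parallel_of_quad_eq_zero {E F G a b c a' b' c' : ℝ} (hE : 0 < E)
    (hΔ : 0 < E * G - F ^ 2) (h : E * a - F * b + G * c = 0)
    (h' : E * a' - F * b' + G * c' = 0) {w : Plane} (hw0 : w ≠ 0) (hw : quad a b c w = 0)
    (hw' : quad a' b' c' w = 0) : c * b' - b * c' = 0 := by
  unfold quad at *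
  set X := c * b' - b * c' with hX
  have hy : E * (a * c' - c * a') = -F * X := by rw [hX]; linear_combination c' * h - c * h'
  have hz : E * (b * a' - a * b') = G * X := by rw [hX]; linear_combination -b' * h + b * h'
  have k1 : X * (w 0 * w 1) - (a * c' - c * a') * w 1 ^ 2 = 0 := by
    rw [hX]; linear_combination c * hw' - c' * hw
  have k2 : X * w 0 ^ 2 - (b * a' - a * b') * w 1 ^ 2 = 0 := by
    rw [hX]; linear_combination -b * hw' + b' * hw
  have k1' : X * (w 1 * (E * w 0 + F * w 1)) = 0 := by
    linear_combination E * k1 + w 1 ^ 2 * hy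
  have k2' : X * (E * w 0 ^ 2 - G * w 1 ^ 2) = 0 := by
    linear_combination E * k2 + w 1 ^ 2 * hz
  by_contra hne
  have k3 := (mul_eq_zero.1 k1').resolve_left hne
  have k4 := (mul_eq_zero.1 k2').resolve_left hne
  rcases mul_eq_zero.1 k3 with h1 | h1
  · rw [h1] at k4
    have h2 : E * w 0 ^ 2 = 0 := by linarith
    have h3 : w 0 = 0 := by simpa [hE.ne'] using h2
    exact hw0 (by ext i; fin_cases i <;> simp [h1, h3])
  · have h2 : (E * G - F ^ 2) * w 1 ^ 2 = 0 := by
      linear_combination (-E) * k4 + (E * w 0 - F * w 1) * h1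
    have h3 : w 1 = 0 := by simpa [hΔ.ne'] using h2
    rw [h3] at h1
    have h4 : w 0 = 0 := by simpa [hE.ne'] using h1
    exact hw0 (by ext i; fin_cases i <;> simp [h4, h3])

/-! ### Recognizing the three types of umbilic points -/

/-- The first derivatives of the coefficients of the torsion form. -/
def jet1 (f : Plane → Space) (x : Plane) : Fin 6 → ℝ :=
  ![fderiv ℝ (coefL f) x (EuclideanSpace.single 0 1), fderiv ℝ (coefL f) x (EuclideanSpace.single 1 1),
    fderiv ℝ (coefM f) x (EuclideanSpace.single 0 1), fderiv ℝ (coefM f) x (EuclideanSpace.single 1 1),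
    fderiv ℝ (coefN f) x (EuclideanSpace.single 0 1), fderiv ℝ (coefN f) x (EuclideanSpace.single 1 1)]

theorem dquad_eq (f : Plane → Space) (x u w : Plane) : dquad f x u w = cquad (jet1 f x) u w := by
  simp only [dquad, cquad, clm_plane_apply (fderiv ℝ _ x) u]
  simp [jet1]

theorem dpolar_eq (f : Plane → Space) (x u w d : Plane) :
    dpolar f x u w d = cpolar (jet1 f x) u w d := by
  simp only [dpolar, cpolar, clm_plane_apply (fderiv ℝ _ x) u]
  simp [jet1]

/-- At `x` the surface is immersed and umbilic, and its fundamental forms are of class `C²`. -/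
structure SmoothUmbilicAt (f : Plane → Space) (x : Plane) : Prop extends FlatAt f x where
  umbilic : LocUmbilic f x
  immersive : Immersive f x
  contFirst : ∀ i j, ContDiffAt ℝ 2 (fun y => firstForm f y i j) x

/-! ### Differentiating the apolarity relation at an umbilic point. -/

section Relation

variable {e g : Plane → ℝ} {x : Plane}

theorem fderiv_mul_of_zero (he : ContDiffAt ℝ 2 e x) (hg : ContDiffAt ℝ 2 g x) (h0 : g x = 0)
    (u : Plane) : fderiv ℝ (fun y => e y * g y) x u = e x * fderiv ℝ g x u := by
  rw [fderiv_fun_mul (he.differentiableAt (by simp)) (hg.differentiableAt (by simp))]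
  simp [h0]

/-- By the Leibniz rule the other terms contain g(x) or the derivative of g along k, so second
derivatives along a common kernel satisfy the same linear relation as the coefficients themselves.
-/
theorem fderiv_fderiv_mul_of_zero (he : ContDiffAt ℝ 2 e x) (hg : ContDiffAt ℝ 2 g x)
    (h0 : g x = 0) {k : Plane} (hk : fderiv ℝ g x k = 0) :
    fderiv ℝ (fderiv ℝ (fun y => e y * g y)) x k k = e x * fderiv ℝ (fderiv ℝ g) x k k := by
  have h1 : fderiv ℝ (fun y => e y * g y) =ᶠ[𝓝 x]
      fun y => e y • fderiv ℝ g y + g y • fderiv ℝ e y := by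
    filter_upwards [he.eventually_differentiableAt, hg.eventually_differentiableAt] with y hy hy'
    exact fderiv_fun_mul hy hy'
  have he1 := he.differentiableAt (n := 2) (by simp)
  have hg1 := hg.differentiableAt (n := 2) (by simp)
  rw [h1.fderiv_eq, fderiv_fun_add (he1.fun_smul hg.differentiableAt_fderiv)
    (hg1.fun_smul he.differentiableAt_fderiv), fderiv_fun_smul he1 hg.differentiableAt_fderiv,
    fderiv_fun_smul hg1 he.differentiableAt_fderiv]
  simp [h0, hk]

end Relation

section Criteria

variable {f : Plane → Space} {x : Plane}

theorem SmoothUmbilicAt.relation_fun (f : Plane → Space) :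
    (fun y => firstForm f y 0 0 * coefL f y) =
      fun y => firstForm f y 0 1 * coefM f y - firstForm f y 1 1 * coefN f y := by
  funext y
  linear_combination coef_relation f y

theorem SmoothUmbilicAt.fderiv_relation (h : SmoothUmbilicAt f x) (u : Plane) :
    firstForm f x 0 0 * fderiv ℝ (coefL f) x u - firstForm f x 0 1 * fderiv ℝ (coefM f) x u
      + firstForm f x 1 1 * fderiv ℝ (coefN f) x u = 0 := by
  have h1 := fderiv_mul_of_zero (h.contFirst 0 0) h.contL h.zeroL u
  have h2 := fderiv_mul_of_zero (h.contFirst 0 1) h.contM h.zeroM u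
  have h3 := fderiv_mul_of_zero (h.contFirst 1 1) h.contN h.zeroN u
  rw [SmoothUmbilicAt.relation_fun, fderiv_fun_sub
    (((h.contFirst 0 1).mul h.contM).differentiableAt (by simp))
    (((h.contFirst 1 1).mul h.contN).differentiableAt (by simp)), sub_apply, h2, h3] at h1
  linarith

theorem SmoothUmbilicAt.compatible (h : SmoothUmbilicAt f x) :
    Compatible (jet1 f x) (firstForm f x 0 0) (firstForm f x 0 1) (firstForm f x 1 1) := by
  constructor <;> simp only [jet1] <;> exact h.fderiv_relation _

theorem SmoothUmbilicAt.fderiv_fderiv_relation (h : SmoothUmbilicAt f x) {k : Plane}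
    (hL : fderiv ℝ (coefL f) x k = 0) (hM : fderiv ℝ (coefM f) x k = 0)
    (hN : fderiv ℝ (coefN f) x k = 0) :
    firstForm f x 0 0 * fderiv ℝ (fderiv ℝ (coefL f)) x k k
      - firstForm f x 0 1 * fderiv ℝ (fderiv ℝ (coefM f)) x k k
      + firstForm f x 1 1 * fderiv ℝ (fderiv ℝ (coefN f)) x k k = 0 := by
  have h1 := fderiv_fderiv_mul_of_zero (h.contFirst 0 0) h.contL h.zeroL hL
  have h2 := fderiv_fderiv_mul_of_zero (h.contFirst 0 1) h.contM h.zeroM hM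
  have h3 := fderiv_fderiv_mul_of_zero (h.contFirst 1 1) h.contN h.zeroN hN
  have c2 := (h.contFirst 0 1).mul h.contM
  have c3 := (h.contFirst 1 1).mul h.contN
  have h4 : fderiv ℝ (fun y => firstForm f y 0 1 * coefM f y - firstForm f y 1 1 * coefN f y)
      =ᶠ[𝓝 x] fun y => fderiv ℝ (fun y => firstForm f y 0 1 * coefM f y) y
        - fderiv ℝ (fun y => firstForm f y 1 1 * coefN f y) y := by
    filter_upwards [c2.eventually_differentiableAt, c3.eventually_differentiableAt] with y hy hy'
    exact fderiv_fun_sub hy hy'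
  rw [SmoothUmbilicAt.relation_fun, h4.fderiv_eq, fderiv_fun_sub c2.differentiableAt_fderiv
    c3.differentiableAt_fderiv, sub_apply, sub_apply] at h1
  linarith

/-- At a nonregular fibre point the whole covector Q(w) vanishes, and `cquad_mul_cpolar` would give
J = 0. -/
theorem SmoothUmbilicAt.conditionT (h : SmoothUmbilicAt f x) (hJ : jacNM (jet1 f x) ≠ 0) :
    ConditionT f x := by
  intro l
  rw [h.regularAt_iff]
  by_contra hc
  push Not at hc
  simp only [dquad_eq] at hc
  obtain ⟨hE, hΔ⟩ := gram_pos h.immersive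
  have h1 := cquad_mul_cpolar hE.ne' h.compatible (hc (dir l))
  rw [hc, zero_mul, mul_zero] at h1
  have h2 := metric_pos hE hΔ (dir_ne_zero l)
  have h3 := normSq_pos (dir_ne_zero l)
  have h4 : jacNM (jet1 f x) * (firstForm f x 0 0 * dir l 0 ^ 2 + 2 * firstForm f x 0 1 *
    (dir l 0 * dir l 1) + firstForm f x 1 1 * dir l 1 ^ 2) *
      (dir l 0 ^ 2 + dir l 1 ^ 2) ^ 2 = 0 := by linarith
  have := mul_ne_zero (mul_ne_zero hJ h2.ne') (pow_ne_zero 2 h3.ne')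
  exact this h4

theorem SmoothUmbilicAt.singularSet (h : SmoothUmbilicAt f x) {w₁ w₂ w₃ : Plane}
    (hw : GoodDirs (jet1 f x) w₁ w₂ w₃) :
    {l | SingularAt f x l} = {toLine w₁, toLine w₂, toLine w₃} := by
  rw [← hw.zeroSet]
  ext l
  simp only [mem_ofPred_eq, h.singularAt_iff, dquad_eq]

theorem SmoothUmbilicAt.saddleAt_toLine (h : SmoothUmbilicAt f x) {w : Plane} (hw : w ≠ 0)
    (h0 : cquad (jet1 f x) w w = 0) (hr : cquad (jet1 f x) (rot w) w ≠ 0)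
    (hp : 0 < ccubic (jet1 f x) w (rot w) * cpolar (jet1 f x) w w (rot w)) :
    SaddleAt f x (toLine w) := by
  obtain ⟨ρ, μ, hρ, hμ, hdir, hs⟩ := exists_scale hw
  obtain ⟨h1, h2⟩ := hs _ h0
  refine h.toFlatAt.saddleAt _ ?_ ?_ ?_ <;> simp only [dquad_eq, dpolar_eq]
  · have : cquad (jet1 f x) (ρ • w) (ρ • w) = ρ ^ 3 * cquad (jet1 f x) w w := by
      simp [cquad, quad]; ring
    rw [hdir, this, h0, mul_zero]
  · rw [h1]; exact mul_ne_zero hμ hr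
  · rw [h1, h2]
    have : (μ * cquad (jet1 f x) (rot w) w + μ * cpolar (jet1 f x) w w (rot w)) *
        (μ * cpolar (jet1 f x) w w (rot w)) =
        μ ^ 2 * (ccubic (jet1 f x) w (rot w) * cpolar (jet1 f x) w w (rot w)) := by
      rw [ccubic]; ring
    rw [this]
    positivity

theorem SmoothUmbilicAt.nodeAt_toLine (h : SmoothUmbilicAt f x) {w : Plane} (hw : w ≠ 0)
    (h0 : cquad (jet1 f x) w w = 0) (hr : cquad (jet1 f x) (rot w) w ≠ 0)
    (hp : ccubic (jet1 f x) w (rot w) * cpolar (jet1 f x) w w (rot w) < 0) :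
    NodeAt f x (toLine w) := by
  obtain ⟨ρ, μ, hρ, hμ, hdir, hs⟩ := exists_scale hw
  obtain ⟨h1, h2⟩ := hs _ h0
  refine h.toFlatAt.nodeAt _ ?_ ?_ ?_ <;> simp only [dquad_eq, dpolar_eq]
  · have : cquad (jet1 f x) (ρ • w) (ρ • w) = ρ ^ 3 * cquad (jet1 f x) w w := by
      simp [cquad, quad]; ring
    rw [hdir, this, h0, mul_zero]
  · rw [h1]; exact mul_ne_zero hμ hr
  · rw [h1, h2]
    have : (μ * cquad (jet1 f x) (rot w) w + μ * cpolar (jet1 f x) w w (rot w)) *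
        (μ * cpolar (jet1 f x) w w (rot w)) =
        μ ^ 2 * (ccubic (jet1 f x) w (rot w) * cpolar (jet1 f x) w w (rot w)) := by
      rw [ccubic]; ring
    rw [this]
    exact mul_neg_of_pos_of_neg (by positivity) hp

theorem SmoothUmbilicAt.exists_mul (h : SmoothUmbilicAt f x) {w : Plane} (hw : w ≠ 0)
    (h0 : cquad (jet1 f x) w w = 0) : ∃ κ : ℝ, 0 < κ ∧
      cquad (jet1 f x) (rot w) w * cpolar (jet1 f x) w w (rot w) = -(κ * jacNM (jet1 f x)) := by
  obtain ⟨hE, hΔ⟩ := gram_pos h.immersive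
  have h1 := cquad_mul_cpolar hE.ne' h.compatible h0
  have h2 := metric_pos hE hΔ hw
  have h3 := normSq_pos hw
  refine ⟨(firstForm f x 0 0 * w 0 ^ 2 + 2 * firstForm f x 0 1 * (w 0 * w 1)
    + firstForm f x 1 1 * w 1 ^ 2) * (w 0 ^ 2 + w 1 ^ 2) ^ 2 / firstForm f x 0 0,
    by positivity, ?_⟩
  field_simp
  linear_combination h1

/-- With A and P as in `cquad_mul_cpolar`, J > 0 gives A P < 0 at every root. At w₁, w₂ the
condition (A + P) P > 0 already means a saddle. At w₃ the sum A + P has the sign of A, so (A + P) P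
< 0 and the eigenvalues -(A + P), P have equal signs. -/
theorem SmoothUmbilicAt.locD2 (h : SmoothUmbilicAt f x) {w₁ w₂ w₃ : Plane}
    (hw : GoodDirs (jet1 f x) w₁ w₂ w₃) (hJ : 0 < jacNM (jet1 f x)) : LocD2 f x := by
  have hw1 := (ne_zero_of_wedge hw.ne12).1
  have hw2 := (ne_zero_of_wedge hw.ne12).2
  have hw3 := (ne_zero_of_wedge hw.ne13).2
  have hreg : ∀ w : Plane, w ≠ 0 → cquad (jet1 f x) w w = 0 →
      cquad (jet1 f x) (rot w) w * cpolar (jet1 f x) w w (rot w) < 0 := by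
    intro w hw h0
    obtain ⟨κ, hκ, h1⟩ := h.exists_mul hw h0
    rw [h1]
    exact neg_neg_of_pos (mul_pos hκ hJ)
  refine ⟨h.umbilic, h.conditionT hJ.ne', toLine w₃, toLine w₁, toLine w₂,
    (toLine_ne hw.ne13).symm, (toLine_ne hw.ne23).symm, toLine_ne hw.ne12, ?_,
    h.nodeAt_toLine hw3 hw.zero3 (left_ne_zero_of_mul (hreg _ hw3 hw.zero3).ne) ?_,
    h.saddleAt_toLine hw1 hw.zero1 (left_ne_zero_of_mul (hreg _ hw1 hw.zero1).ne) hw.pos1,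
    h.saddleAt_toLine hw2 hw.zero2 (left_ne_zero_of_mul (hreg _ hw2 hw.zero2).ne) hw.pos2⟩
  · rw [h.singularSet hw]
    ext l; simp only [mem_insert_iff, mem_singleton_iff]; tauto
  · have h1 := hreg _ hw3 hw.zero3
    have h2 := hw.pos3
    rcases mul_pos_iff.1 h2 with ⟨h3, h4⟩ | ⟨h3, h4⟩
    · exact mul_neg_of_pos_of_neg h3 ((pos_iff_neg_of_mul_neg h1).1 h4)
    · exact mul_neg_of_neg_of_pos h3 ((neg_iff_pos_of_mul_neg h1).1 h4)

/-- Here J < 0 gives A P > 0, so A, P and A + P share one sign at w₃ and the third singularity is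
also a saddle. -/
theorem SmoothUmbilicAt.locD3 (h : SmoothUmbilicAt f x) {w₁ w₂ w₃ : Plane}
    (hw : GoodDirs (jet1 f x) w₁ w₂ w₃) (hJ : jacNM (jet1 f x) < 0) : LocD3 f x := by
  have hw1 := (ne_zero_of_wedge hw.ne12).1
  have hw2 := (ne_zero_of_wedge hw.ne12).2
  have hw3 := (ne_zero_of_wedge hw.ne13).2
  have hreg : ∀ w : Plane, w ≠ 0 → cquad (jet1 f x) w w = 0 →
      0 < cquad (jet1 f x) (rot w) w * cpolar (jet1 f x) w w (rot w) := by
    intro w hw h0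
    obtain ⟨κ, hκ, h1⟩ := h.exists_mul hw h0
    rw [h1]
    exact neg_pos.2 (mul_neg_of_pos_of_neg hκ hJ)
  refine ⟨h.umbilic, h.conditionT hJ.ne, toLine w₁, toLine w₂, toLine w₃,
    toLine_ne hw.ne12, toLine_ne hw.ne13, toLine_ne hw.ne23, h.singularSet hw,
    h.saddleAt_toLine hw1 hw.zero1 (left_ne_zero_of_mul (hreg _ hw1 hw.zero1).ne') hw.pos1,
    h.saddleAt_toLine hw2 hw.zero2 (left_ne_zero_of_mul (hreg _ hw2 hw.zero2).ne') hw.pos2,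
    h.saddleAt_toLine hw3 hw.zero3 (left_ne_zero_of_mul (hreg _ hw3 hw.zero3).ne') ?_⟩
  have h1 := hreg _ hw3 hw.zero3
  rcases mul_pos_iff.1 hw.pos3 with ⟨h3, h4⟩ | ⟨h3, h4⟩
  · exact mul_pos h3 ((pos_iff_pos_of_mul_pos h1).1 h4)
  · exact mul_pos_of_neg_of_neg h3 ((neg_iff_neg_of_mul_pos h1).1 h4)

theorem fderiv_of_jet1 {a b c : ℝ} {ξ : Plane} (hj : jet1 f x = tensorJet a b c ξ) (u : Plane) :
    fderiv ℝ (coefL f) x u = a * (u 0 * ξ 0 + u 1 * ξ 1) ∧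
    fderiv ℝ (coefM f) x u = b * (u 0 * ξ 0 + u 1 * ξ 1) ∧
    fderiv ℝ (coefN f) x u = c * (u 0 * ξ 0 + u 1 * ξ 1) := by
  have h := fun i => congrFun hj i
  have h0 := h 0
  have h1 := h 1
  have h2 := h 2
  have h3 := h 3
  have h4 := h 4
  have h5 := h 5
  simp only [jet1, tensorJet, Matrix.cons_val] at h0 h1 h2 h3 h4 h5
  refine ⟨?_, ?_, ?_⟩ <;> rw [clm_plane_apply] <;> simp only [h0, h1, h2, h3, h4, h5, smul_eq_mul]
    <;> ring

theorem ddquad_smul_add_right (f : Plane → Space) (x v u u' w : Plane) (s t : ℝ) :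
    ddquad f x v (s • u + t • u') w = s * ddquad f x v u w + t * ddquad f x v u' w := by
  simp only [ddquad, quad, map_add, map_smul, smul_eq_mul]; ring

theorem ddquad_smul_left (f : Plane → Space) (x v u w : Plane) (s : ℝ) :
    ddquad f x (s • v) u w = s * ddquad f x v u w := by
  simp only [ddquad, quad, map_smul, smul_apply, smul_eq_mul]; ring

theorem eq_smul_rot {ξ v : Plane} (hξ : ξ ≠ 0) :
    v = ((-(v 0 * ξ 1) + v 1 * ξ 0) / (ξ 0 ^ 2 + ξ 1 ^ 2)) • rot ξ +
      ((v 0 * ξ 0 + v 1 * ξ 1) / (ξ 0 ^ 2 + ξ 1 ^ 2)) • ξ := by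
  have := (normSq_pos hξ).ne'
  ext i
  fin_cases i <;> simp <;> field_simp <;> ring

/-- In the frame `rot ξ`, ξ, fibre, the fibre direction pairs only with ξ, by a nonzero factor. The
determinant of the Hessian is therefore a nonzero multiple of the entry at (`rot ξ`, `rot ξ`). -/
theorem FlatAt.hessianNondegenerateAt_iff (h : FlatAt f x) {a b c : ℝ} {ξ : Plane} (hξ : ξ ≠ 0)
    (hj : jet1 f x = tensorJet a b c ξ) {l : OnePoint ℝ}
    (hp : polar a b c (dir l) (dirVel l) ≠ 0) :
    HessianNondegenerateAt f x l ↔ ddquad f x (rot ξ) (rot ξ) (dir l) ≠ 0 := by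
  have hn := (normSq_pos hξ).ne'
  have hH : ∀ v σ u τ, fderiv ℝ (fderiv ℝ (liftFun f l)) (x, affineCoord l) (v, σ) (u, τ) =
      ddquad f x v u (dir l) + σ * (polar a b c (dir l) (dirVel l) * (u 0 * ξ 0 + u 1 * ξ 1))
        + τ * (polar a b c (dir l) (dirVel l) * (v 0 * ξ 0 + v 1 * ξ 1)) := by
    intro v σ u τ
    rw [h.fderiv_fderiv_liftFun, dpolar_eq, dpolar_eq, hj, cpolar_tensorJet, cpolar_tensorJet]
  constructor
  · intro hnd h0
    -- The fibre component that makes `(rot ξ, σ)` pair to zero with ξ too; when the distinguished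
    -- entry is 0 this vector lies in the kernel.
    set σ := -(ddquad f x (rot ξ) ξ (dir l)) /
      (polar a b c (dir l) (dirVel l) * (ξ 0 ^ 2 + ξ 1 ^ 2)) with hσ
    have h1 := hnd (rot ξ, σ) (fun ⟨u, τ⟩ => by
      rw [hH]
      have hu := eq_smul_rot (v := u) hξ
      have h2 : ddquad f x (rot ξ) u (dir l) =
          ((u 0 * ξ 0 + u 1 * ξ 1) / (ξ 0 ^ 2 + ξ 1 ^ 2)) * ddquad f x (rot ξ) ξ (dir l) := by
        conv_lhs => rw [hu]
        rw [ddquad_smul_add_right, h0, mul_zero, zero_add]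
      rw [h2, hσ]
      simp only [rot_zero_apply, rot_one_apply]
      field_simp
      ring)
    have h2 := congrArg Prod.fst h1
    have h3 := congrArg (fun w : Plane => w 0) h2
    have h4 := congrArg (fun w : Plane => w 1) h2
    simp at h3 h4
    exact hξ (by ext i; fin_cases i <;> simp [h3, h4])
  · rintro hk ⟨v, σ⟩ hv
    have h1 := hv (0, 1)
    rw [hH] at h1
    have h2 : v 0 * ξ 0 + v 1 * ξ 1 = 0 := by
      simpa [ddquad, quad, hp] using h1
    have hv' := eq_smul_rot (v := v) hξ
    rw [h2, zero_div, zero_smul, add_zero] at hv'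
    set t := (-(v 0 * ξ 1) + v 1 * ξ 0) / (ξ 0 ^ 2 + ξ 1 ^ 2) with ht
    have h3 := hv (rot ξ, 0)
    rw [hH, hv', ddquad_smul_left] at h3
    have h4 : t * ddquad f x (rot ξ) (rot ξ) (dir l) = 0 := by
      have h5 : rot ξ 0 * ξ 0 + rot ξ 1 * ξ 1 = 0 := by simp; ring
      rw [h5] at h3
      simpa using h3
    have h5 := (mul_eq_zero.1 h4).resolve_right hk
    rw [h5, zero_smul] at hv'
    have h6 := hv (ξ, 0)
    rw [hH, hv'] at h6
    have h7 : σ * (polar a b c (dir l) (dirVel l) * (ξ 0 ^ 2 + ξ 1 ^ 2)) = 0 := by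
      simpa [ddquad, quad, pow_two] using h6
    rw [hv', (mul_eq_zero.1 h7).resolve_right (mul_ne_zero hp hn)]
    rfl

end Criteria

/-! ### Simple roots of binary quadratic forms, and the fold condition. -/

theorem quad_eq_wedge (a b c : ℝ) (w₁ w₂ w : Plane) : wedge w₁ w₂ ^ 2 * quad a b c w =
    wedge w w₂ ^ 2 * quad a b c w₁ + wedge w₁ w ^ 2 * quad a b c w₂ +
      wedge w w₂ * wedge w₁ w * polar a b c w₁ w₂ := by
  simp only [wedge, quad, polar]; ring

theorem normSq_mul_polar (a b c : ℝ) (w d : Plane) : (w 0 ^ 2 + w 1 ^ 2) * polar a b c w d =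
    (w 0 * d 0 + w 1 * d 1) * (2 * quad a b c w) + wedge w d * polar a b c w (rot w) := by
  simp [wedge, quad, polar]; ring

/-- A nonzero binary quadratic form with two different roots has no double root. -/
theorem polar_rot_ne_zero {a b c : ℝ} {w₁ w₂ w₃ : Plane} (h₁ : quad a b c w₁ = 0)
    (h₂ : quad a b c w₂ = 0) (h₃ : quad a b c w₃ ≠ 0) (hne : wedge w₁ w₂ ≠ 0) :
    polar a b c w₁ (rot w₁) ≠ 0 := by
  intro h0
  have h4 := normSq_mul_polar a b c w₁ w₂
  rw [h₁, h0, mul_zero, mul_zero, mul_zero, add_zero] at h4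
  have h5 := (mul_eq_zero.1 h4).resolve_left (normSq_pos (ne_zero_of_wedge hne).1).ne'
  have h6 := quad_eq_wedge a b c w₁ w₂ w₃
  rw [h₁, h₂, h5] at h6
  simp only [mul_zero, add_zero] at h6
  exact h₃ ((mul_eq_zero.1 h6).resolve_left (pow_ne_zero 2 hne))

theorem polar_ne_zero {a b c : ℝ} {w d : Plane} (hw : quad a b c w = 0)
    (hr : polar a b c w (rot w) ≠ 0) (hd : wedge w d ≠ 0) : polar a b c w d ≠ 0 := by
  intro h0
  have h4 := normSq_mul_polar a b c w d
  rw [hw, h0, mul_zero, mul_zero, mul_zero, zero_add] at h4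
  exact mul_ne_zero hd hr h4.symm

theorem wedge_eq_zero_of_annihilated {ξ v w : Plane} (hξ : ξ ≠ 0) (hv : v 0 * ξ 0 + v 1 * ξ 1 = 0)
    (hw : w 0 * ξ 0 + w 1 * ξ 1 = 0) : wedge v w = 0 := by
  have h : (ξ 0 ^ 2 + ξ 1 ^ 2) * wedge v w = 0 := by
    simp only [wedge]
    linear_combination (ξ 0 * w 1 - ξ 1 * w 0) * hv + (ξ 1 * v 0 - ξ 0 * v 1) * hw
  exact (mul_eq_zero.1 h).resolve_left (normSq_pos hξ).ne'

/-- A number that, at an umbilic point where the differentials of `coefM` and `coefN` are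
proportional, vanishes if the umbilic is not a fold. -/
def foldNumber (f : Plane → Space) (x : Plane) (a b : ℝ) : ℝ :=
  let j := jet1 f x
  let η : Plane := !₂[a * j 4 + b * j 2, a * j 5 + b * j 3]
  (j 4 * η 0 + j 5 * η 1) * fderiv ℝ (fderiv ℝ (coefM f)) x (rot η) (rot η) -
    (j 2 * η 0 + j 3 * η 1) * fderiv ℝ (fderiv ℝ (coefN f)) x (rot η) (rot η)

section

variable {f : Plane → Space} {x : Plane}

/-- For a rank-one jet the vector η in `foldNumber` is (s c + t b) ξ; one power of this factor comes
from the pairing with η and two from `rot η`. The definition uses only the jets and never a choice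
of ξ, so it is continuous in the immersion and its nonvanishing is an open condition. -/
theorem foldNumber_eq {a b c s t : ℝ} {ξ : Plane} (hj : jet1 f x = tensorJet a b c ξ) :
    foldNumber f x s t = (s * c + t * b) ^ 3 * (ξ 0 ^ 2 + ξ 1 ^ 2) *
      (c * fderiv ℝ (fderiv ℝ (coefM f)) x (rot ξ) (rot ξ)
        - b * fderiv ℝ (fderiv ℝ (coefN f)) x (rot ξ) (rot ξ)) := by
  have hη : (!₂[s * (c * ξ 0) + t * (b * ξ 0), s * (c * ξ 1) + t * (b * ξ 1)] : Plane) =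
      (s * c + t * b) • ξ := by
    ext i; fin_cases i <;> simp <;> ring
  have hrot : ∀ r : ℝ, rot (r • ξ) = r • rot ξ := fun r => by
    ext i; fin_cases i <;> simp
  simp only [foldNumber, hj, tensorJet, Matrix.cons_val]
  rw [hη, hrot]
  simp only [map_smul, smul_apply, smul_eq_mul]
  ring

theorem SmoothUmbilicAt.fderiv_fderiv_rot (h : SmoothUmbilicAt f x) {a b c : ℝ} {ξ : Plane}
    (hj : jet1 f x = tensorJet a b c ξ) :
    firstForm f x 0 0 * fderiv ℝ (fderiv ℝ (coefL f)) x (rot ξ) (rot ξ)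
      - firstForm f x 0 1 * fderiv ℝ (fderiv ℝ (coefM f)) x (rot ξ) (rot ξ)
      + firstForm f x 1 1 * fderiv ℝ (fderiv ℝ (coefN f)) x (rot ξ) (rot ξ) = 0 := by
  obtain ⟨h1, h2, h3⟩ := fderiv_of_jet1 hj (rot ξ)
  have h4 : rot ξ 0 * ξ 0 + rot ξ 1 * ξ 1 = 0 := by simp; ring
  rw [h4, mul_zero] at h1 h2 h3
  exact h.fderiv_fderiv_relation h1 h2 h3

/-- For Q = q ⊗ ξ, a root of the cubic with P ≠ 0 has ξ(w) ≠ 0 and is thus a root of q, and one with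
A ≠ 0 is no root of q and so lies in ker ξ. If the Hessian degenerated at a root of q, the second
derivative along ker ξ would be an apolar form sharing a root with q, hence proportional to q,
against the fold number. -/
theorem SmoothUmbilicAt.locD123 (h : SmoothUmbilicAt f x) {w₁ w₂ w₃ : Plane}
    (hw : GoodDirs (jet1 f x) w₁ w₂ w₃) (hJ : jacNM (jet1 f x) = 0) {s t : ℝ}
    (hΦ : foldNumber f x s t ≠ 0) : LocD123 f x := by
  have hw1 := (ne_zero_of_wedge hw.ne12).1
  have hw2 := (ne_zero_of_wedge hw.ne12).2
  have hw3 := (ne_zero_of_wedge hw.ne13).2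
  obtain ⟨hE, hΔ⟩ := gram_pos h.immersive
  have hne : jet1 f x ≠ 0 := by
    intro h0
    have := hw.pos3
    rw [h0] at this
    simp [ccubic, cquad, cpolar, quad, polar] at this
  obtain ⟨a, b, c, ξ, hξ, hj, habc⟩ := exists_tensorJet hE h.compatible hJ hne
  have hn := normSq_pos hξ
  rw [foldNumber_eq hj] at hΦ
  have hfold := right_ne_zero_of_mul hΦ
  have hsing := hw.zeroSet
  rw [hj] at hw hsing
  have hreg : ∀ l, RegularAt f x l ↔ quad a b c (dir l) ≠ 0 := by
    intro l
    rw [h.regularAt_iff]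
    simp only [dquad_eq, hj, cquad_tensorJet]
    constructor
    · rintro ⟨u, hu⟩; exact left_ne_zero_of_mul hu
    · intro hq; exact ⟨ξ, mul_ne_zero hq (by nlinarith)⟩
  have hquad : ∀ (ρ : ℝ) (w : Plane), quad a b c (ρ • w) = ρ ^ 2 * quad a b c w := fun ρ w => by
    simp [quad]; ring
  have hq3 : quad a b c w₃ ≠ 0 := by
    have := right_ne_zero_of_mul hw.pos3.ne'
    rw [cquad_tensorJet] at this
    exact left_ne_zero_of_mul this
  have hroot : ∀ w : Plane, w ≠ 0 → cquad (tensorJet a b c ξ) w w = 0 →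
      0 < ccubic (tensorJet a b c ξ) w (rot w) * cpolar (tensorJet a b c ξ) w w (rot w) →
      ¬RegularAt f x (toLine w) ∧ HessianNondegenerateAt f x (toLine w) := by
    intro w hw0 hz hp
    have h1 := right_ne_zero_of_mul hp.ne'
    obtain ⟨ρ, μ, hρ, hμ, hdir, hs⟩ := exists_scale hw0
    obtain ⟨-, h2⟩ := hs _ hz
    have h3 : cpolar (tensorJet a b c ξ) (dir (toLine w)) (dir (toLine w)) (dirVel (toLine w)) ≠ 0 := by
      rw [h2]; exact mul_ne_zero hμ h1
    rw [cpolar_tensorJet] at h1 h3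
    rw [cquad_tensorJet] at hz
    have hqw := (mul_eq_zero.1 hz).resolve_right (right_ne_zero_of_mul h1)
    have hqd : quad a b c (dir (toLine w)) = 0 := by rw [hdir, hquad, hqw, mul_zero]
    refine ⟨by rw [hreg]; exact not_not.2 hqd, ?_⟩
    rw [h.hessianNondegenerateAt_iff hξ hj (left_ne_zero_of_mul h3)]
    intro h0
    exact hfold (parallel_of_quad_eq_zero hE hΔ habc (h.fderiv_fderiv_rot hj) (dir_ne_zero _)
      hqd h0)
  obtain ⟨hn1, hh1⟩ := hroot w₁ hw1 hw.zero1 hw.pos1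
  obtain ⟨hn2, hh2⟩ := hroot w₂ hw2 hw.zero2 hw.pos2
  have hr3 : RegularAt f x (toLine w₃) := by
    obtain ⟨ρ, hρ, h3⟩ := dir_toLine hw3
    rw [hreg, h3, hquad]
    exact mul_ne_zero (pow_ne_zero 2 hρ) hq3
  refine ⟨h.umbilic, ⟨toLine w₁, toLine w₂, toLine_ne hw.ne12, ?_, hh1, hh2⟩, toLine w₃, ?_, hr3⟩
  · ext l
    simp only [mem_ofPred_eq, mem_insert_iff, mem_singleton_iff]
    constructor
    · intro hl
      have h1 : l ∈ {l | cquad (tensorJet a b c ξ) (dir l) (dir l) = 0} := by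
        rw [hreg, not_not] at hl
        simp [cquad_tensorJet, hl]
      rw [hsing] at h1
      rcases h1 with h1 | h1 | h1
      · exact Or.inl h1
      · exact Or.inr h1
      · exact absurd (h1 ▸ hr3) hl
    · rintro (rfl | rfl)
      · exact hn1
      · exact hn2
  · rw [h.singularAt_iff, dquad_eq, hj]
    have : toLine w₃ ∈ {l | cquad (tensorJet a b c ξ) (dir l) (dir l) = 0} := by
      rw [hsing]; simp
    exact this

/-- A nonregular point forces J = 0, hence Q = q ⊗ ξ. The regular singularity is no root of q, so it
spans ker ξ and shows q ≠ 0; the two nonregular points are then simple roots of q off ker ξ. The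
Hessian at one of them yields the fold condition. -/
theorem SmoothUmbilicAt.exists_of_locD123 (h : SmoothUmbilicAt f x) (hD : LocD123 f x) :
    ∃ (w₁ w₂ w₃ : Plane) (a b c : ℝ) (ξ : Plane), GoodDirs (jet1 f x) w₁ w₂ w₃ ∧ ξ ≠ 0 ∧
      jet1 f x = tensorJet a b c ξ ∧
      c * fderiv ℝ (fderiv ℝ (coefM f)) x (rot ξ) (rot ξ)
        - b * fderiv ℝ (fderiv ℝ (coefN f)) x (rot ξ) (rot ξ) ≠ 0 := by
  obtain ⟨-, ⟨l₁, l₂, hl12, hset, hh1, -⟩, l₀, hs0, hr0⟩ := hD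
  obtain ⟨hE, hΔ⟩ := gram_pos h.immersive
  have hn1 : ¬RegularAt f x l₁ := by
    have : l₁ ∈ {l | ¬RegularAt f x l} := by rw [hset]; simp
    exact this
  have hn2 : ¬RegularAt f x l₂ := by
    have : l₂ ∈ {l | ¬RegularAt f x l} := by rw [hset]; simp
    exact this
  have hn1' := hn1
  rw [h.regularAt_iff] at hn1 hn2 hr0
  push Not at hn1 hn2
  rw [h.singularAt_iff] at hs0
  simp only [dquad_eq] at hn1 hn2 hr0 hs0
  have hne : jet1 f x ≠ 0 := by
    rintro h0
    obtain ⟨u, hu⟩ := hr0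
    rw [h0] at hu
    simp [cquad, quad] at hu
  have hJ : jacNM (jet1 f x) = 0 := by
    obtain ⟨κ, hκ, h1⟩ := h.exists_mul (dir_ne_zero l₁) (hn1 _)
    rw [hn1, zero_mul] at h1
    exact (mul_eq_zero.1 (neg_eq_zero.1 h1.symm)).resolve_left hκ.ne'
  obtain ⟨a, b, c, ξ, hξ, hj, habc⟩ := exists_tensorJet hE h.compatible hJ hne
  have hn := normSq_pos hξ
  simp only [hj, cquad_tensorJet] at hn1 hn2 hr0 hs0
  have hξξ : ξ 0 * ξ 0 + ξ 1 * ξ 1 ≠ 0 := by nlinarith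
  have hq1 := (mul_eq_zero.1 (hn1 ξ)).resolve_right hξξ
  have hq2 := (mul_eq_zero.1 (hn2 ξ)).resolve_right hξξ
  obtain ⟨u, hu⟩ := hr0
  have hq0 := left_ne_zero_of_mul hu
  have hξ0 := (mul_eq_zero.1 hs0).resolve_left hq0
  have h12 : wedge (dir l₁) (dir l₂) ≠ 0 := fun h0 => hl12 (eq_of_wedge_dir h0)
  have h10 : wedge (dir l₁) (dir l₀) ≠ 0 := fun h0 => hq0 (eq_of_wedge_dir h0 ▸ hq1)
  have h20 : wedge (dir l₂) (dir l₀) ≠ 0 := fun h0 => hq0 (eq_of_wedge_dir h0 ▸ hq2)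
  have h21 : wedge (dir l₂) (dir l₁) ≠ 0 := fun h0 => hl12 (eq_of_wedge_dir h0).symm
  have hp1 := polar_rot_ne_zero hq1 hq2 hq0 h12
  have hp2 := polar_rot_ne_zero hq2 hq1 hq0 h21
  have hξ1 : dir l₁ 0 * ξ 0 + dir l₁ 1 * ξ 1 ≠ 0 := fun h0 =>
    h10 (wedge_eq_zero_of_annihilated hξ h0 hξ0)
  have hξ2 : dir l₂ 0 * ξ 0 + dir l₂ 1 * ξ 1 ≠ 0 := fun h0 =>
    h20 (wedge_eq_zero_of_annihilated hξ h0 hξ0)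
  have hξr : rot (dir l₀) 0 * ξ 0 + rot (dir l₀) 1 * ξ 1 ≠ 0 := by
    intro h0
    have h1 := wedge_eq_zero_of_annihilated hξ hξ0 h0
    have h2 := normSq_pos (dir_ne_zero l₀)
    simp only [wedge, rot_zero_apply, rot_one_apply] at h1
    nlinarith
  refine ⟨dir l₁, dir l₂, dir l₀, a, b, c, ξ, ⟨h12, h10, h20, ?_, ?_, ?_, ?_, ?_, ?_⟩, hξ, hj, ?_⟩
  · rw [hj, cquad_tensorJet, hq1, zero_mul]
  · rw [hj, cquad_tensorJet, hq2, zero_mul]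
  · rw [hj, cquad_tensorJet, hξ0, mul_zero]
  · rw [ccubic, hj, cquad_tensorJet, cpolar_tensorJet, hq1, zero_mul, zero_add]
    exact mul_self_pos.2 (mul_ne_zero hp1 hξ1)
  · rw [ccubic, hj, cquad_tensorJet, cpolar_tensorJet, hq2, zero_mul, zero_add]
    exact mul_self_pos.2 (mul_ne_zero hp2 hξ2)
  · rw [ccubic, hj, cquad_tensorJet, cpolar_tensorJet, hξ0, mul_zero, add_zero]
    exact mul_self_pos.2 (mul_ne_zero hq0 hξr)
  · have hd : wedge (dir l₁) (dirVel l₁) ≠ 0 := by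
      intro h0
      have := wedge_dir_sq l₁
      rw [h0] at this; simp at this
    rw [h.hessianNondegenerateAt_iff hξ hj (polar_ne_zero hq1 hp1 hd)] at hh1
    have hbc : b ≠ 0 ∨ c ≠ 0 := by
      by_contra hc
      push Not at hc
      obtain ⟨hb, hc⟩ := hc
      rw [hb, hc] at habc hq0
      have ha : a = 0 := by simpa [hE.ne'] using habc
      rw [ha] at hq0
      exact hq0 (quad_zero _)
    intro h0
    exact hh1 (quad_eq_zero_of_parallel hE habc (h.fderiv_fderiv_rot hj) hbc h0 hq1)

end

/-! ### Persistence of the zeros of the cubic form -/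

theorem continuous_cquad : Continuous fun q : (Fin 6 → ℝ) × Plane × Plane =>
    cquad q.1 q.2.1 q.2.2 := by
  unfold cquad quad; fun_prop

theorem continuous_cpolar : Continuous fun q : (Fin 6 → ℝ) × Plane × Plane × Plane =>
    cpolar q.1 q.2.1 q.2.2.1 q.2.2.2 := by
  unfold cpolar polar; fun_prop

theorem continuous_rot : Continuous rot := by
  unfold rot
  refine (PiLp.continuous_toLp 2 _).comp (continuous_pi fun i => ?_)
  fin_cases i <;> simp <;> fun_prop

/-- At a simple root the cubic changes sign along the line through w₀ in the direction `rot w₀`, and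
strict signs at two fixed points survive a perturbation of the coefficients. -/
theorem eventually_exists_zero_of_pos {j₀ : Fin 6 → ℝ} {w₀ : Plane} (h0 : cquad j₀ w₀ w₀ = 0)
    (hd : 0 < ccubic j₀ w₀ (rot w₀)) {N : Set Plane} (hN : N ∈ 𝓝 w₀) :
    ∀ᶠ j in 𝓝 j₀, ∃ w ∈ N, cquad j w w = 0 := by
  set line : ℝ → Plane := fun s => w₀ + s • rot w₀ with hline
  have hlc : Continuous line := by fun_prop
  have hl0 : line 0 = w₀ := by simp [hline]
  have hg : ∀ j : Fin 6 → ℝ, Continuous fun s => cquad j (line s) (line s) := fun j =>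
    continuous_cquad.comp (continuous_const.prodMk (hlc.prodMk hlc))
  have hg' : ∀ s : ℝ, Continuous fun j => cquad j (line s) (line s) := fun s =>
    continuous_cquad.comp (continuous_id.prodMk (continuous_const (y := (line s, line s))))
  -- The cubic on the line divided by s; its value at 0 is the derivative of the cubic, which is
  -- positive.
  set h : ℝ → ℝ := fun s => ccubic j₀ w₀ (rot w₀) + s * (cquad j₀ w₀ (rot w₀)
    + cpolar j₀ (rot w₀) w₀ (rot w₀)) + s ^ 2 * cquad j₀ (rot w₀) (rot w₀) with hh
  have hexp : ∀ s, cquad j₀ (line s) (line s) = s * h s := by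
    intro s
    have : cquad j₀ (line s) (line s) = cquad j₀ w₀ w₀ + s * h s := by
      simp [hh, hline, ccubic, cquad, cpolar, quad, polar]; ring
    rw [this, h0, zero_add]
  have hhc : Continuous h := by fun_prop
  have h1 : ∀ᶠ s in 𝓝 (0 : ℝ), 0 < h s ∧ line s ∈ N := by
    refine (hhc.continuousAt.eventually (lt_mem_nhds (by simpa [hh] using hd))).and ?_
    exact hlc.continuousAt.eventually (by rw [hl0]; exact hN)
  obtain ⟨ε, hε, hball⟩ := Metric.eventually_nhds_iff.1 h1
  have hs : ∀ s, |s| < ε → 0 < h s ∧ line s ∈ N := fun s hs => hball (by simpa using hs)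
  have hε2 : |ε / 2| < ε := by rw [abs_of_pos (by positivity)]; linarith
  have hε2' : |-(ε / 2)| < ε := by rw [abs_neg]; exact hε2
  have hp : 0 < cquad j₀ (line (ε / 2)) (line (ε / 2)) := by
    rw [hexp]; exact mul_pos (by positivity) (hs _ hε2).1
  have hm : cquad j₀ (line (-(ε / 2))) (line (-(ε / 2))) < 0 := by
    rw [hexp]; exact mul_neg_of_neg_of_pos (by linarith) (hs _ hε2').1
  filter_upwards [(hg' _).continuousAt.eventually (lt_mem_nhds hp),
    (hg' _).continuousAt.eventually (gt_mem_nhds hm)] with j hj1 hj2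
  obtain ⟨s, hs1, hs2⟩ := intermediate_value_Ioo (by linarith : -(ε / 2) ≤ ε / 2)
    (hg j).continuousOn ⟨hj2, hj1⟩
  exact ⟨line s, (hs s (abs_lt.2 ⟨by linarith [hs1.1], by linarith [hs1.2]⟩)).2, hs2⟩

theorem eventually_exists_zero {j₀ : Fin 6 → ℝ} {w₀ : Plane} (h0 : cquad j₀ w₀ w₀ = 0)
    (hd : ccubic j₀ w₀ (rot w₀) ≠ 0) {N : Set Plane} (hN : N ∈ 𝓝 w₀) :
    ∀ᶠ j in 𝓝 j₀, ∃ w ∈ N, cquad j w w = 0 := by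
  rcases hd.lt_or_gt with h | h
  · have hneg : ∀ (j : Fin 6 → ℝ) (u w : Plane), cquad (-j) u w = -cquad j u w := fun j u w => by
      simp [cquad, quad]; ring
    have hneg' : ccubic (-j₀) w₀ (rot w₀) = -ccubic j₀ w₀ (rot w₀) := by
      simp [ccubic, cquad, cpolar, quad, polar]; ring
    have h1 := eventually_exists_zero_of_pos (j₀ := -j₀) (by rw [hneg, h0, neg_zero])
      (by rw [hneg']; linarith) hN
    have h2 := (continuous_neg (G := Fin 6 → ℝ)).continuousAt (x := j₀) |>.eventually h1
    filter_upwards [h2] with j ⟨w, hw, hj⟩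
    exact ⟨w, hw, by rw [hneg] at hj; linarith⟩
  · exact eventually_exists_zero_of_pos h0 h hN

/-- Neighbourhoods of the three roots on which the strict conditions hold are fixed beforehand; the
roots are then found inside them, with no need to depend continuously on the coefficients. -/
theorem GoodDirs.eventually {j₀ : Fin 6 → ℝ} {w₁ w₂ w₃ : Plane} (h : GoodDirs j₀ w₁ w₂ w₃) :
    ∀ᶠ j in 𝓝 j₀, ∃ v₁ v₂ v₃, GoodDirs j v₁ v₂ v₃ := by
  have hwc : Continuous fun q : Plane × Plane => wedge q.1 q.2 := by unfold wedge; fun_prop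
  have hcq : Continuous fun q : (Fin 6 → ℝ) × Plane => cquad q.1 (rot q.2) q.2 :=
    continuous_cquad.comp (continuous_fst.prodMk
      ((continuous_rot.comp continuous_snd).prodMk continuous_snd))
  have hcp : Continuous fun q : (Fin 6 → ℝ) × Plane => cpolar q.1 q.2 q.2 (rot q.2) :=
    continuous_cpolar.comp (continuous_fst.prodMk (continuous_snd.prodMk
      (continuous_snd.prodMk (continuous_rot.comp continuous_snd))))
  have hcc : Continuous fun q : (Fin 6 → ℝ) × Plane => ccubic q.1 q.2 (rot q.2) := hcq.add hcp
  have e12 := (hwc.continuousAt (x := (w₁, w₂))).eventually_ne h.ne12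
  have e13 := (hwc.continuousAt (x := (w₁, w₃))).eventually_ne h.ne13
  have e23 := (hwc.continuousAt (x := (w₂, w₃))).eventually_ne h.ne23
  have p1 := ((hcc.mul hcp).continuousAt (x := (j₀, w₁))).eventually (lt_mem_nhds h.pos1)
  have p2 := ((hcc.mul hcp).continuousAt (x := (j₀, w₂))).eventually (lt_mem_nhds h.pos2)
  have p3 := ((hcc.mul hcq).continuousAt (x := (j₀, w₃))).eventually (lt_mem_nhds h.pos3)
  obtain ⟨A12, hA12, B12, hB12, s12⟩ := mem_nhds_prod_iff.1 e12
  obtain ⟨A13, hA13, B13, hB13, s13⟩ := mem_nhds_prod_iff.1 e13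
  obtain ⟨A23, hA23, B23, hB23, s23⟩ := mem_nhds_prod_iff.1 e23
  obtain ⟨J1, hJ1, N1, hN1, t1⟩ := mem_nhds_prod_iff.1 p1
  obtain ⟨J2, hJ2, N2, hN2, t2⟩ := mem_nhds_prod_iff.1 p2
  obtain ⟨J3, hJ3, N3, hN3, t3⟩ := mem_nhds_prod_iff.1 p3
  filter_upwards [hJ1, hJ2, hJ3,
    eventually_exists_zero h.zero1 (left_ne_zero_of_mul h.pos1.ne')
      (inter_mem (inter_mem hA12 hA13) hN1),
    eventually_exists_zero h.zero2 (left_ne_zero_of_mul h.pos2.ne')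
      (inter_mem (inter_mem hB12 hA23) hN2),
    eventually_exists_zero h.zero3 (left_ne_zero_of_mul h.pos3.ne')
      (inter_mem (inter_mem hB13 hB23) hN3)] with j hj1 hj2 hj3 ⟨v₁, hv1, z1⟩ ⟨v₂, hv2, z2⟩
      ⟨v₃, hv3, z3⟩
  exact ⟨v₁, v₂, v₃, s12 (mk_mem_prod hv1.1.1 hv2.1.1), s13 (mk_mem_prod hv1.1.2 hv3.1.1),
    s23 (mk_mem_prod hv2.1.2 hv3.1.2), z1, z2, z3, t1 (mk_mem_prod hj1 hv1.2),
    t2 (mk_mem_prod hj2 hv2.2), t3 (mk_mem_prod hj3 hv3.2)⟩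

/-! ### Umbilic points do not depend on the chart -/

theorem partialD_partialD {f : Plane → Space} {x : Plane} (hf : ContDiffAt ℝ 2 f x) (i j : Fin 2) :
    partialD i (partialD j f) x =
      fderiv ℝ (fderiv ℝ f) x (EuclideanSpace.single i 1) (EuclideanSpace.single j 1) := by
  change fderiv ℝ (fun y => fderiv ℝ f y (EuclideanSpace.single j 1)) x _ = _
  rw [fderiv_clm_apply hf.differentiableAt_fderiv (differentiableAt_const _)]
  simp

/-- Proportionality of the fundamental forms, written with the unnormalised normal: a change of
coordinates multiplies this normal by the Jacobian determinant, which κ can absorb whatever its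
sign. -/
theorem locUmbilic_iff_exists {f : Plane → Space} {x : Plane} (hf : ContDiffAt ℝ 2 f x)
    (him : Immersive f x) : LocUmbilic f x ↔ ∃ κ : ℝ, ∀ v w,
      inner ℝ (vecProd (partialD 0 f x) (partialD 1 f x)) (fderiv ℝ (fderiv ℝ f) x v w)
        = κ * inner ℝ (fderiv ℝ f x v) (fderiv ℝ f x w) := by
  rw [locUmbilic_iff hf him]
  obtain ⟨hE, hΔ⟩ := gram_pos him
  have hs := secondForm_symm hf
  have hf1 := firstForm_symm f x
  set n := vecProd (partialD 0 f x) (partialD 1 f x) with hn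
  have hn0 : ‖n‖ ≠ 0 := norm_ne_zero_iff.2 him
  have hII : ∀ i j, inner ℝ n (fderiv ℝ (fderiv ℝ f) x (EuclideanSpace.single i 1)
      (EuclideanSpace.single j 1)) = ‖n‖ * secondForm f x i j := by
    intro i j
    simp only [secondForm, Matrix.of_apply, unitNormal, ← hn, partialD_partialD hf,
      real_inner_smul_left]
    field_simp
  constructor
  · rintro ⟨h1, h2⟩
    have h3 := coefL_eq_zero him h1 h2
    unfold coefM at h1
    unfold coefN at h2
    set κ := secondForm f x 0 0 / firstForm f x 0 0 with hκ
    have k00 : secondForm f x 0 0 = κ * firstForm f x 0 0 := by rw [hκ]; field_simp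
    have k01 : secondForm f x 0 1 = κ * firstForm f x 0 1 := by
      rw [hκ]; field_simp; linarith
    have k11 : secondForm f x 1 1 = κ * firstForm f x 1 1 := by
      rw [hκ]; field_simp; linarith
    refine ⟨‖n‖ * κ, fun v w => ?_⟩
    have hfv := fun v => clm_plane_apply (fderiv ℝ f x) v
    rw [clm_plane_apply (fderiv ℝ (fderiv ℝ f) x) v, hfv v, hfv w]
    simp only [add_apply, smul_apply]
    simp only [clm_plane_apply (fderiv ℝ (fderiv ℝ f) x _) w, inner_add_right, inner_add_left,
      real_inner_smul_left, real_inner_smul_right, hII, hs, k00, k01, k11, smul_add]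
    have e00 : inner ℝ (fderiv ℝ f x (EuclideanSpace.single 0 1))
      (fderiv ℝ f x (EuclideanSpace.single 0 1)) = firstForm f x 0 0 := rfl
    have e01 : inner ℝ (fderiv ℝ f x (EuclideanSpace.single 0 1))
      (fderiv ℝ f x (EuclideanSpace.single 1 1)) = firstForm f x 0 1 := rfl
    have e10 : inner ℝ (fderiv ℝ f x (EuclideanSpace.single 1 1))
      (fderiv ℝ f x (EuclideanSpace.single 0 1)) = firstForm f x 0 1 := hf1
    have e11 : inner ℝ (fderiv ℝ f x (EuclideanSpace.single 1 1))
      (fderiv ℝ f x (EuclideanSpace.single 1 1)) = firstForm f x 1 1 := rfl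
    rw [e00, e01, e10, e11]
    ring
  · rintro ⟨κ, hκ⟩
    have h4 : ∀ i j, secondForm f x i j = κ / ‖n‖ * firstForm f x i j := by
      intro i j
      have h5 := hκ (EuclideanSpace.single i 1) (EuclideanSpace.single j 1)
      rw [hII] at h5
      have h6 : inner ℝ (fderiv ℝ f x (EuclideanSpace.single i 1))
        (fderiv ℝ f x (EuclideanSpace.single j 1)) = firstForm f x i j := rfl
      rw [h6] at h5
      field_simp
      linarith
    unfold coefM coefN
    constructor <;> rw [h4, h4] <;> ring

theorem fderiv_fderiv_comp {E F G : Type*} [NormedAddCommGroup E] [NormedSpace ℝ E]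
    [NormedAddCommGroup F] [NormedSpace ℝ F] [NormedAddCommGroup G] [NormedSpace ℝ G]
    {f : F → G} {θ : E → F} {y : E} (hf : ContDiffAt ℝ 2 f (θ y)) (hθ : ContDiffAt ℝ 2 θ y)
    (v w : E) : fderiv ℝ (fderiv ℝ (f ∘ θ)) y v w =
      fderiv ℝ (fderiv ℝ f) (θ y) (fderiv ℝ θ y v) (fderiv ℝ θ y w) +
        fderiv ℝ f (θ y) (fderiv ℝ (fderiv ℝ θ) y v w) := by
  have hθd := hθ.differentiableAt (n := 2) (by simp)
  have hev : fderiv ℝ (f ∘ θ) =ᶠ[𝓝 y] fun z => (fderiv ℝ f (θ z)).comp (fderiv ℝ θ z) := by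
    filter_upwards [hθd.continuousAt.eventually hf.eventually_differentiableAt,
      hθ.eventually_differentiableAt] with z hz hz'
    exact fderiv_comp z hz hz'
  have h3 := (hf.differentiableAt_fderiv.hasFDerivAt.comp y hθd.hasFDerivAt).clm_comp
    hθ.differentiableAt_fderiv.hasFDerivAt
  rw [(h3.congr_of_eventuallyEq hev).fderiv]
  simp only [add_apply, ContinuousLinearMap.comp_apply, ContinuousLinearMap.compL_apply,
    ContinuousLinearMap.flip_apply]
  exact add_comm _ _

/-- The second derivative of θ enters only through a tangential vector, which the normal
annihilates. -/
theorem LocUmbilic.comp {f : Plane → Space} {θ : Plane → Plane} {y : Plane}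
    (hf : ContDiffAt ℝ 2 f (θ y)) (hθ : ContDiffAt ℝ 2 θ y) (him : Immersive f (θ y))
    (him' : Immersive (f ∘ θ) y) (h : LocUmbilic f (θ y)) : LocUmbilic (f ∘ θ) y := by
  obtain ⟨κ, hκ⟩ := (locUmbilic_iff_exists hf him).1 h
  refine (locUmbilic_iff_exists (hf.comp y hθ) him').2 ?_
  have hfd := hf.differentiableAt (n := 2) (by simp)
  have hθd := hθ.differentiableAt (n := 2) (by simp)
  have h1 : fderiv ℝ (f ∘ θ) y = (fderiv ℝ f (θ y)).comp (fderiv ℝ θ y) := fderiv_comp y hfd hθd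
  have h2 := fderiv_fderiv_comp hf hθ
  set a := partialD 0 f (θ y) with ha
  set b := partialD 1 f (θ y) with hb
  have hpd : ∀ i, partialD i (f ∘ θ) y = fderiv ℝ θ y (EuclideanSpace.single i 1) 0 • a +
      fderiv ℝ θ y (EuclideanSpace.single i 1) 1 • b := by
    intro i
    rw [partialD, h1, ContinuousLinearMap.comp_apply, clm_plane_apply (fderiv ℝ f (θ y))]
    rfl
  have hperp : ∀ v, inner ℝ (vecProd a b) (fderiv ℝ f (θ y) v) = (0 : ℝ) := by
    intro v
    rw [clm_plane_apply, inner_add_right, real_inner_smul_right, real_inner_smul_right]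
    have ha' : fderiv ℝ f (θ y) (EuclideanSpace.single 0 1) = a := rfl
    have hb' : fderiv ℝ f (θ y) (EuclideanSpace.single 1 1) = b := rfl
    rw [ha', hb', inner_vecProd_left, inner_vecProd_right]
    ring
  rw [hpd, hpd, vecProd_linear_comb]
  set δ := fderiv ℝ θ y (EuclideanSpace.single 0 1) 0 * fderiv ℝ θ y (EuclideanSpace.single 1 1) 1 -
    fderiv ℝ θ y (EuclideanSpace.single 0 1) 1 * fderiv ℝ θ y (EuclideanSpace.single 1 1) 0
  refine ⟨δ * κ, fun v w => ?_⟩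
  · rw [h2, real_inner_smul_left, inner_add_right, hperp, add_zero, hκ, h1]
    simp only [ContinuousLinearMap.comp_apply]
    rw [mul_assoc]

section Chart

variable {M : Type*} [TopologicalSpace M] [ChartedSpace Plane M] [IsManifold (𝓡 2) ∞ M] {r : ℕ}

/-- `umbilicSet` asks for some chart, whereas counting umbilic points requires testing all of them
in one fixed chart. -/
theorem mem_umbilicSet_iff (hr : 2 ≤ r) {β : CrMap M r} (hβ : β ∈ immersions M r)
    {φ : OpenPartialHomeomorph M Plane} (hφ : φ ∈ IsManifold.maximalAtlas (𝓡 2) ∞ M) {q : M}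
    (hq : q ∈ φ.source) : q ∈ umbilicSet β ↔ LocUmbilic (β ∘ φ.symm) (φ q) := by
  refine ⟨fun ⟨ψ, hψ, hqψ, h⟩ => ?_, fun h => ⟨φ, hφ, hq, h⟩⟩
  have himm : ∀ {χ : OpenPartialHomeomorph M Plane}, χ ∈ IsManifold.maximalAtlas (𝓡 2) ∞ M →
      q ∈ χ.source → Immersive (β ∘ χ.symm) (χ q) := fun hχ hqχ =>
    injective_fderiv_iff_immersive.1 ((injective_mfderiv_iff (by omega) β hχ hqχ).1 (hβ q))
  have hcd : ContDiffAt ℝ 2 (β ∘ ψ.symm) (ψ q) :=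
    ((contDiffOn_comp_symm β hψ).contDiffAt (ψ.open_target.mem_nhds (ψ.map_source hqψ))).of_le
      (by exact_mod_cast hr)
  have hmem : φ q ∈ φ.target ∩ φ.symm ⁻¹' ψ.source :=
    ⟨φ.map_source hq, by rwa [mem_preimage, φ.left_inv hq]⟩
  have hθ : ContDiffAt ℝ 2 (ψ ∘ φ.symm) (φ q) :=
    ((contDiffOn_transition hφ hψ).contDiffAt (isOpen_transition_source.mem_nhds hmem)).of_le
      (WithTop.coe_le_coe.2 (le_top : (2 : ℕ∞) ≤ ⊤))
  have hval : (ψ ∘ φ.symm) (φ q) = ψ q := by simp [φ.left_inv hq]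
  have hev : (β ∘ ψ.symm) ∘ (ψ ∘ φ.symm) =ᶠ[𝓝 (φ q)] β ∘ φ.symm := by
    filter_upwards [isOpen_transition_source.mem_nhds hmem] with z hz
    simp only [Function.comp]
    rw [ψ.left_inv hz.2]
  have hpd : ∀ i, partialD i ((β ∘ ψ.symm) ∘ (ψ ∘ φ.symm)) =ᶠ[𝓝 (φ q)]
      partialD i (β ∘ φ.symm) := fun i => by
    filter_upwards [Filter.EventuallyEq.fderiv (𝕜 := ℝ) hev] with z hz
    simp only [partialD, hz]
  have hpd2 : ∀ i j, partialD i (partialD j ((β ∘ ψ.symm) ∘ (ψ ∘ φ.symm))) (φ q) =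
      partialD i (partialD j (β ∘ φ.symm)) (φ q) := fun i j => by
    rw [partialD, (hpd j).fderiv_eq]; rfl
  have hI : firstForm ((β ∘ ψ.symm) ∘ (ψ ∘ φ.symm)) (φ q) = firstForm (β ∘ φ.symm) (φ q) := by
    ext i j
    simp only [firstForm, Matrix.of_apply, (hpd _).self_of_nhds]
  have hII : secondForm ((β ∘ ψ.symm) ∘ (ψ ∘ φ.symm)) (φ q) = secondForm (β ∘ φ.symm) (φ q) := by
    ext i j
    simp only [secondForm, unitNormal, Matrix.of_apply, (hpd _).self_of_nhds, hpd2]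
  have him := himm hφ hq
  have key := LocUmbilic.comp (f := β ∘ ψ.symm) (θ := ψ ∘ φ.symm) (y := φ q)
    (by rw [hval]; exact hcd) hθ (by rw [hval]; exact himm hψ hqψ)
    (by unfold Immersive; rw [(hpd 0).self_of_nhds, (hpd 1).self_of_nhds]; exact him)
    (by rw [hval]; exact h)
  unfold LocUmbilic meanCurv gaussCurv shapeMatrix at key ⊢
  rwa [hI, hII] at key

end Chart

/-! ### Smooth dependence of the torsion form on the immersion -/

section Slice

variable {X E F : Type*} [NormedAddCommGroup X] [NormedSpace ℝ X] [NormedAddCommGroup E]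
  [NormedSpace ℝ E] [NormedAddCommGroup F] [NormedSpace ℝ F]

theorem hasFDerivAt_slice {g : X → E → F} {β : X} {x : E}
    (h : DifferentiableAt ℝ (fun q : X × E => g q.1 q.2) (β, x)) :
    HasFDerivAt (g β) ((fderiv ℝ (fun q : X × E => g q.1 q.2) (β, x)).comp
      (ContinuousLinearMap.inr ℝ X E)) x :=
  h.hasFDerivAt.comp x (hasFDerivAt_prodMk_right β x)

theorem contDiffOn_fderiv_slice {g : X → E → F} {Ω : Set (X × E)} (hΩ : IsOpen Ω) {n : ℕ}
    (h : ContDiffOn ℝ ((n + 1 : ℕ) : WithTop ℕ∞) (fun q : X × E => g q.1 q.2) Ω) :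
    ContDiffOn ℝ (n : WithTop ℕ∞) (fun q : X × E => fderiv ℝ (g q.1) q.2) Ω := by
  have h1 : ContDiffOn ℝ (n : WithTop ℕ∞) (fderiv ℝ fun q : X × E => g q.1 q.2) Ω :=
    h.fderiv_of_isOpen hΩ (by norm_cast)
  refine (h1.clm_comp (contDiffOn_const (c := ContinuousLinearMap.inr ℝ X E))).congr
    fun q hq => (hasFDerivAt_slice ?_).fderiv
  exact (h.contDiffAt (hΩ.mem_nhds hq)).differentiableAt (by simp)

theorem contDiffAt_slice {g : X → E → F} {Ω : Set (X × E)} (hΩ : IsOpen Ω) {n : WithTop ℕ∞}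
    (h : ContDiffOn ℝ n (fun q : X × E => g q.1 q.2) Ω) {β : X} {x : E} (hq : (β, x) ∈ Ω) :
    ContDiffAt ℝ n (g β) x :=
  ContDiffAt.comp x (f := fun y => (β, y)) (h.contDiffAt (hΩ.mem_nhds hq))
    (contDiffAt_const.prodMk contDiffAt_id)

end Slice

section Family

variable {X : Type*} [NormedAddCommGroup X] [NormedSpace ℝ X] {g : X → Plane → Space}
  {Ω : Set (X × Plane)} {n : ℕ}

theorem contDiffOn_partialD (hΩ : IsOpen Ω)
    (h : ContDiffOn ℝ ((n + 1 : ℕ) : WithTop ℕ∞) (fun q : X × Plane => g q.1 q.2) Ω) (i : Fin 2) :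
    ContDiffOn ℝ (n : WithTop ℕ∞) (fun q : X × Plane => partialD i (g q.1) q.2) Ω :=
  (contDiffOn_fderiv_slice hΩ h).clm_apply contDiffOn_const

theorem contDiff_vecProd {k : WithTop ℕ∞} :
    ContDiff ℝ k fun q : Space × Space => vecProd q.1 q.2 := by
  have h1 : ∀ i : Fin 3, ContDiff ℝ k fun q : Space × Space => q.1 i := fun i =>
    (contDiff_euclidean.1 contDiff_id i).comp contDiff_fst
  have h2 : ∀ i : Fin 3, ContDiff ℝ k fun q : Space × Space => q.2 i := fun i =>
    (contDiff_euclidean.1 contDiff_id i).comp contDiff_snd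
  refine contDiff_euclidean.2 fun i => ?_
  fin_cases i <;> simp only [vecProd, cross_apply] <;>
    exact ((h1 _).mul (h2 _)).sub ((h1 _).mul (h2 _))

theorem isOpen_immersive (hΩ : IsOpen Ω)
    (h : ContDiffOn ℝ ((n + 1 : ℕ) : WithTop ℕ∞) (fun q : X × Plane => g q.1 q.2) Ω) :
    IsOpen (Ω ∩ {q | Immersive (g q.1) q.2}) := by
  have h1 : ContinuousOn (fun q : X × Plane => vecProd (partialD 0 (g q.1) q.2)
      (partialD 1 (g q.1) q.2)) Ω :=
    (contDiff_vecProd (k := 0)).continuous.comp_continuousOn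
      ((contDiffOn_partialD hΩ h 0).continuousOn.prodMk
        (contDiffOn_partialD hΩ h 1).continuousOn)
  exact h1.isOpen_inter_preimage hΩ isOpen_ne

theorem contDiffOn_firstForm (hΩ : IsOpen Ω)
    (h : ContDiffOn ℝ ((n + 1 : ℕ) : WithTop ℕ∞) (fun q : X × Plane => g q.1 q.2) Ω)
    (i j : Fin 2) :
    ContDiffOn ℝ (n : WithTop ℕ∞) (fun q : X × Plane => firstForm (g q.1) q.2 i j) Ω :=
  (contDiffOn_partialD hΩ h i).inner ℝ (contDiffOn_partialD hΩ h j)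

theorem contDiffOn_secondForm (hΩ : IsOpen Ω)
    (h : ContDiffOn ℝ ((n + 2 : ℕ) : WithTop ℕ∞) (fun q : X × Plane => g q.1 q.2) Ω)
    (him : ∀ q ∈ Ω, Immersive (g q.1) q.2) (i j : Fin 2) :
    ContDiffOn ℝ (n : WithTop ℕ∞) (fun q : X × Plane => secondForm (g q.1) q.2 i j) Ω := by
  have h1 : ContDiffOn ℝ ((n + 1 : ℕ) : WithTop ℕ∞) (fun q : X × Plane =>
      vecProd (partialD 0 (g q.1) q.2) (partialD 1 (g q.1) q.2)) Ω :=
    contDiff_vecProd.comp_contDiffOn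
      ((contDiffOn_partialD hΩ h 0).prodMk (contDiffOn_partialD hΩ h 1))
  have h2 : ContDiffOn ℝ ((n + 1 : ℕ) : WithTop ℕ∞) (fun q : X × Plane =>
      unitNormal (g q.1) q.2) Ω :=
    ((h1.norm ℝ him).inv fun q hq => norm_ne_zero_iff.2 (him q hq)).smul h1
  exact (h2.of_le (by norm_cast; omega)).inner ℝ
    (contDiffOn_partialD hΩ (g := fun β => partialD j (g β)) (contDiffOn_partialD hΩ h j) i)

theorem contDiffOn_coef (hΩ : IsOpen Ω)
    (h : ContDiffOn ℝ ((n + 2 : ℕ) : WithTop ℕ∞) (fun q : X × Plane => g q.1 q.2) Ω)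
    (him : ∀ q ∈ Ω, Immersive (g q.1) q.2) :
    ContDiffOn ℝ (n : WithTop ℕ∞) (fun q : X × Plane => coefL (g q.1) q.2) Ω ∧
    ContDiffOn ℝ (n : WithTop ℕ∞) (fun q : X × Plane => coefM (g q.1) q.2) Ω ∧
    ContDiffOn ℝ (n : WithTop ℕ∞) (fun q : X × Plane => coefN (g q.1) q.2) Ω := by
  have hI := fun i j => (contDiffOn_firstForm hΩ h i j).of_le
    (by norm_cast; omega : ((n : ℕ) : WithTop ℕ∞) ≤ ((n + 1 : ℕ) : WithTop ℕ∞))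
  have hII := contDiffOn_secondForm hΩ h him
  exact ⟨((hI 0 1).mul (hII 1 1)).sub ((hI 1 1).mul (hII 0 1)),
    ((hI 0 0).mul (hII 1 1)).sub ((hI 1 1).mul (hII 0 0)),
    ((hI 0 0).mul (hII 0 1)).sub ((hI 0 1).mul (hII 0 0))⟩

theorem continuousOn_jet1 (hΩ : IsOpen Ω)
    (h : ContDiffOn ℝ ((n + 3 : ℕ) : WithTop ℕ∞) (fun q : X × Plane => g q.1 q.2) Ω)
    (him : ∀ q ∈ Ω, Immersive (g q.1) q.2) :
    ContinuousOn (fun q : X × Plane => jet1 (g q.1) q.2) Ω := by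
  obtain ⟨hL, hM, hN⟩ := contDiffOn_coef (n := n + 1) hΩ h him
  have hd : ∀ {e : X → Plane → ℝ} (v : Plane), ContDiffOn ℝ ((n + 1 : ℕ) : WithTop ℕ∞)
      (fun q : X × Plane => e q.1 q.2) Ω →
      ContinuousOn (fun q : X × Plane => fderiv ℝ (e q.1) q.2 v) Ω := fun v he =>
    ((contDiffOn_fderiv_slice hΩ he).clm_apply contDiffOn_const).continuousOn
  refine continuousOn_pi.2 fun i => ?_
  fin_cases i
  · exact hd (e := fun β => coefL (g β)) _ hL
  · exact hd (e := fun β => coefL (g β)) _ hL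
  · exact hd (e := fun β => coefM (g β)) _ hM
  · exact hd (e := fun β => coefM (g β)) _ hM
  · exact hd (e := fun β => coefN (g β)) _ hN
  · exact hd (e := fun β => coefN (g β)) _ hN

theorem continuousOn_foldNumber (hΩ : IsOpen Ω)
    (h : ContDiffOn ℝ ((n + 4 : ℕ) : WithTop ℕ∞) (fun q : X × Plane => g q.1 q.2) Ω)
    (him : ∀ q ∈ Ω, Immersive (g q.1) q.2) (a b : ℝ) :
    ContinuousOn (fun q : X × Plane => foldNumber (g q.1) q.2 a b) Ω := by
  obtain ⟨-, hM, hN⟩ := contDiffOn_coef (n := n + 2) hΩ h him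
  have hj := fun i => continuousOn_pi.1 (continuousOn_jet1 (n := n + 1) hΩ h him) i
  have hη : ContinuousOn (fun q : X × Plane =>
      (!₂[a * jet1 (g q.1) q.2 4 + b * jet1 (g q.1) q.2 2,
        a * jet1 (g q.1) q.2 5 + b * jet1 (g q.1) q.2 3] : Plane)) Ω := by
    refine (PiLp.continuous_toLp 2 _).comp_continuousOn (continuousOn_pi.2 fun i => ?_)
    fin_cases i
    · exact ((hj 4).const_mul a).add ((hj 2).const_mul b)
    · exact ((hj 5).const_mul a).add ((hj 3).const_mul b)
  have hr := continuous_rot.comp_continuousOn hη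
  have hd : ∀ {e : X → Plane → ℝ} {v : X × Plane → Plane}, ContinuousOn v Ω →
      ContDiffOn ℝ ((n + 2 : ℕ) : WithTop ℕ∞) (fun q : X × Plane => e q.1 q.2) Ω →
      ContinuousOn (fun q : X × Plane => fderiv ℝ (fderiv ℝ (e q.1)) q.2 (v q) (v q)) Ω :=
    fun {e} v hv he => ((contDiffOn_fderiv_slice hΩ (g := fun β => fderiv ℝ (e β))
      (contDiffOn_fderiv_slice hΩ he)).continuousOn.clm_apply hv).clm_apply hv
  exact ((((hj 4).mul ((hj 4).const_mul a |>.add ((hj 2).const_mul b))).add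
    ((hj 5).mul ((hj 5).const_mul a |>.add ((hj 3).const_mul b)))).mul
      (hd (e := fun β => coefM (g β)) hr hM)).sub
    ((((hj 2).mul ((hj 4).const_mul a |>.add ((hj 2).const_mul b))).add
    ((hj 3).mul ((hj 5).const_mul a |>.add ((hj 3).const_mul b)))).mul
      (hd (e := fun β => coefN (g β)) hr hN))

theorem smoothUmbilicAt_of_mem (hΩ : IsOpen Ω)
    (h : ContDiffOn ℝ ((n + 4 : ℕ) : WithTop ℕ∞) (fun q : X × Plane => g q.1 q.2) Ω)
    (him : ∀ q ∈ Ω, Immersive (g q.1) q.2) {β : X} {x : Plane} (hq : (β, x) ∈ Ω)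
    (hM : coefM (g β) x = 0) (hN : coefN (g β) x = 0) : SmoothUmbilicAt (g β) x := by
  obtain ⟨cL, cM, cN⟩ := contDiffOn_coef (n := n + 2) hΩ h him
  have hle : (2 : WithTop ℕ∞) ≤ ((n + 2 : ℕ) : WithTop ℕ∞) := by norm_cast; omega
  have hle' : (2 : WithTop ℕ∞) ≤ ((n + 3 : ℕ) : WithTop ℕ∞) := by norm_cast; omega
  have hle'' : (2 : WithTop ℕ∞) ≤ ((n + 4 : ℕ) : WithTop ℕ∞) := by norm_cast; omega
  exact
    { contL := (contDiffAt_slice (g := fun β => coefL (g β)) hΩ cL hq).of_le hle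
      contM := (contDiffAt_slice (g := fun β => coefM (g β)) hΩ cM hq).of_le hle
      contN := (contDiffAt_slice (g := fun β => coefN (g β)) hΩ cN hq).of_le hle
      zeroL := coefL_eq_zero (him _ hq) hM hN
      zeroM := hM
      zeroN := hN
      umbilic := (locUmbilic_iff ((contDiffAt_slice hΩ h hq).of_le hle'') (him _ hq)).2 ⟨hM, hN⟩
      immersive := him _ hq
      contFirst := fun i j => (contDiffAt_slice (g := fun β y => firstForm (g β) y i j) hΩ
        (contDiffOn_firstForm hΩ h i j) hq).of_le hle' }

end Family

/-! ### Perturbations of an immersion with prescribed second derivatives -/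

section Perturbation

variable {M : Type*} [TopologicalSpace M] [T2Space M] [ChartedSpace Plane M]
  [IsManifold (𝓡 2) ∞ M] {r : ℕ}

/-- Cutting off with a bump function supported in the chart extends a local perturbation to all of M
without changing its germ. -/
theorem exists_crMap_eventuallyEq {φ : OpenPartialHomeomorph M Plane}
    (hφ : φ ∈ IsManifold.maximalAtlas (𝓡 2) ∞ M) {p : M} (hp : p ∈ φ.source)
    {Q : Plane → Space} (hQ : ContDiff ℝ ∞ Q) :
    ∃ γ : CrMap M r, γ ∘ φ.symm =ᶠ[𝓝 (φ p)] Q := by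
  obtain ⟨χ, -, hχ⟩ := (SmoothBumpFunction.nhds_basis_tsupport (I := 𝓡 2) p).mem_iff.1
    (φ.open_source.mem_nhds hp)
  have hsm : ContMDiff (𝓡 2) 𝓘(ℝ, Space) ∞ fun x => χ x • Q (φ x) := by
    refine contMDiff_of_tsupport fun x hx => ?_
    have hxs : x ∈ φ.source := hχ (tsupport_smul_subset_left χ _ hx)
    have h1 : ContMDiffAt (𝓡 2) 𝓘(ℝ, Space) ∞ (fun x => Q (φ x)) x :=
      ContMDiffAt.comp x hQ.contMDiff.contMDiffAt
        (contMDiffAt_of_mem_maximalAtlas hφ hxs)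
    exact χ.contMDiffAt.smul h1
  refine ⟨⟨fun x => χ x • Q (φ x), hsm.of_le (by exact_mod_cast le_top)⟩, ?_⟩
  have h1 : ∀ᶠ y in 𝓝 (φ p), χ (φ.symm y) = 1 := by
    have h2 : ContinuousAt φ.symm (φ p) := φ.continuousAt_symm (φ.map_source hp)
    have h3 : ∀ᶠ x in 𝓝 (φ.symm (φ p)), χ x = 1 := by
      rw [φ.left_inv hp]
      exact χ.eventuallyEq_one
    exact h2.eventually h3
  filter_upwards [h1, φ.open_target.mem_nhds (φ.map_source hp)] with y hy hyt
  change χ (φ.symm y) • Q (φ (φ.symm y)) = Q y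
  rw [hy, one_smul, φ.right_inv hyt]

end Perturbation

/-! ### The effect of a normal perturbation on the torsion form -/

/-- The quadratic polynomial `b u v - c v² / 2` at `x₀`, as a vector field in direction `n`. -/
def bend (b c : ℝ) (n : Space) (x₀ x : Plane) : Space :=
  (b * ((x 0 - x₀ 0) * (x 1 - x₀ 1)) - c / 2 * (x 1 - x₀ 1) ^ 2) • n

theorem contDiff_bend (b c : ℝ) (n : Space) (x₀ : Plane) : ContDiff ℝ ∞ (bend b c n x₀) := by
  unfold bend
  fun_prop

theorem partialD_bend (b c : ℝ) (n : Space) (x₀ : Plane) :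
    partialD 0 (bend b c n x₀) = (fun x => (b * (x 1 - x₀ 1)) • n) ∧
    partialD 1 (bend b c n x₀) = fun x => (b * (x 0 - x₀ 0) - c * (x 1 - x₀ 1)) • n := by
  have hd : ∀ (x : Plane) (i : Fin 2), HasFDerivAt (fun x : Plane => x i - x₀ i)
      (EuclideanSpace.proj (𝕜 := ℝ) i : Plane →L[ℝ] ℝ) x := fun x i =>
    (EuclideanSpace.proj (𝕜 := ℝ) i : Plane →L[ℝ] ℝ).hasFDerivAt.sub_const _
  have h : ∀ x, HasFDerivAt (bend b c n x₀) _ x := fun x =>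
    (((((hd x 0).mul (hd x 1)).const_mul b).sub (((hd x 1).pow 2).const_mul (c / 2))).smul_const n)
  constructor <;> funext x <;> rw [partialD, (h x).fderiv] <;> simp
  congr 1; ring

theorem partialD_partialD_bend (b c : ℝ) (n : Space) (x₀ : Plane) :
    partialD 0 (partialD 0 (bend b c n x₀)) x₀ = (0 : ℝ) • n ∧
    partialD 0 (partialD 1 (bend b c n x₀)) x₀ = b • n ∧
    partialD 1 (partialD 1 (bend b c n x₀)) x₀ = -c • n := by
  have hd : ∀ (x : Plane) (i : Fin 2), HasFDerivAt (fun x : Plane => x i - x₀ i)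
      (EuclideanSpace.proj (𝕜 := ℝ) i : Plane →L[ℝ] ℝ) x := fun x i =>
    (EuclideanSpace.proj (𝕜 := ℝ) i : Plane →L[ℝ] ℝ).hasFDerivAt.sub_const _
  have h0 := ((hd x₀ 1).const_mul b).smul_const n
  have h1 := (((hd x₀ 0).const_mul b).sub ((hd x₀ 1).const_mul c)).smul_const n
  have h1' : HasFDerivAt (fun x : Plane => (b * (x 0 - x₀ 0) - c * (x 1 - x₀ 1)) • n) _ x₀ := h1
  rw [(partialD_bend b c n x₀).1, (partialD_bend b c n x₀).2]
  refine ⟨?_, ?_, ?_⟩ <;> rw [partialD]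
  · rw [h0.fderiv]; simp
  · rw [h1'.fderiv]; simp
  · rw [h1'.fderiv]; simp

theorem norm_unitNormal {f : Plane → Space} {x : Plane} (h : Immersive f x) :
    ‖unitNormal f x‖ = 1 := by
  rw [unitNormal, norm_smul, norm_inv, norm_norm, inv_mul_cancel₀ (norm_ne_zero_iff.2 h)]

/-- The bump has zero first derivatives at the point, so the first fundamental form and the normal
are unchanged there. Only the entries f and g of the second form move, by s b and -s c. The pair (M,
N) thus moves along (-c, b), orthogonally to the direction (b, c) that will be the image of its
differential. -/
theorem coef_add_smul_bend {f q : Plane → Space} {x : Plane} (hf : ContDiffAt ℝ 2 f x)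
    (hq : ContDiffAt ℝ 2 q x) (him : Immersive f x) {b c : ℝ}
    (hQ : q =ᶠ[𝓝 x] bend b c (unitNormal f x) x) (s : ℝ) :
    coefM (f + s • q) x = coefM f x - s * (firstForm f x 0 0 * c) ∧
    coefN (f + s • q) x = coefN f x + s * (firstForm f x 0 0 * b) := by
  have hsq : ContDiffAt ℝ 2 (s • q) x := hq.const_smul s
  have hq0 : ∀ i : Fin 2, partialD i q x = 0 := by
    intro i
    have h1 : partialD i q x = partialD i (bend b c (unitNormal f x) x) x := by
      rw [partialD, hQ.fderiv_eq, partialD]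
    rw [h1]
    fin_cases i
    · exact (congrFun (partialD_bend b c (unitNormal f x) x).1 x).trans (by simp)
    · exact (congrFun (partialD_bend b c (unitNormal f x) x).2 x).trans (by simp)
  have h1 : ∀ i, partialD i (f + s • q) x = partialD i f x := by
    intro i
    have h2 : fderiv ℝ (f + s • q) x = fderiv ℝ f x + s • fderiv ℝ q x := by
      rw [fderiv_add (hf.differentiableAt (by simp)) (hsq.differentiableAt (by simp)),
        fderiv_const_smul (hq.differentiableAt (by simp))]
    have h3 := hq0 i
    rw [partialD] at h3 ⊢
    rw [h2, partialD, add_apply, smul_apply, h3, smul_zero, add_zero]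
  have hI : ∀ i j, firstForm (f + s • q) x i j = firstForm f x i j := fun i j => by
    simp only [firstForm, Matrix.of_apply, h1]
  have hn : unitNormal (f + s • q) x = unitNormal f x := by simp only [unitNormal, h1]
  have h4 : fderiv ℝ (fderiv ℝ (f + s • q)) x =
      fderiv ℝ (fderiv ℝ f) x + s • fderiv ℝ (fderiv ℝ q) x := by
    have h5 : fderiv ℝ (f + s • q) =ᶠ[𝓝 x] fderiv ℝ f + s • fderiv ℝ q := by
      filter_upwards [hf.eventually_differentiableAt, hq.eventually_differentiableAt] with y hy hy'
      rw [fderiv_add hy (hy'.const_smul s), fderiv_const_smul hy']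
      rfl
    rw [h5.fderiv_eq, fderiv_add hf.differentiableAt_fderiv
      (hq.differentiableAt_fderiv.const_smul s), fderiv_const_smul hq.differentiableAt_fderiv]
  have hQ2 : ContDiffAt ℝ 2 (bend b c (unitNormal f x) x) x :=
    (contDiff_bend _ _ _ _).contDiffAt.of_le (WithTop.coe_le_coe.2 (le_top : (2 : ℕ∞) ≤ ⊤))
  have hII : ∀ i j t, partialD i (partialD j (bend b c (unitNormal f x) x)) x =
      t • unitNormal f x → secondForm (f + s • q) x i j = secondForm f x i j + s * t := by
    intro i j t ht
    have h6 : partialD i (partialD j (f + s • q)) x =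
        partialD i (partialD j f) x + s • (t • unitNormal f x) := by
      have h7 : ContDiffAt ℝ 2 (f + s • q) x := hf.add hsq
      rw [partialD_partialD h7, partialD_partialD hf, h4, ← ht, partialD_partialD hQ2,
        hQ.fderiv.fderiv_eq]
      rfl
    simp only [secondForm, Matrix.of_apply, hn, h6, inner_add_right, real_inner_smul_right,
      real_inner_self_eq_norm_sq, norm_unitNormal him]
    ring
  obtain ⟨h00, h01, h11⟩ := partialD_partialD_bend b c (unitNormal f x) x
  simp only [coefM, coefN, hI, hII _ _ _ h00, hII _ _ _ h01, hII _ _ _ h11]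
  constructor <;> ring

/-! ### Coordinates adapted to a fold -/

/-- The point with coordinates `(t, y)` in the orthogonal frame `rot ξ`, `ξ` at `x₀`. -/
def framePt (x₀ ξ : Plane) (w : ℝ × ℝ) : Plane := x₀ + (w.1 • rot ξ + w.2 • ξ)

/-- The coordinates of a point in the frame `rot ξ`, `ξ` at `x₀`. -/
def frameCoord (x₀ ξ x : Plane) : ℝ × ℝ :=
  ((-((x - x₀) 0 * ξ 1) + (x - x₀) 1 * ξ 0) / (ξ 0 ^ 2 + ξ 1 ^ 2),
    ((x - x₀) 0 * ξ 0 + (x - x₀) 1 * ξ 1) / (ξ 0 ^ 2 + ξ 1 ^ 2))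

theorem framePt_frameCoord {ξ : Plane} (hξ : ξ ≠ 0) (x₀ x : Plane) :
    framePt x₀ ξ (frameCoord x₀ ξ x) = x := by
  rw [framePt, frameCoord, ← eq_smul_rot hξ, add_sub_cancel]

theorem frameCoord_framePt {ξ : Plane} (hξ : ξ ≠ 0) (x₀ : Plane) (w : ℝ × ℝ) :
    frameCoord x₀ ξ (framePt x₀ ξ w) = w := by
  have := (normSq_pos hξ).ne'
  ext <;> simp [frameCoord, framePt] <;> field_simp <;> ring

theorem continuous_frameCoord (x₀ ξ : Plane) : Continuous (frameCoord x₀ ξ) := by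
  unfold frameCoord
  fun_prop

/-- The parameter together with the point of the plane that has the given frame coordinates. -/
def frameMap (X : Type*) (x₀ ξ : Plane) (q : (X × ℝ) × ℝ) : X × Plane :=
  (q.1.1, framePt x₀ ξ (q.1.2, q.2))

theorem frameMap_zero {X : Type*} (x₀ ξ : Plane) (β : X) : frameMap X x₀ ξ ((β, 0), 0) = (β, x₀) := by
  simp [frameMap, framePt]

section Frame

variable {X : Type*} [NormedAddCommGroup X] [NormedSpace ℝ X] {x₀ ξ : Plane}

theorem contDiff_frameMap {k : WithTop ℕ∞} : ContDiff ℝ k (frameMap X x₀ ξ) := by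
  unfold frameMap framePt
  fun_prop

theorem fderiv_comp_frameMap {e : X → Plane → ℝ} {q : (X × ℝ) × ℝ}
    (h : DifferentiableAt ℝ (fun z : X × Plane => e z.1 z.2) (frameMap X x₀ ξ q)) (s t : ℝ) :
    fderiv ℝ (fun q => e (frameMap X x₀ ξ q).1 (frameMap X x₀ ξ q).2) q ((0, s), t) =
      fderiv ℝ (e (frameMap X x₀ ξ q).1) (frameMap X x₀ ξ q).2 (s • rot ξ + t • ξ) := by
  have h1 : HasFDerivAt (frameMap X x₀ ξ)
      (((ContinuousLinearMap.fst ℝ X ℝ).comp (ContinuousLinearMap.fst ℝ (X × ℝ) ℝ)).prod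
        ((((ContinuousLinearMap.snd ℝ X ℝ).comp (ContinuousLinearMap.fst ℝ (X × ℝ) ℝ)).smulRight
          (rot ξ)) + (ContinuousLinearMap.snd ℝ (X × ℝ) ℝ).smulRight ξ)) q := by
    refine HasFDerivAt.prodMk ((ContinuousLinearMap.fst ℝ X ℝ).comp
      (ContinuousLinearMap.fst ℝ (X × ℝ) ℝ)).hasFDerivAt ?_
    refine HasFDerivAt.const_add x₀ (HasFDerivAt.add ?_ ?_)
    · exact ContinuousLinearMap.hasFDerivAt (((ContinuousLinearMap.snd ℝ X ℝ).comp
        (ContinuousLinearMap.fst ℝ (X × ℝ) ℝ)).smulRight (rot ξ))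
    · exact ContinuousLinearMap.hasFDerivAt
        ((ContinuousLinearMap.snd ℝ (X × ℝ) ℝ).smulRight ξ)
  have h2 : HasFDerivAt (fun q => e (frameMap X x₀ ξ q).1 (frameMap X x₀ ξ q).2) _ q :=
    HasFDerivAt.comp q (f := frameMap X x₀ ξ) h.hasFDerivAt h1
  have h3 := hasFDerivAt_slice (g := e) (β := (frameMap X x₀ ξ q).1) (x := (frameMap X x₀ ξ q).2) h
  rw [h3.fderiv, h2.fderiv]
  simp

theorem jac_comp_frameMap {M N : X → Plane → ℝ} {q : (X × ℝ) × ℝ}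
    (hM : DifferentiableAt ℝ (fun z : X × Plane => M z.1 z.2) (frameMap X x₀ ξ q))
    (hN : DifferentiableAt ℝ (fun z : X × Plane => N z.1 z.2) (frameMap X x₀ ξ q)) (b c ε : ℝ) :
    jac (fun q => c * N (frameMap X x₀ ξ q).1 (frameMap X x₀ ξ q).2 +
        b * M (frameMap X x₀ ξ q).1 (frameMap X x₀ ξ q).2)
      (fun q => ε * (b * N (frameMap X x₀ ξ q).1 (frameMap X x₀ ξ q).2 -
        c * M (frameMap X x₀ ξ q).1 (frameMap X x₀ ξ q).2)) q =
    ε * (b ^ 2 + c ^ 2) *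
      (fderiv ℝ (N (frameMap X x₀ ξ q).1) (frameMap X x₀ ξ q).2 (rot ξ) *
        fderiv ℝ (M (frameMap X x₀ ξ q).1) (frameMap X x₀ ξ q).2 ξ -
      fderiv ℝ (N (frameMap X x₀ ξ q).1) (frameMap X x₀ ξ q).2 ξ *
        fderiv ℝ (M (frameMap X x₀ ξ q).1) (frameMap X x₀ ξ q).2 (rot ξ)) := by
  have hA := (contDiff_frameMap (X := X) (x₀ := x₀) (ξ := ξ) (k := 1)).differentiable (by simp) q
  have hM' : DifferentiableAt ℝ
      (fun q => M (frameMap X x₀ ξ q).1 (frameMap X x₀ ξ q).2) q :=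
    DifferentiableAt.comp q (f := frameMap X x₀ ξ) hM hA
  have hN' : DifferentiableAt ℝ
      (fun q => N (frameMap X x₀ ξ q).1 (frameMap X x₀ ξ q).2) q :=
    DifferentiableAt.comp q (f := frameMap X x₀ ξ) hN hA
  have e1 := fderiv_comp_frameMap hM 1 0
  have e2 := fderiv_comp_frameMap hM 0 1
  have e3 := fderiv_comp_frameMap hN 1 0
  have e4 := fderiv_comp_frameMap hN 0 1
  simp only [one_smul, zero_smul, add_zero, zero_add, ← Prod.zero_eq_mk] at e1 e2 e3 e4
  simp only [jac]
  rw [fderiv_fun_add (hN'.const_mul c) (hM'.const_mul b), fderiv_const_mul hN', fderiv_const_mul hM',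
    fderiv_const_mul ((hN'.const_mul b).fun_sub (hM'.const_mul c)),
    fderiv_fun_sub (hN'.const_mul b) (hM'.const_mul c), fderiv_const_mul hN', fderiv_const_mul hM']
  simp only [add_apply, sub_apply, smul_apply, smul_eq_mul, e1, e2, e3, e4]
  ring

end Frame

/-- Expresses the Jacobian in the frame `rot ξ`, ξ through `jacNM`. The minus sign exchanges the
roles of the signs when the types D₂ and D₃ are assigned. -/
theorem jacNM_jet1 (f : Plane → Space) (x ξ : Plane) :
    fderiv ℝ (coefN f) x (rot ξ) * fderiv ℝ (coefM f) x ξ -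
      fderiv ℝ (coefN f) x ξ * fderiv ℝ (coefM f) x (rot ξ) =
    -((ξ 0 ^ 2 + ξ 1 ^ 2) * jacNM (jet1 f x)) := by
  rw [clm_plane_apply _ (rot ξ), clm_plane_apply _ ξ, clm_plane_apply _ (rot ξ),
    clm_plane_apply _ ξ]
  simp [jacNM, jet1]
  ring

/-! ### The bifurcation function in a chart -/

section Fold

variable {X : Type*} [NormedAddCommGroup X] [NormedSpace ℝ X]

/-- Zeros of the pair `M`, `N` near a fold of the map `(M, N)` of the plane. -/
theorem exists_planar_fold {M N : X → Plane → ℝ} {Ω : Set (X × Plane)} {m : ℕ} (hΩ : IsOpen Ω)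
    (hM : ContDiffOn ℝ ((m + 2 : ℕ) : WithTop ℕ∞) (fun q : X × Plane => M q.1 q.2) Ω)
    (hN : ContDiffOn ℝ ((m + 2 : ℕ) : WithTop ℕ∞) (fun q : X × Plane => N q.1 q.2) Ω)
    {α : X} {x₀ : Plane} (h0 : (α, x₀) ∈ Ω) (hM0 : M α x₀ = 0) (hN0 : N α x₀ = 0)
    {b c ε : ℝ} {ξ : Plane} (hξ : ξ ≠ 0)
    (hdM : ∀ u : Plane, fderiv ℝ (M α) x₀ u = b * (u 0 * ξ 0 + u 1 * ξ 1))
    (hdN : ∀ u : Plane, fderiv ℝ (N α) x₀ u = c * (u 0 * ξ 0 + u 1 * ξ 1))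
    (hε : 0 < ε * (b * fderiv ℝ (fderiv ℝ (N α)) x₀ (rot ξ) (rot ξ) -
      c * fderiv ℝ (fderiv ℝ (M α)) x₀ (rot ξ) (rot ξ))) {γ : X} {κ : ℝ} (hκ : κ ≠ 0)
    (hγM : ∀ s : ℝ, M (α + s • γ) x₀ = -(s * (κ * c)))
    (hγN : ∀ s : ℝ, N (α + s • γ) x₀ = s * (κ * b)) :
    ∃ (𝒱 : Set X) (V : Set Plane) (B : X → ℝ), IsOpen 𝒱 ∧ α ∈ 𝒱 ∧ IsOpen V ∧ x₀ ∈ V ∧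
      (∀ β ∈ 𝒱, ∀ x ∈ V, (β, x) ∈ Ω) ∧
      ContDiffOn ℝ ((m + 1 : ℕ) : WithTop ℕ∞) B 𝒱 ∧ fderiv ℝ B α ≠ 0 ∧
      ∀ β ∈ 𝒱,
        (0 < B β → {x ∈ V | M β x = 0 ∧ N β x = 0} = ∅) ∧
        (B β = 0 → ∃ x, {x ∈ V | M β x = 0 ∧ N β x = 0} = {x} ∧
          fderiv ℝ (N β) x (rot ξ) * fderiv ℝ (M β) x ξ -
            fderiv ℝ (N β) x ξ * fderiv ℝ (M β) x (rot ξ) = 0) ∧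
        (B β < 0 → ∃ x₁ x₂, x₁ ≠ x₂ ∧ {x ∈ V | M β x = 0 ∧ N β x = 0} = {x₁, x₂} ∧
          fderiv ℝ (N β) x₁ (rot ξ) * fderiv ℝ (M β) x₁ ξ -
            fderiv ℝ (N β) x₁ ξ * fderiv ℝ (M β) x₁ (rot ξ) < 0 ∧
          0 < fderiv ℝ (N β) x₂ (rot ξ) * fderiv ℝ (M β) x₂ ξ -
            fderiv ℝ (N β) x₂ ξ * fderiv ℝ (M β) x₂ (rot ξ)) := by
  have hξ2 := normSq_pos hξ
  have hε0 : ε ≠ 0 := left_ne_zero_of_mul hε.ne'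
  have hbc : 0 < b ^ 2 + c ^ 2 := by
    rcases eq_or_ne b 0 with rfl | hb
    · rcases eq_or_ne c 0 with rfl | hc
      · simp at hε
      · positivity
    · positivity
  set D : X → Plane → ℝ := fun β x => fderiv ℝ (N β) x (rot ξ) * fderiv ℝ (M β) x ξ -
    fderiv ℝ (N β) x ξ * fderiv ℝ (M β) x (rot ξ) with hD
  -- The image of d(M, N) is spanned by (b, c). F is the component along it, with nonzero derivative
  -- in the direction ξ; H is the orthogonal component, with zero differential in the plane. The
  -- sign of ε makes the second derivative of H along `rot ξ` positive, so that the fold is a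
  -- valley.
  set F : (X × ℝ) × ℝ → ℝ := fun q => c * N (frameMap X x₀ ξ q).1 (frameMap X x₀ ξ q).2 +
    b * M (frameMap X x₀ ξ q).1 (frameMap X x₀ ξ q).2 with hF
  set H : (X × ℝ) × ℝ → ℝ := fun q => ε * (b * N (frameMap X x₀ ξ q).1 (frameMap X x₀ ξ q).2 -
    c * M (frameMap X x₀ ξ q).1 (frameMap X x₀ ξ q).2) with hH
  have hA : ∀ k : WithTop ℕ∞, ContDiff ℝ k (frameMap X x₀ ξ) := fun k => contDiff_frameMap
  have hΩ' : IsOpen (frameMap X x₀ ξ ⁻¹' Ω) := hΩ.preimage (hA 0).continuous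
  have hdiff : ∀ {e : X → Plane → ℝ} {k : ℕ},
      ContDiffOn ℝ ((k + 1 : ℕ) : WithTop ℕ∞) (fun q : X × Plane => e q.1 q.2) Ω →
      ∀ q ∈ Ω, DifferentiableAt ℝ (fun q : X × Plane => e q.1 q.2) q := fun h q hq =>
    (h.contDiffAt (hΩ.mem_nhds hq)).differentiableAt (by simp)
  have hcomp : ∀ {e : X → Plane → ℝ} {k : WithTop ℕ∞},
      ContDiffOn ℝ k (fun q : X × Plane => e q.1 q.2) Ω →
      ContDiffOn ℝ k (fun q => e (frameMap X x₀ ξ q).1 (frameMap X x₀ ξ q).2)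
        (frameMap X x₀ ξ ⁻¹' Ω) := fun h => h.comp (hA _).contDiffOn fun q hq => hq
  have hjac : ∀ q ∈ frameMap X x₀ ξ ⁻¹' Ω, jac F H q =
      ε * (b ^ 2 + c ^ 2) * D (frameMap X x₀ ξ q).1 (frameMap X x₀ ξ q).2 := fun q hq =>
    jac_comp_frameMap (hdiff hM _ hq) (hdiff hN _ hq) b c ε
  have hFC : ContDiffOn ℝ ((m + 2 : ℕ) : WithTop ℕ∞) F (frameMap X x₀ ξ ⁻¹' Ω) :=
    (contDiffOn_const.mul (hcomp hN)).add (contDiffOn_const.mul (hcomp hM))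
  have hHC : ContDiffOn ℝ ((m + 2 : ℕ) : WithTop ℕ∞) H (frameMap X x₀ ξ ⁻¹' Ω) :=
    contDiffOn_const.mul ((contDiffOn_const.mul (hcomp hN)).sub (contDiffOn_const.mul (hcomp hM)))
  have hz : ((α, 0), 0) ∈ frameMap X x₀ ξ ⁻¹' Ω := by rwa [mem_preimage, frameMap_zero]
  have hzero := frameMap_zero x₀ ξ α
  have hdir : ∀ {e : X → Plane → ℝ}, DifferentiableAt ℝ (fun q : X × Plane => e q.1 q.2) (α, x₀) →
      ∀ s t : ℝ, fderiv ℝ (fun q => e (frameMap X x₀ ξ q).1 (frameMap X x₀ ξ q).2)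
        ((α, 0), 0) ((0, s), t) = fderiv ℝ (e α) x₀ (s • rot ξ + t • ξ) := by
    intro e he s t
    rw [fderiv_comp_frameMap (by rwa [hzero]), hzero]
  have hMs : ContDiffAt ℝ ((m + 2 : ℕ) : WithTop ℕ∞) (M α) x₀ := contDiffAt_slice hΩ hM h0
  have hNs : ContDiffAt ℝ ((m + 2 : ℕ) : WithTop ℕ∞) (N α) x₀ := contDiffAt_slice hΩ hN h0
  have hMd := hMs.differentiableAt (by simp)
  have hNd := hNs.differentiableAt (by simp)
  have hFd : ∀ s t : ℝ, fderiv ℝ F ((α, 0), 0) ((0, s), t) =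
      t * ((b ^ 2 + c ^ 2) * (ξ 0 ^ 2 + ξ 1 ^ 2)) := by
    intro s t
    have h1 := hdir (e := fun β x => c * N β x + b * M β x)
      (((hdiff hN _ h0).const_mul c).fun_add ((hdiff hM _ h0).const_mul b)) s t
    rw [hF, h1, fderiv_fun_add (hNd.const_mul c) (hMd.const_mul b), fderiv_const_mul hNd,
      fderiv_const_mul hMd]
    simp only [add_apply, smul_apply, hdM, hdN, smul_eq_mul]
    simp
    ring
  have hHd : ∀ s t : ℝ, fderiv ℝ H ((α, 0), 0) ((0, s), t) = 0 := by
    intro s t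
    have h1 := hdir (e := fun β x => ε * (b * N β x - c * M β x))
      ((((hdiff hN _ h0).const_mul b).fun_sub ((hdiff hM _ h0).const_mul c)).const_mul ε) s t
    rw [hH, h1, fderiv_const_mul ((hNd.const_mul b).fun_sub (hMd.const_mul c)),
      fderiv_fun_sub (hNd.const_mul b) (hMd.const_mul c), fderiv_const_mul hNd,
      fderiv_const_mul hMd]
    simp only [sub_apply, smul_apply, hdM, hdN, smul_eq_mul]
    ring
  have hJ : 0 < fderiv ℝ (jac F H) ((α, 0), 0) ((0, 1), 0) := by
    have h1 : jac F H =ᶠ[𝓝 ((α, 0), 0)] fun q =>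
        ε * (b ^ 2 + c ^ 2) * D (frameMap X x₀ ξ q).1 (frameMap X x₀ ξ q).2 := by
      filter_upwards [hΩ'.mem_nhds hz] with q hq using hjac q hq
    have h2 : ∀ {e : X → Plane → ℝ} (v : Plane),
        ContDiffOn ℝ ((m + 2 : ℕ) : WithTop ℕ∞) (fun q : X × Plane => e q.1 q.2) Ω →
        ContDiffOn ℝ ((m + 1 : ℕ) : WithTop ℕ∞)
          (fun q : X × Plane => fderiv ℝ (e q.1) q.2 v) Ω := fun v he =>
      (contDiffOn_fderiv_slice hΩ he).clm_apply contDiffOn_const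
    have h3 : DifferentiableAt ℝ (fun q : X × Plane => ε * (b ^ 2 + c ^ 2) * D q.1 q.2) (α, x₀) :=
      ((((hdiff (e := fun β x => fderiv ℝ (N β) x (rot ξ)) (h2 _ hN) _ h0).fun_mul
        (hdiff (e := fun β x => fderiv ℝ (M β) x ξ) (h2 _ hM) _ h0)).fun_sub
        ((hdiff (e := fun β x => fderiv ℝ (N β) x ξ) (h2 _ hN) _ h0).fun_mul
        (hdiff (e := fun β x => fderiv ℝ (M β) x (rot ξ)) (h2 _ hM) _ h0)))).const_mul _
    rw [h1.fderiv_eq, hdir (e := fun β x => ε * (b ^ 2 + c ^ 2) * D β x) h3, one_smul, zero_smul,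
      add_zero]
    have hle : (2 : WithTop ℕ∞) ≤ ((m + 2 : ℕ) : WithTop ℕ∞) := by norm_cast; omega
    have h4 : ∀ {e : Plane → ℝ} (v : Plane), ContDiffAt ℝ ((m + 2 : ℕ) : WithTop ℕ∞) e x₀ →
        HasFDerivAt (fun x => fderiv ℝ e x v) ((fderiv ℝ (fderiv ℝ e) x₀).flip v) x₀ :=
      fun {e} v he => by
        have h5 := ((he.of_le hle).differentiableAt_fderiv.hasFDerivAt).clm_apply
          (hasFDerivAt_const v x₀)
        simpa using h5
    have h5 := (((h4 (rot ξ) hNs).mul (h4 ξ hMs)).sub ((h4 ξ hNs).mul (h4 (rot ξ) hMs))).const_mul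
      (ε * (b ^ 2 + c ^ 2))
    have h6 : HasFDerivAt (fun x => ε * (b ^ 2 + c ^ 2) * D α x) _ x₀ := h5
    rw [h6.fderiv]
    simp only [add_apply, sub_apply, smul_apply, smul_eq_mul, ContinuousLinearMap.flip_apply, hdM,
      hdN, rot_zero_apply, rot_one_apply]
    have h7 : 0 < (b ^ 2 + c ^ 2) * (ξ 0 ^ 2 + ξ 1 ^ 2) := mul_pos hbc hξ2
    have h8 := mul_pos h7 hε
    refine h8.trans_eq ?_
    ring
  obtain ⟨𝒱, W, B, h𝒱, hα𝒱, hW, hW0, hsub, hB, hBd, hcases⟩ :=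
    exists_fold hΩ' hFC hHC hz (by simp [hF, hzero, hM0, hN0]) (by simp [hH, hzero, hM0, hN0])
      (by
        have := hFd 0 1
        rw [← Prod.zero_eq_mk] at this
        rw [this, one_mul]
        exact mul_pos hbc hξ2) (by rw [hFd, zero_mul])
      (by rw [Prod.zero_eq_mk]; exact hHd 0 1) (hHd 1 0) hJ
  have hset : ∀ β, {x ∈ frameCoord x₀ ξ ⁻¹' W | M β x = 0 ∧ N β x = 0} =
      framePt x₀ ξ '' {w ∈ W | F ((β, w.1), w.2) = 0 ∧ H ((β, w.1), w.2) = 0} := by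
    intro β
    have hiff : ∀ w : ℝ × ℝ, F ((β, w.1), w.2) = 0 ∧ H ((β, w.1), w.2) = 0 ↔
        M β (framePt x₀ ξ w) = 0 ∧ N β (framePt x₀ ξ w) = 0 := by
      intro w
      simp only [hF, hH, frameMap, mul_eq_zero, hε0, false_or]
      constructor
      · rintro ⟨h1, h2⟩
        constructor
        · refine (mul_eq_zero.1 ?_).resolve_left hbc.ne'
          linear_combination b * h1 - c * h2
        · refine (mul_eq_zero.1 ?_).resolve_left hbc.ne'
          linear_combination c * h1 + b * h2
      · rintro ⟨h1, h2⟩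
        simp [h1, h2]
    ext x
    constructor
    · rintro ⟨h1, h2⟩
      refine ⟨frameCoord x₀ ξ x, ⟨h1, (hiff _).2 ?_⟩, framePt_frameCoord hξ x₀ x⟩
      rwa [framePt_frameCoord hξ]
    · rintro ⟨w, ⟨h1, h2⟩, rfl⟩
      exact ⟨by rwa [mem_preimage, frameCoord_framePt hξ], (hiff w).1 h2⟩
  have hmem : ∀ {β : X}, β ∈ 𝒱 → ∀ {w : ℝ × ℝ}, w ∈ W →
      jac F H ((β, w.1), w.2) = ε * (b ^ 2 + c ^ 2) * D β (framePt x₀ ξ w) := fun hβ _ hw =>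
    hjac _ (hsub _ hβ _ hw)
  refine ⟨𝒱, frameCoord x₀ ξ ⁻¹' W, B, h𝒱, hα𝒱, hW.preimage (continuous_frameCoord x₀ ξ), ?_, ?_,
    hB, ?_, fun β hβ => ⟨fun h => ?_, fun h => ?_, fun h => ?_⟩⟩
  · simpa [frameCoord] using hW0
  · intro β hβ x hx
    have h1 := hsub β hβ _ hx
    rwa [mem_preimage, frameMap, framePt_frameCoord hξ] at h1
  · intro hcon
    have h1 := hBd γ
    rw [hcon, zero_apply] at h1
    have h2 : HasDerivAt (fun s : ℝ => (((α + s • γ, 0), 0) : (X × ℝ) × ℝ)) ((γ, 0), 0) 0 := by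
      have h3 : HasDerivAt (fun s : ℝ => α + s • γ) γ 0 := by
        simpa using ((hasDerivAt_id (0 : ℝ)).smul_const γ).const_add α
      exact (h3.prodMk (hasDerivAt_const _ _)).prodMk (hasDerivAt_const _ _)
    have h3 : HasFDerivAt H (fderiv ℝ H ((α, 0), 0)) ((α + (0 : ℝ) • γ, 0), 0) := by
      rw [zero_smul, add_zero]
      exact ((hHC.contDiffAt (hΩ'.mem_nhds hz)).differentiableAt (by simp)).hasFDerivAt
    have h4 := HasFDerivAt.comp_hasDerivAt 0
      (f := fun s : ℝ => (((α + s • γ, 0), 0) : (X × ℝ) × ℝ)) h3 h2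
    -- Along α + s γ the pair (M, N) moves orthogonally to (b, c), so H is linear in s with slope ε
    -- κ (b² + c²) ≠ 0.
    have h5 : (H ∘ fun s : ℝ => (((α + s • γ, 0), 0) : (X × ℝ) × ℝ)) =
        fun s => s * (ε * (κ * (b ^ 2 + c ^ 2))) := by
      funext s
      simp only [Function.comp, hH, frameMap_zero, hγM, hγN]
      ring
    rw [h5] at h4
    have h6 := h4.unique ((hasDerivAt_id (0 : ℝ)).mul_const _)
    rw [← h1, one_mul] at h6
    exact mul_ne_zero hε0 (mul_ne_zero hκ hbc.ne') h6.symm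
  · rw [hset, (hcases β hβ).1 h, image_empty]
  · obtain ⟨w, h1, h2⟩ := (hcases β hβ).2.1 h
    have hw : w ∈ W := (h1.ge (mem_singleton w)).1
    rw [hmem hβ hw] at h2
    exact ⟨framePt x₀ ξ w, by rw [hset, h1, image_singleton],
      (mul_eq_zero.1 h2).resolve_left (mul_ne_zero hε0 hbc.ne')⟩
  · obtain ⟨w₁, w₂, hne, h1, h2, h3⟩ := (hcases β hβ).2.2 h
    have hw1 : w₁ ∈ W := (h1.ge (mem_insert _ _)).1
    have hw2 : w₂ ∈ W := (h1.ge (mem_insert_of_mem _ (mem_singleton _))).1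
    have hinj : Function.Injective (framePt x₀ ξ) :=
      (show Function.LeftInverse (frameCoord x₀ ξ) _ from frameCoord_framePt hξ x₀).injective
    rw [hmem hβ hw1] at h2
    rw [hmem hβ hw2] at h3
    -- The Jacobian of (F, H) is ε (b² + c²) times that of (N, M), so a negative ε interchanges the
    -- two zeros.
    rcases lt_or_gt_of_ne hε0 with hlt | hgt
    · have h4 : ε * (b ^ 2 + c ^ 2) < 0 := mul_neg_of_neg_of_pos hlt hbc
      exact ⟨framePt x₀ ξ w₂, framePt x₀ ξ w₁, hinj.ne hne.symm,
        by rw [hset, h1, image_pair, pair_comm], (neg_iff_neg_of_mul_pos h3).1 h4,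
        (neg_iff_pos_of_mul_neg h2).1 h4⟩
    · have h4 : 0 < ε * (b ^ 2 + c ^ 2) := mul_pos hgt hbc
      exact ⟨framePt x₀ ξ w₁, framePt x₀ ξ w₂, hinj.ne hne,
        by rw [hset, h1, image_pair], (pos_iff_neg_of_mul_neg h2).1 h4,
        (mul_pos_iff_of_pos_left h4).1 h3⟩

end Fold

section Local

variable {X : Type*} [NormedAddCommGroup X] [NormedSpace ℝ X]

/-- The bifurcation of a `D¹₂,₃` umbilic in a smooth family of parametrized surfaces in which the
second fundamental form can be perturbed freely. -/
theorem exists_umbilic_fold {g : X → Plane → Space} {Ω : Set (X × Plane)} {m : ℕ} (hΩ : IsOpen Ω)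
    (h : ContDiffOn ℝ ((m + 4 : ℕ) : WithTop ℕ∞) (fun q : X × Plane => g q.1 q.2) Ω)
    (him : ∀ q ∈ Ω, Immersive (g q.1) q.2) {α : X} {x₀ : Plane} (h0 : (α, x₀) ∈ Ω)
    (hD : LocD123 (g α) x₀)
    (hpert : ∀ b c : ℝ, ∃ γ : X, ∀ s : ℝ,
      coefM (g (α + s • γ)) x₀ = coefM (g α) x₀ - s * (firstForm (g α) x₀ 0 0 * c) ∧
      coefN (g (α + s • γ)) x₀ = coefN (g α) x₀ + s * (firstForm (g α) x₀ 0 0 * b)) :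
    ∃ (𝒱 : Set X) (V : Set Plane) (B : X → ℝ), IsOpen 𝒱 ∧ α ∈ 𝒱 ∧ IsOpen V ∧ x₀ ∈ V ∧
      (∀ β ∈ 𝒱, ∀ x ∈ V, (β, x) ∈ Ω) ∧
      ContDiffOn ℝ ((m + 1 : ℕ) : WithTop ℕ∞) B 𝒱 ∧ fderiv ℝ B α ≠ 0 ∧
      ∀ β ∈ 𝒱,
        (0 < B β → {x ∈ V | LocUmbilic (g β) x} = ∅) ∧
        (B β = 0 → ∃ x, {x ∈ V | LocUmbilic (g β) x} = {x} ∧ LocD123 (g β) x) ∧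
        (B β < 0 → ∃ x₁ x₂, x₁ ≠ x₂ ∧ {x ∈ V | LocUmbilic (g β) x} = {x₁, x₂} ∧
          LocD2 (g β) x₁ ∧ LocD3 (g β) x₂) := by
  have hle : (2 : WithTop ℕ∞) ≤ ((m + 4 : ℕ) : WithTop ℕ∞) := by norm_cast; omega
  have humb : ∀ {β : X} {x : Plane}, (β, x) ∈ Ω →
      (LocUmbilic (g β) x ↔ coefM (g β) x = 0 ∧ coefN (g β) x = 0) := fun hq =>
    locUmbilic_iff ((contDiffAt_slice hΩ h hq).of_le hle) (him _ hq)
  obtain ⟨hM0, hN0⟩ := (humb h0).1 hD.1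
  have hS := smoothUmbilicAt_of_mem hΩ h him h0 hM0 hN0
  obtain ⟨w₁, w₂, w₃, a, b, c, ξ, hw, hξ, hj, hne⟩ := hS.exists_of_locD123 hD
  have hξ2 := normSq_pos hξ
  have hbc : 0 < b ^ 2 + c ^ 2 := by
    rcases eq_or_ne b 0 with rfl | hb
    · rcases eq_or_ne c 0 with rfl | hc
      · simp at hne
      · positivity
    · positivity
  -- With the parameters c, b the factor in `foldNumber_eq` becomes (c² + b²)³, which is nonzero at
  -- α. The same numbers are kept for all nearby immersions.
  have hΦ : foldNumber (g α) x₀ c b ≠ 0 := by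
    rw [foldNumber_eq hj]
    exact mul_ne_zero (mul_ne_zero (pow_ne_zero 3 (by nlinarith)) hξ2.ne') hne
  have hev : ∀ᶠ q : X × Plane in 𝓝 (α, x₀), q ∈ Ω ∧ (∃ v₁ v₂ v₃, GoodDirs (jet1 (g q.1) q.2) v₁ v₂ v₃) ∧
      foldNumber (g q.1) q.2 c b ≠ 0 :=
    (hΩ.eventually_mem h0).and
      ((((continuousOn_jet1 (n := m + 1) hΩ h him).continuousAt (hΩ.mem_nhds h0)).eventually
        hw.eventually).and
      (((continuousOn_foldNumber hΩ h him c b).continuousAt (hΩ.mem_nhds h0)).eventually_ne hΦ))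
  -- On Ω' the cubic keeps three good roots and the fold number stays nonzero, so the Jacobian alone
  -- decides the type of each umbilic point there.
  obtain ⟨Ω', hsub, hΩ', h0'⟩ := eventually_nhds_iff.1 hev
  have hΩsub : Ω' ⊆ Ω := fun q hq => (hsub q hq).1
  obtain ⟨-, hM, hN⟩ := contDiffOn_coef (n := m + 2) hΩ' (h.mono hΩsub) fun q hq => him q (hΩsub hq)
  obtain ⟨γ, hγ⟩ := hpert b c
  obtain ⟨ε, hε⟩ : ∃ ε : ℝ, 0 < ε * (b * fderiv ℝ (fderiv ℝ (coefN (g α))) x₀ (rot ξ) (rot ξ) -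
      c * fderiv ℝ (fderiv ℝ (coefM (g α))) x₀ (rot ξ) (rot ξ)) :=
    ⟨_, mul_self_pos.2 fun hc => hne (by linarith)⟩
  obtain ⟨𝒱, V, B, h𝒱, hα, hV, hx, hmem, hB, hdB, hcases⟩ :=
    exists_planar_fold (M := fun β => coefM (g β)) (N := fun β => coefN (g β)) hΩ' hM hN h0'
      hM0 hN0 hξ (fun u => (fderiv_of_jet1 hj u).2.1) (fun u => (fderiv_of_jet1 hj u).2.2) hε
      (gram_pos (him _ h0)).1.ne' (γ := γ) (fun s => by rw [(hγ s).1, hM0]; ring)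
      (fun s => by rw [(hγ s).2, hN0]; ring)
  have hset : ∀ β ∈ 𝒱, {x ∈ V | LocUmbilic (g β) x} =
      {x ∈ V | coefM (g β) x = 0 ∧ coefN (g β) x = 0} := fun β hβ => by
    ext x
    exact and_congr_right fun hxV => humb (hΩsub (hmem β hβ x hxV))
  have hsm : ∀ β ∈ 𝒱, ∀ x ∈ {x ∈ V | coefM (g β) x = 0 ∧ coefN (g β) x = 0},
      SmoothUmbilicAt (g β) x := fun β hβ x hxs =>
    smoothUmbilicAt_of_mem hΩ h him (hΩsub (hmem β hβ x hxs.1)) hxs.2.1 hxs.2.2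
  simp only [jacNM_jet1] at hcases
  refine ⟨𝒱, V, B, h𝒱, hα, hV, hx, fun β hβ x hxV => hΩsub (hmem β hβ x hxV), hB, hdB,
    fun β hβ => ?_⟩
  rw [hset β hβ]
  obtain ⟨hpos, hzero, hneg⟩ := hcases β hβ
  refine ⟨hpos, fun hb => ?_, fun hb => ?_⟩
  · obtain ⟨x, hs, hJ⟩ := hzero hb
    have hxs := hs.ge (mem_singleton x)
    obtain ⟨-, ⟨v₁, v₂, v₃, hv⟩, hfold⟩ := hsub _ (hmem β hβ x hxs.1)
    exact ⟨x, hs, (hsm β hβ x hxs).locD123 hv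
      ((mul_eq_zero.1 (neg_eq_zero.1 hJ)).resolve_left hξ2.ne') hfold⟩
  · obtain ⟨x₁, x₂, hne, hs, hJ₁, hJ₂⟩ := hneg hb
    have hxs₁ := hs.ge (mem_insert x₁ _)
    have hxs₂ := hs.ge (mem_insert_of_mem x₁ (mem_singleton x₂))
    obtain ⟨-, ⟨u₁, u₂, u₃, hu⟩, -⟩ := hsub _ (hmem β hβ x₁ hxs₁.1)
    obtain ⟨-, ⟨v₁, v₂, v₃, hv⟩, -⟩ := hsub _ (hmem β hβ x₂ hxs₂.1)
    exact ⟨x₁, x₂, hne, hs,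
      (hsm β hβ x₁ hxs₁).locD2 hu ((mul_pos_iff_of_pos_left hξ2).1 (neg_neg_iff_pos.1 hJ₁)),
      (hsm β hβ x₂ hxs₂).locD3 hv ((pos_iff_neg_of_mul_neg (neg_pos.1 hJ₂)).1 hξ2)⟩

end Local

end UmbilicBifurcation

end

/-! ### From the chart to the surface. -/

theorem mainTheorem5 {M : Type*} [TopologicalSpace M] [T2Space M] [CompactSpace M]
    [ChartedSpace UmbilicBifurcation.Plane M] [IsManifold (𝓡 2) ∞ M]
    (r : ℕ) (hr : 5 ≤ r) (α : UmbilicBifurcation.CrMap M r)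
    (hα : α ∈ UmbilicBifurcation.immersions M r)
    (p : M) (hp : UmbilicBifurcation.IsD123 α p) :
    ∃ (𝒱 : Set (UmbilicBifurcation.CrMap M r)) (V : Set M)
      (B : UmbilicBifurcation.CrMap M r → ℝ),
      IsOpen 𝒱 ∧ α ∈ 𝒱 ∧ 𝒱 ⊆ UmbilicBifurcation.immersions M r ∧
      IsOpen V ∧ p ∈ V ∧
      ContDiffOn ℝ ((r - 3 : ℕ) : WithTop ℕ∞) B 𝒱 ∧
      fderiv ℝ B α ≠ 0 ∧
      ∀ β ∈ 𝒱,
        (0 < B β ↔ UmbilicBifurcation.umbilicSet β ∩ V = ∅) ∧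
        (B β < 0 ↔ ∃ q₁ q₂ : M, q₁ ≠ q₂ ∧
          UmbilicBifurcation.umbilicSet β ∩ V = {q₁, q₂} ∧
          UmbilicBifurcation.IsD2 β q₁ ∧ UmbilicBifurcation.IsD3 β q₂) ∧
        (B β = 0 ↔ ∃ q : M,
          UmbilicBifurcation.umbilicSet β ∩ V = {q} ∧ UmbilicBifurcation.IsD123 β q) := by
  -- In these terms M and N are of class C^(m + 2), and r - 3 is m + 1.
  obtain ⟨m, rfl⟩ : ∃ m, r = m + 4 := ⟨r - 4, by omega⟩
  obtain ⟨φ, hφ, hpφ, hD⟩ := hp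
  obtain ⟨U, hU, hpU, hUφ, hev⟩ := UmbilicBifurcation.exists_contDiffOn_eval (r := m + 4) hφ hpφ
  have himm : ∀ {β : UmbilicBifurcation.CrMap M (m + 4)} {q : M},
      β ∈ UmbilicBifurcation.immersions M (m + 4) → q ∈ φ.source →
      UmbilicBifurcation.Immersive (β ∘ φ.symm) (φ q) := fun {β q} hβ hq =>
    UmbilicBifurcation.injective_fderiv_iff_immersive.1
      ((UmbilicBifurcation.injective_mfderiv_iff (by omega) β hφ hq).1 (hβ q))
  have hcont : ∀ β : UmbilicBifurcation.CrMap M (m + 4), ContDiffAt ℝ 2 (β ∘ φ.symm) (φ p) :=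
    fun β => ((UmbilicBifurcation.contDiffOn_comp_symm β hφ).contDiffAt
      (φ.open_target.mem_nhds (φ.map_source hpφ))).of_le (by norm_cast; omega)
  have hUopen : IsOpen ((Set.univ : Set (UmbilicBifurcation.CrMap M (m + 4))) ×ˢ U) :=
    isOpen_univ.prod hU
  obtain ⟨𝒱, V, B, h𝒱, hα𝒱, hV, hpV, hmem, hB, hdB, hcases⟩ :=
    UmbilicBifurcation.exists_umbilic_fold (m := m)
      (g := fun β : UmbilicBifurcation.CrMap M (m + 4) => β ∘ φ.symm)
      (UmbilicBifurcation.isOpen_immersive (n := m + 3)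
        (g := fun β : UmbilicBifurcation.CrMap M (m + 4) => β ∘ φ.symm) hUopen hev)
      (hev.mono Set.inter_subset_left) (fun q hq => hq.2) (α := α) (x₀ := φ p)
      ⟨⟨Set.mem_univ _, hpU⟩, himm hα hpφ⟩ hD (fun b c => by
        obtain ⟨γ, hγ⟩ := UmbilicBifurcation.exists_crMap_eventuallyEq (r := m + 4) hφ hpφ
          (UmbilicBifurcation.contDiff_bend b c
            (UmbilicBifurcation.unitNormal (α ∘ φ.symm) (φ p)) (φ p))
        exact ⟨γ, fun s => UmbilicBifurcation.coef_add_smul_bend (hcont α) (hcont γ)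
          (himm hα hpφ) hγ s⟩)
  obtain ⟨𝒲, h𝒲, h𝒲o, hα𝒲⟩ :=
    mem_nhds_iff.1 (UmbilicBifurcation.immersions_mem_nhds (by omega) hα)
  refine ⟨𝒱 ∩ 𝒲, φ.source ∩ φ ⁻¹' V, B, h𝒱.inter h𝒲o, ⟨hα𝒱, hα𝒲⟩,
    fun β hβ => h𝒲 hβ.2, φ.isOpen_inter_preimage hV, ⟨hpφ, hpV⟩, hB.mono Set.inter_subset_left,
    hdB, fun β hβ => ?_⟩
  have hVφ : V ⊆ φ.target := fun x hx => hUφ (hmem β hβ.1 x hx).1.2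
  have hset : UmbilicBifurcation.umbilicSet β ∩ (φ.source ∩ φ ⁻¹' V) =
      φ.symm '' {x ∈ V | UmbilicBifurcation.LocUmbilic (β ∘ φ.symm) x} := by
    ext q
    constructor
    · rintro ⟨hq, hqφ, hqV⟩
      exact ⟨φ q, ⟨hqV, (UmbilicBifurcation.mem_umbilicSet_iff (by omega) (h𝒲 hβ.2) hφ hqφ).1 hq⟩,
        φ.left_inv hqφ⟩
    · rintro ⟨x, ⟨hxV, hx⟩, rfl⟩
      have hxφ := hVφ hxV
      refine ⟨(UmbilicBifurcation.mem_umbilicSet_iff (by omega) (h𝒲 hβ.2) hφ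
        (φ.map_target hxφ)).2 ?_, φ.map_target hxφ, ?_⟩
      · rwa [φ.right_inv hxφ]
      · rwa [Set.mem_preimage, φ.right_inv hxφ]
  -- The types on M ask for some chart, and φ itself serves; their independence of the chart is not
  -- needed.
  have hchart : ∀ {P : (UmbilicBifurcation.Plane → UmbilicBifurcation.Space) →
      UmbilicBifurcation.Plane → Prop} {x : UmbilicBifurcation.Plane}, x ∈ V →
      P (β ∘ φ.symm) x → UmbilicBifurcation.InChart P β (φ.symm x) := fun {P x} hx hP =>
    ⟨φ, hφ, φ.map_target (hVφ hx), by rwa [φ.right_inv (hVφ hx)]⟩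
  obtain ⟨hpos, hzero, hneg⟩ := hcases β hβ.1
  have hpos' : 0 < B β → UmbilicBifurcation.umbilicSet β ∩ (φ.source ∩ φ ⁻¹' V) = ∅ := fun h => by
    rw [hset, hpos h, Set.image_empty]
  have hzero' : B β = 0 → ∃ q : M,
      UmbilicBifurcation.umbilicSet β ∩ (φ.source ∩ φ ⁻¹' V) = {q} ∧
        UmbilicBifurcation.IsD123 β q := fun h => by
    obtain ⟨x, hs, hx⟩ := hzero h
    exact ⟨φ.symm x, by rw [hset, hs, Set.image_singleton],
      hchart (hs.ge (Set.mem_singleton x)).1 hx⟩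
  have hneg' : B β < 0 → ∃ q₁ q₂ : M, q₁ ≠ q₂ ∧
      UmbilicBifurcation.umbilicSet β ∩ (φ.source ∩ φ ⁻¹' V) = {q₁, q₂} ∧
      UmbilicBifurcation.IsD2 β q₁ ∧ UmbilicBifurcation.IsD3 β q₂ := fun h => by
    obtain ⟨x₁, x₂, hne, hs, hx₁, hx₂⟩ := hneg h
    have h₁ := (hs.ge (Set.mem_insert x₁ _)).1
    have h₂ := (hs.ge (Set.mem_insert_of_mem x₁ (Set.mem_singleton x₂))).1
    exact ⟨φ.symm x₁, φ.symm x₂, fun he => hne (φ.symm.injOn (hVφ h₁) (hVφ h₂) he),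
      by rw [hset, hs, Set.image_pair], hchart h₁ hx₁, hchart h₂ hx₂⟩
  -- The converses need only the cardinalities: the three signs give zero, one and two umbilic
  -- points, which exclude each other.
  refine ⟨⟨hpos', fun h => ?_⟩, ⟨hneg', ?_⟩, ⟨hzero', ?_⟩⟩
  · rcases lt_trichotomy (B β) 0 with hb | hb | hb
    · obtain ⟨q₁, q₂, -, hs, -⟩ := hneg' hb
      exact absurd (h ▸ hs).symm (Set.insert_nonempty _ _).ne_empty
    · obtain ⟨q, hs, -⟩ := hzero' hb
      exact absurd (h ▸ hs).symm (Set.singleton_ne_empty q)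
    · exact hb
  · rintro ⟨q₁, q₂, hne, h, -⟩
    rcases lt_trichotomy (B β) 0 with hb | hb | hb
    · exact hb
    · obtain ⟨q, hs, -⟩ := hzero' hb
      rw [hs] at h
      have h₁ : q₁ = q := h.ge (Set.mem_insert q₁ _)
      have h₂ : q₂ = q := h.ge (Set.mem_insert_of_mem q₁ (Set.mem_singleton q₂))
      exact absurd (h₁.trans h₂.symm) hne
    · exact absurd (h ▸ hpos' hb) (Set.insert_nonempty _ _).ne_empty
  · rintro ⟨q, h, -⟩
    rcases lt_trichotomy (B β) 0 with hb | hb | hb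
    · obtain ⟨q₁, q₂, hne, hs, -⟩ := hneg' hb
      rw [h] at hs
      have h₁ : q₁ = q := hs.ge (Set.mem_insert q₁ _)
      have h₂ : q₂ = q := hs.ge (Set.mem_insert_of_mem q₁ (Set.mem_singleton q₂))
      exact absurd (h₁.trans h₂.symm) hne
    · exact hb
    · exact absurd (h ▸ hpos' hb) (Set.singleton_ne_empty q)
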